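/- Let $\mathbb{F}$ be a field of characteristic $0$. An associative interchange algebra is a vector space with two associative bilinear operations $\circ,\bullet$ satisfying $(a\circ b)\bullet(c\circ d)=(a\bullet c)\circ(b\bullet d)$. In the free associative interchange algebra on countably many generators put $[a,b]_\circ=a\circ b-b\circ a$ and $[a,b]_\bullet=a\bullet b-b\bullet a$. Polynomial identities for these brackets are elements of the free nonassociative algebra with two bilinear operation symbols $[-,-]_\circ,[-,-]_\bullet$ that vanish under all substitutions. The consequences of a set of identities are the elements of the ideal generated by all their substitution instances. For $n\ge 0$ let $\mathrm{All}(n)$ be the $S_n$-module of multilinear identities of degree $n$ satisfied by the two brackets, $\mathrm{Old}(n)$ the multilinear consequences in degree $n$ of the elements of $\mathrm{All}(k)$ for $k<n$, and $\mathrm{New}(n)=\mathrm{All}(n)/\mathrm{Old}(n)$. (1) A multilinear polynomial of degree $6$ is an identity satisfied by the two brackets if and only if it is a consequence of: (i) anticommutativity and the Jacobi identity for each of the two brackets; (ii) the following identity, where $\sigma$ runs over all permutations of $\{b,c,d,e\}$, $\epsilon(\sigma)$ is the sign, and $x^\sigma$ is the image of $x$ under $\sigma$: $$ \begin{aligned}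 \sum_{\sigma}\epsilon(\sigma)\Big\{ &2[[ab^\sigma]_\circ[a[c^\sigma[d^\sigma e^\sigma]_\circ]_\bullet]_\circ]_\bullet -2[[ab^\sigma]_\circ[c^\sigma[a[d^\sigma e^\sigma]_\circ]_\bullet]_\circ]_\bullet +2[[ab^\sigma]_\circ[c^\sigma[d^\sigma[ae^\sigma]_\circ]_\bullet]_\circ]_\bullet\\ &-[[b^\sigma c^\sigma]_\circ[a[d^\sigma[ae^\sigma]_\circ]_\bullet]_\circ]_\bullet +[[b^\sigma c^\sigma]_\circ[d^\sigma[a[ae^\sigma]_\circ]_\bullet]_\circ]_\bullet +[[ab^\sigma]_\circ[[ac^\sigma]_\circ[d^\sigma e^\sigma]_\bullet]_\circ]_\bullet\\ &+2[[ab^\sigma]_\circ[[c^\sigma d^\sigma]_\circ[ae^\sigma]_\bullet]_\circ]_\bullet +[[b^\sigma c^\sigma]_\circ[[ad^\sigma]_\circ[ae^\sigma]_\bullet]_\circ]_\bullet +[[a[ab^\sigma]_\circ]_\circ[c^\sigma[d^\sigma e^\sigma]_\bullet]_\circ]_\bullet\\ &-[[a[b^\sigma c^\sigma]_\circ]_\circ[d^\sigma[ae^\sigma]_\bullet]_\circ]_\bullet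 +[[b^\sigma[ac^\sigma]_\circ]_\circ[a[d^\sigma e^\sigma]_\bullet]_\circ]_\bullet \Big\}\equiv 0; \end{aligned} $$ (iii) the identity obtained from (ii) by interchanging $\circ$ and $\bullet$. (2) There are exactly two new irreducible identities in degree $6$, both for the partition $21^4$: the complete linearizations of (ii) and (iii) belong to $\mathrm{All}(6)$, each of their classes generates a simple submodule of $\mathrm{New}(6)$ isomorphic to the simple $S_6$-module $[21^4]$, and $\mathrm{New}(6)$ is the direct sum of these two submodules. -/

import Mathlib

open scoped MonoidAlgebra

noncomputable section

namespace Interchange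

/-- The two binary operation symbols `∘` and `•`. -/
inductive Op : Type
  | circ
  | bullet

/-- Nonassociative monomials in the two operation symbols, with indeterminates in `X`. -/
inductive Mono (X : Type*) : Type _
  | var (x : X) : Mono X
  | op (w : Op) (s t : Mono X) : Mono X

/-- The multiset of indeterminates occurring in a monomial. -/
def Mono.vars {X : Type*} : Mono X → Multiset X
  | .var x => {x}
  | .op _ s t => s.vars + t.vars

/-- Renaming of the indeterminates of a monomial. -/
def Mono.rename {X Y : Type*} (r : X → Y) : Mono X → Mono Y
  | .var x => .var (r x)
  | .op w s t => .op w (s.rename r) (t.rename r)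

/-- The underlying vector space of the free algebra with two bilinear operations on `X`: it has
the monomials as a basis. -/
def FreeAlg (F X : Type*) [Field F] := Mono X →₀ F

variable (F : Type*) [Field F]

instance (X : Type*) : AddCommGroup (FreeAlg F X) := inferInstanceAs (AddCommGroup (Mono X →₀ F))

instance (X : Type*) : Module F (FreeAlg F X) := inferInstanceAs (Module F (Mono X →₀ F))

/-- The basis of the free algebra that consists of the monomials. -/
def monoBasis (X : Type*) : Module.Basis (Mono X) F (FreeAlg F X) :=
  Module.Basis.ofRepr (LinearEquiv.refl F (Mono X →₀ F))

/-- A pair of bilinear operations on `A`. -/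
abbrev Ops (A : Type*) [AddCommGroup A] [Module F A] := Op → A →ₗ[F] A →ₗ[F] A

variable {F}

/-- The generators of the free algebra. -/
def X {X : Type*} (x : X) : FreeAlg F X := monoBasis F X (Mono.var x)

/-- The two bilinear operations of the free algebra, given on monomials `s`, `t` by the
monomial `op w s t`. -/
def freeMul {X : Type*} : Ops F (FreeAlg F X) := fun w =>
  (monoBasis F X).constr F fun s =>
    (monoBasis F X).constr F fun t => monoBasis F X (Mono.op w s t)

/-- The value of a monomial in an algebra with operations `m` under the substitution `v`. -/
def evalMono {A : Type*} [AddCommGroup A] [Module F A] (m : Ops F A) {X : Type*} (v : X → A) :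
    Mono X → A
  | .var x => v x
  | .op w s t => m w (evalMono m v s) (evalMono m v t)

/-- The value of a polynomial in an algebra with operations `m` under the substitution `v`. -/
def eval {A : Type*} [AddCommGroup A] [Module F A] (m : Ops F A) {X : Type*} (v : X → A) :
    FreeAlg F X →ₗ[F] A :=
  (monoBasis F X).constr F (evalMono m v)

/-- Substitution of polynomials for the indeterminates of a polynomial. -/
abbrev subst {X Y : Type*} (v : X → FreeAlg F Y) : FreeAlg F X →ₗ[F] FreeAlg F Y :=
  eval freeMul v

/-- Renaming of the indeterminates of a polynomial. -/
def rename {X Y : Type*} (r : X → Y) : FreeAlg F X →ₗ[F] FreeAlg F Y :=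
  (monoBasis F X).constr F fun t => monoBasis F Y (t.rename r)

/-- The set of all polynomial identities in the indeterminates `X` of an algebra with
operations `m`: the polynomials that vanish under every substitution. -/
def identities {A : Type*} [AddCommGroup A] [Module F A] (m : Ops F A) (X : Type*) :
    Submodule F (FreeAlg F X) :=
  ⨅ v : X → A, LinearMap.ker (eval m v)

/-- Two-sided ideals of the free algebra. -/
def IsIdeal {X : Type*} (I : Submodule F (FreeAlg F X)) : Prop :=
  ∀ (w : Op) (a b : FreeAlg F X), a ∈ I → freeMul w a b ∈ I ∧ freeMul w b a ∈ I

/-- The consequences, in the indeterminates `X`, of a set `S` of polynomial identities: the ideal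
of the free algebra on `X` generated by all substitution instances of elements of `S`. -/
def consequences {Y : Type*} (S : Set (FreeAlg F Y)) (X : Type*) : Submodule F (FreeAlg F X) :=
  sInf {I | IsIdeal I ∧ ∀ g ∈ S, ∀ v : Y → FreeAlg F X, subst v g ∈ I}

theorem isIdeal_consequences {Y : Type*} (S : Set (FreeAlg F Y)) (X : Type*) :
    IsIdeal (consequences S X) := by
  intro w a b ha
  simp only [consequences, Submodule.mem_sInf, Set.mem_ofPred_eq] at ha ⊢
  exact ⟨fun I hI => (hI.1 w a b (ha I hI)).1, fun I hI => (hI.1 w a b (ha I hI)).2⟩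

/-- The operations induced on the quotient of the free algebra by an ideal. -/
def quotMul {X : Type*} (I : Submodule F (FreeAlg F X)) (hI : IsIdeal I) :
    Ops F (FreeAlg F X ⧸ I) := fun w =>
  I.liftQ (I.liftQ ((freeMul w).compr₂ I.mkQ).flip (by
    intro b hb
    rw [LinearMap.mem_ker]
    ext1 a
    simpa using (hI w b a hb).2)).flip (by
    intro a ha
    rw [LinearMap.mem_ker]
    ext b
    simpa using (hI w a b ha).1)

/-- The operations of `quotMul` are the products of representatives. -/
theorem quotMul_mk {X : Type*} (I : Submodule F (FreeAlg F X)) (hI : IsIdeal I) (w : Op)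
    (a b : FreeAlg F X) :
    quotMul I hI w (I.mkQ a) (I.mkQ b) = I.mkQ (freeMul w a b) := rfl

variable (F)

/-- Associativity of the operation `w`. -/
def assoc (w : Op) : FreeAlg F ℕ :=
  freeMul w (freeMul w (X 0) (X 1)) (X 2) - freeMul w (X 0) (freeMul w (X 1) (X 2))

/-- The interchange identity `(a ∘ b) • (c ∘ d) = (a • c) ∘ (b • d)`. -/
def interchange : FreeAlg F ℕ :=
  freeMul .bullet (freeMul .circ (X 0) (X 1)) (freeMul .circ (X 2) (X 3)) -
    freeMul .circ (freeMul .bullet (X 0) (X 2)) (freeMul .bullet (X 1) (X 3))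

/-- The defining identities of associative interchange algebras. -/
def assocInterchange : Set (FreeAlg F ℕ) :=
  {assoc F .circ, assoc F .bullet, interchange F}

/-- The free associative interchange algebra on `X`. -/
abbrev FreeAI (X : Type*) := FreeAlg F X ⧸ consequences (assocInterchange F) X

/-- The operations `∘` and `•` of the free associative interchange algebra. -/
def mulAI (X : Type*) : Ops F (FreeAI F X) :=
  quotMul _ (isIdeal_consequences (assocInterchange F) X)

variable {F} in
/-- The brackets `a b - b a` of the operations `m`. -/
def brackets {A : Type*} [AddCommGroup A] [Module F A] (m : Ops F A) : Ops F A :=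
  fun w => m w - (m w).flip

/-- The multilinear polynomials of degree `n`: the span of the monomials in which each of the
`n` indeterminates occurs exactly once. -/
def multilinear (n : ℕ) : Submodule F (FreeAlg F (Fin n)) :=
  Submodule.span F (monoBasis F (Fin n) '' {t | t.vars = (Finset.univ : Finset (Fin n)).val})

/-- The multilinear identities of degree `n` satisfied by the two Lie brackets in the free
associative interchange algebra on countably many generators. The operation symbols now stand for
the two brackets. -/
def allIds (n : ℕ) : Submodule F (FreeAlg F (Fin n)) :=
  multilinear F n ⊓ identities (brackets (mulAI F ℕ)) (Fin n)

/-- The multilinear identities of degree less than `n` satisfied by the two Lie brackets. -/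
def lowerIds (n : ℕ) : Set (FreeAlg F ℕ) :=
  {g | ∃ k < n, ∃ f ∈ allIds F k, g = rename (fun i : Fin k => (i : ℕ)) f}

/-- The multilinear consequences in degree `n` of the identities of lower degree. -/
def oldIds (n : ℕ) : Submodule F (FreeAlg F (Fin n)) :=
  multilinear F n ⊓ consequences (lowerIds F n) (Fin n)

section Action

variable {F}

theorem rename_mono {X Y : Type*} (r : X → Y) (t : Mono X) :
    rename r (monoBasis F X t) = monoBasis F Y (t.rename r) := by
  simp [rename]

theorem Mono.rename_id {X : Type*} (t : Mono X) : t.rename id = t := by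
  induction t with
  | var x => rfl
  | op w s t hs ht => simp [Mono.rename, hs, ht]

theorem Mono.rename_rename {X Y Z : Type*} (r : X → Y) (q : Y → Z) (t : Mono X) :
    (t.rename r).rename q = t.rename (q ∘ r) := by
  induction t with
  | var x => rfl
  | op w s t hs ht => simp [Mono.rename, hs, ht]

theorem Mono.vars_rename {X Y : Type*} (r : X → Y) (t : Mono X) :
    (t.rename r).vars = t.vars.map r := by
  induction t with
  | var x => rfl
  | op w s t hs ht => simp [Mono.rename, Mono.vars, hs, ht]

theorem evalMono_rename {A : Type*} [AddCommGroup A] [Module F A] (m : Ops F A) {X Y : Type*}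
    (r : X → Y) (v : Y → A) (t : Mono X) :
    evalMono m v (t.rename r) = evalMono m (v ∘ r) t := by
  induction t with
  | var x => rfl
  | op w s t hs ht => simp [Mono.rename, evalMono, hs, ht]

theorem eval_rename {A : Type*} [AddCommGroup A] [Module F A] (m : Ops F A) {X Y : Type*}
    (r : X → Y) (v : Y → A) (f : FreeAlg F X) :
    eval m v (rename r f) = eval m (v ∘ r) f := by
  have h : eval m v ∘ₗ rename r = eval m (v ∘ r) := by
    refine (monoBasis F X).ext fun t => ?_
    simp [rename_mono, eval, evalMono_rename]
  exact LinearMap.congr_fun h f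

theorem freeMul_mono {X : Type*} (w : Op) (s t : Mono X) :
    freeMul w (monoBasis F X s) (monoBasis F X t) = monoBasis F X (Mono.op w s t) := by
  simp [freeMul]

theorem rename_freeMul {X Y : Type*} (r : X → Y) (w : Op) (a b : FreeAlg F X) :
    rename r (freeMul w a b) = freeMul w (rename r a) (rename r b) := by
  have h : (freeMul w).compr₂ (rename r) =
      ((freeMul w).compl₁₂ (rename r) (rename r) :
        FreeAlg F X →ₗ[F] FreeAlg F X →ₗ[F] FreeAlg F Y) := by
    refine (monoBasis F X).ext fun s => (monoBasis F X).ext fun t => ?_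
    simp [freeMul_mono, rename_mono, Mono.rename]
  exact LinearMap.congr_fun (LinearMap.congr_fun h a) b

theorem rename_evalMono {X Y Z : Type*} (r : Y → Z) (v : X → FreeAlg F Y) (t : Mono X) :
    rename r (evalMono freeMul v t) = evalMono freeMul (fun x => rename r (v x)) t := by
  induction t with
  | var x => rfl
  | op w s t hs ht => simp [evalMono, rename_freeMul, hs, ht]

theorem rename_subst {X Y Z : Type*} (r : Y → Z) (v : X → FreeAlg F Y) (f : FreeAlg F X) :
    rename r (subst v f) = subst (fun x => rename r (v x)) f := by
  have h : rename r ∘ₗ subst v = subst (fun x => rename r (v x)) := by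
    refine (monoBasis F X).ext fun t => ?_
    simp [eval, rename_evalMono]
  exact LinearMap.congr_fun h f

theorem rename_mem_consequences {Y X Z : Type*} (S : Set (FreeAlg F Y)) (r : X → Z)
    {f : FreeAlg F X} (hf : f ∈ consequences S X) : rename r f ∈ consequences S Z := by
  have hle : consequences S X ≤ (consequences S Z).comap (rename r) := by
    refine sInf_le ⟨fun w a b ha => ?_, fun g hg v => ?_⟩
    · simp only [Submodule.mem_comap, rename_freeMul]
      exact isIdeal_consequences S Z w _ _ ha
    · rw [Submodule.mem_comap, rename_subst]
      simp only [consequences, Submodule.mem_sInf]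
      exact fun I hI => hI.2 g hg _
  exact hle hf

theorem rename_mem_multilinear {n : ℕ} (g : Equiv.Perm (Fin n)) {f : FreeAlg F (Fin n)}
    (hf : f ∈ multilinear F n) : rename g f ∈ multilinear F n := by
  have hle : multilinear F n ≤ (multilinear F n).comap (rename g) := by
    rw [multilinear, Submodule.span_le]
    rintro _ ⟨t, ht, rfl⟩
    simp only [SetLike.mem_coe, Submodule.mem_comap, rename_mono]
    refine Submodule.subset_span ⟨t.rename g, ?_, rfl⟩
    rw [Set.mem_ofPred_eq] at ht ⊢
    rw [Mono.vars_rename, ht]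
    exact congrArg Finset.val (Finset.map_univ_equiv g)
  exact hle hf

theorem rename_mem_allIds {n : ℕ} (g : Equiv.Perm (Fin n)) {f : FreeAlg F (Fin n)}
    (hf : f ∈ allIds F n) : rename g f ∈ allIds F n := by
  refine ⟨rename_mem_multilinear g hf.1, ?_⟩
  have h := hf.2
  simp only [identities, SetLike.mem_coe, Submodule.mem_iInf, LinearMap.mem_ker] at h ⊢
  intro v
  rw [eval_rename]
  exact h _

theorem rename_mem_oldIds {n : ℕ} (g : Equiv.Perm (Fin n)) {f : FreeAlg F (Fin n)}
    (hf : f ∈ oldIds F n) : rename g f ∈ oldIds F n :=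
  ⟨rename_mem_multilinear g hf.1, rename_mem_consequences _ _ hf.2⟩

end Action

/-- The action of the symmetric group on polynomials in `n` indeterminates by
`(σ f)(x_1, …, x_n) = f(x_{σ(1)}, …, x_{σ(n)})`. -/
def permRep (n : ℕ) : Representation F (Equiv.Perm (Fin n)) (FreeAlg F (Fin n)) where
  toFun g := rename g
  map_one' := by
    refine (monoBasis F _).ext fun t => ?_
    rw [rename_mono]
    exact congrArg (monoBasis F _) (Mono.rename_id t)
  map_mul' g h := by
    refine (monoBasis F _).ext fun t => ?_
    simp only [rename_mono, Module.End.mul_apply, Mono.rename_rename]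
    rfl

/-- The action of the symmetric group on the multilinear identities of degree `n`. -/
def allRep (n : ℕ) : Representation F (Equiv.Perm (Fin n)) (allIds F n) :=
  (permRep F n).subrepresentation (allIds F n) (fun g _ hf => rename_mem_allIds g hf)

/-- The quotient of all multilinear identities of degree `n` by the old ones, with the action of
the symmetric group. -/
def newRep (n : ℕ) : Representation F (Equiv.Perm (Fin n))
    (allIds F n ⧸ (oldIds F n).submoduleOf (allIds F n)) :=
  (allRep F n).quotient _ (fun g _ hf => rename_mem_oldIds g hf)

/-- The new identities of degree `n`, as a module over the group algebra. -/
abbrev NewModule (n : ℕ) := (newRep F n).asModule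

variable {F} in
/-- The class of an identity of degree `n` in the module of new identities. -/
def newClass {n : ℕ} (f : FreeAlg F (Fin n)) (hf : f ∈ allIds F n) : NewModule F n :=
  (newRep F n).asModuleEquiv.symm (Submodule.Quotient.mk ⟨f, hf⟩)

variable {F} in
/-- The submodule of the module of new identities generated by an identity of degree `n`. -/
def newSpan {n : ℕ} (f : FreeAlg F (Fin n)) (hf : f ∈ allIds F n) :
    Submodule F[Equiv.Perm (Fin n)] (NewModule F n) :=
  Submodule.span _ {newClass f hf}

/-- Anticommutativity of the bracket `w`. -/
def anticomm (w : Op) : FreeAlg F ℕ :=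
  freeMul w (X 0) (X 1) + freeMul w (X 1) (X 0)

/-- The Jacobi identity for the bracket `w`. -/
def jacobi (w : Op) : FreeAlg F ℕ :=
  freeMul w (X 0) (freeMul w (X 1) (X 2)) + freeMul w (X 1) (freeMul w (X 2) (X 0)) +
    freeMul w (X 2) (freeMul w (X 0) (X 1))

/-- The summand of the new identity, with `p = [-,-]_∘` and `q = [-,-]_•`. -/
def newTerm {A : Type*} [AddCommGroup A] [Module F A] (p q : A →ₗ[F] A →ₗ[F] A)
    (a b c d e : A) : A :=
  (2 : F) • q (p a b) (p a (q c (p d e)))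
    - (2 : F) • q (p a b) (p c (q a (p d e)))
    + (2 : F) • q (p a b) (p c (q d (p a e)))
    - q (p b c) (p a (q d (p a e)))
    + q (p b c) (p d (q a (p a e)))
    + q (p a b) (p (p a c) (q d e))
    + (2 : F) • q (p a b) (p (p c d) (q a e))
    + q (p b c) (p (p a d) (q a e))
    + q (p a (p a b)) (p c (q d e))
    - q (p a (p b c)) (p d (q a e))
    + q (p b (p a c)) (p a (q d e))

/-- The new identity in the indeterminates `a = X 0` and `b, c, d, e = X 1, X 2, X 3, X 4`, an
alternating sum over the permutations of `{b, c, d, e}`. The identity itself has `u = ∘` and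
`w = •`; interchanging the two operations gives `u = •` and `w = ∘`. -/
def newLL6 (u w : Op) : FreeAlg F ℕ :=
  ∑ s : Equiv.Perm (Fin 4), ((Equiv.Perm.sign s : ℤ) : F) •
    newTerm F (freeMul u) (freeMul w) (X 0)
      (X ((s 0 : ℕ) + 1)) (X ((s 1 : ℕ) + 1)) (X ((s 2 : ℕ) + 1)) (X ((s 3 : ℕ) + 1))

variable {F} in
/-- The complete linearization `f(x₀ + x₁, …) - f(x₀, …) - f(x₁, …)` of a polynomial
`f(a, b, c, d, e)` that is quadratic in `a = X 0` and linear in `X 1, X 2, X 3, X 4`; the latter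
become `x₂, x₃, x₄, x₅`. -/
def linearize (f : FreeAlg F ℕ) : FreeAlg F (Fin 6) :=
  let v (a : FreeAlg F (Fin 6)) (k : ℕ) : FreeAlg F (Fin 6) :=
    if k = 0 then a else X (Fin.ofNat 6 (k + 1))
  subst (v (X 0 + X 1)) f - subst (v (X 0)) f - subst (v (X 1)) f

/-- The Young symmetrizer of the tableau on `{0, …, n - 1}` that has the entry `i` in row `row i`
and column `col i`. -/
def youngSymmetrizer {n : ℕ} (row col : Fin n → ℕ) : F[Equiv.Perm (Fin n)] :=
  open Classical in
  (∑ g : Equiv.Perm (Fin n) with ∀ i, row (g i) = row i, MonoidAlgebra.of F _ g) *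
    ∑ g : Equiv.Perm (Fin n) with ∀ i, col (g i) = col i,
      ((Equiv.Perm.sign g : ℤ) : F) • MonoidAlgebra.of F _ g

/-- The module `[21⁴]` of the symmetric group on six letters: the left ideal generated by the
Young symmetrizer of the tableau with rows `(0, 1), (2), (3), (4), (5)`. -/
def specht21111 : Submodule F[Equiv.Perm (Fin 6)] F[Equiv.Perm (Fin 6)] :=
  Submodule.span _ {youngSymmetrizer F ![0, 0, 1, 2, 3, 4] ![0, 1, 0, 0, 0, 0]}

end Interchange

end


/-!
In a free algebra with two associative products the brackets expand into associative monomials.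
Characteristic `0` and Dynkin's operator show that a polynomial in the brackets is a consequence of
anticommutativity and the Jacobi identities if and only if its expansion vanishes. In an interchange
algebra monomials are moreover identified by the interchange law, so a multilinear polynomial is an
identity if and only if the coefficients of its expansion sum to `0` over every class of equivalent
monomials. Reversing all factors of `∘` multiplies a bracket polynomial by a sign on the monomials
with a given number of `∘`, so the sums already vanish over the members of a class with a fixed
parity of that number.

In degree at most five this makes every coefficient vanish. In degree six the relations, together
with the symmetries of the coefficients of brackets, determine all coefficients from those of the
monomials `(a ∘ (b • c)) • (d ∘ e ∘ f)` and of their images under `∘ ↔ •`. For each choice of the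
outer operation these are, up to sign, the differences of a potential, a function on the six
letters, and the identity is old if and only if both potentials are constant. The potentials modulo
constants form the sign-twisted standard representation of `S₆`, which is the simple module
`[21⁴]`, and each of the new identities has a nonconstant potential for one operation and the
potential `0` for the other.
-/

noncomputable section

namespace Interchange

instance : DecidableEq Op
  | .circ, .circ => isTrue rfl
  | .bullet, .bullet => isTrue rfl
  | .circ, .bullet => isFalse nofun
  | .bullet, .circ => isFalse nofun

/-- The other operation symbol. -/
def Op.swap : Op → Op
  | .circ => .bullet
  | .bullet => .circ

@[simp] theorem Op.swap_ne (u : Op) : u.swap ≠ u := by cases u <;> nofun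

@[simp] theorem Op.ne_swap (u : Op) : u ≠ u.swap := u.swap_ne.symm

@[simp] theorem Op.swap_swap (u : Op) : u.swap.swap = u := by cases u <;> rfl

/-! ### Associative normal forms of monomials -/

namespace Mono

variable {α β : Type*}

/-- The product of two monomials up to associativity: if both factors are associated to the right,
then so is the result. -/
def app (w : Op) : Mono α → Mono α → Mono α
  | .var x, t => .op w (.var x) t
  | .op w' a b, t => if w' = w then .op w a (app w b t) else .op w (.op w' a b) t

/-- The right-associated normal form of a monomial. -/
def norm : Mono α → Mono α
  | .var x => .var x
  | .op w s t => app w s.norm t.norm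

/-- The outermost operation of a monomial is `w`. Like `isNormal`, it is Boolean because it is
computed for lists of monomials. -/
def rooted (w : Op) : Mono α → Bool
  | .var _ => false
  | .op u _ _ => decide (u = w)

/-- All products in the monomial are associated to the right. -/
def isNormal : Mono α → Bool
  | .var _ => true
  | .op w s t => !s.rooted w && s.isNormal && t.isNormal

/-- The number of occurrences of the operation `u`. -/
def opCount (u : Op) : Mono α → ℕ
  | .var _ => 0
  | .op w s t => (if w = u then 1 else 0) + s.opCount u + t.opCount u

/-- The number of factors of a monomial when it is written as an iterated product with respect to
the operation `w`. -/
def factorCount (w : Op) : Mono α → ℕ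
  | .var _ => 1
  | .op w' s t => if w' = w then s.factorCount w + t.factorCount w else 1

@[simp] theorem rooted_var (w : Op) (x : α) : (var x).rooted w = false := by rw [rooted]

@[simp] theorem rooted_op (w w' : Op) (s t : Mono α) :
    (op w' s t).rooted w = decide (w' = w) := by rw [rooted]

theorem app_of_not_rooted {w : Op} {s : Mono α} (hs : s.rooted w = false) (t : Mono α) :
    app w s t = op w s t := by
  cases s with
  | var x => rfl
  | op w' a b => simp_all [app]

@[simp] theorem app_op (w : Op) (a b t : Mono α) : app w (op w a b) t = op w a (app w b t) := by
  simp [app]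

@[elab_as_elim]
theorem app_induction {w : Op} {P : Mono α → Prop}
    (base : ∀ s, s.rooted w = false → P s) (step : ∀ a b, P b → P (op w a b)) (s : Mono α) :
    P s := by
  induction s with
  | var x => exact base _ rfl
  | op w' a b _ hb =>
    by_cases h : w' = w
    · subst h; exact step a b hb
    · exact base _ (by simp [h])

@[simp] theorem rooted_app (w w' : Op) (s t : Mono α) :
    (app w s t).rooted w' = decide (w = w') := by
  induction s using app_induction (w := w) with
  | base s hs => simp [app_of_not_rooted hs]
  | step a b _ => simp

theorem app_assoc (w : Op) (s t r : Mono α) : app w (app w s t) r = app w s (app w t r) := by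
  induction s using app_induction (w := w) with
  | base s hs => simp [app_of_not_rooted hs]
  | step a b hb => simp [hb]

theorem isNormal_app (w : Op) {s t : Mono α} (hs : s.isNormal) (ht : t.isNormal) :
    (app w s t).isNormal := by
  induction s using app_induction (w := w) with
  | base s h => simp [app_of_not_rooted h, isNormal, h, hs, ht]
  | step a b hb =>
    simp only [isNormal, Bool.and_eq_true, app_op] at hs ⊢
    exact ⟨hs.1, hb hs.2⟩

theorem norm_of_isNormal {t : Mono α} (ht : t.isNormal) : t.norm = t := by
  induction t with
  | var x => rfl
  | op w s t hs h =>
    simp only [isNormal, Bool.and_eq_true, Bool.not_eq_true'] at ht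
    rw [norm, hs ht.1.2, h ht.2, app_of_not_rooted ht.1.1]

theorem app_eq_op_iff {w : Op} {a b : Mono α} (ha : a.rooted w = false) (hb : b.rooted w = false)
    (s t : Mono α) : app w s t = op w a b ↔ s = a ∧ t = b := by
  induction s using app_induction (w := w) with
  | base s hs => simp [app_of_not_rooted hs]
  | step x y _ =>
    have hleft : op w x y ≠ a := by rintro rfl; simp at ha
    have hright : app w y t ≠ b := by rintro rfl; simp at hb
    simp [hleft, hright]

theorem app_eq_op_op_iff {w : Op} {a b c : Mono α} (ha : a.rooted w = false)
    (hb : b.rooted w = false) (hc : c.rooted w = false) (s t : Mono α) :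
    app w s t = op w a (op w b c) ↔ s = a ∧ t = op w b c ∨ s = op w a b ∧ t = c := by
  induction s using app_induction (w := w) with
  | base s hs =>
    have hne : s ≠ op w a b := by rintro rfl; simp at hs
    simp [app_of_not_rooted hs, hne]
  | step x y _ =>
    have hne : op w x y ≠ a := by rintro rfl; simp at ha
    simp [app_eq_op_iff hb hc, hne, and_assoc]

theorem app_rename (r : α → β) (w : Op) (s t : Mono α) :
    (app w s t).rename r = app w (s.rename r) (t.rename r) := by
  induction s with
  | var x => rfl
  | op w' a b _ hb =>
    by_cases h : w' = w
    · subst h; simp [rename, hb]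
    · simp [rename, app, h]

theorem rename_injective {r : α → β} (hr : Function.Injective r) :
    Function.Injective (Mono.rename r) := by
  intro s
  induction s with
  | var x => rintro (y | _) h <;> simp_all [rename, hr.eq_iff]
  | op w a b ha hb =>
    rintro (_ | ⟨w', a', b'⟩) h
    · simp [rename] at h
    · simp only [rename, op.injEq] at h ⊢
      exact ⟨h.1, ha h.2.1, hb h.2.2⟩

theorem vars_app (w : Op) (s t : Mono α) : (app w s t).vars = s.vars + t.vars := by
  induction s using app_induction (w := w) with
  | base s hs => simp [app_of_not_rooted hs, vars]
  | step a b hb => simp [vars, hb, add_assoc]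

theorem opCount_app (u w : Op) (s t : Mono α) :
    (app w s t).opCount u = (if w = u then 1 else 0) + s.opCount u + t.opCount u := by
  induction s using app_induction (w := w) with
  | base s hs => simp [app_of_not_rooted hs, opCount]
  | step a b hb => simp only [app_op, opCount, hb]; ring

theorem factorCount_pos (w : Op) (t : Mono α) : 0 < t.factorCount w := by
  induction t with
  | var _ => simp [factorCount]
  | op w' s t hs ht => unfold factorCount; split <;> omega

theorem factorCount_app (w w' : Op) (s t : Mono α) : (app w s t).factorCount w' =
    if w = w' then s.factorCount w' + t.factorCount w' else 1 := by
  induction s using app_induction (w := w) with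
  | base s hs => simp [app_of_not_rooted hs, factorCount]
  | step a b hb =>
    simp only [app_op, factorCount, hb]
    split <;> omega

end Mono

open Mono

variable {F : Type*} [Field F] {α β A : Type*} [AddCommGroup A] [Module F A]

/-! ### Linear maps on the free algebra -/

/-- Linear extension of functions on monomials. -/
def extend : (Mono α → A) ≃ₗ[F] (FreeAlg F α →ₗ[F] A) :=
  (monoBasis F α).constr F

@[simp] theorem extend_mono (g : Mono α → A) (t : Mono α) :
    extend g (monoBasis F α t) = g t := by simp [extend]

theorem linearMap_ext {g h : FreeAlg F α →ₗ[F] A}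
    (H : ∀ t, g (monoBasis F α t) = h (monoBasis F α t)) : g = h :=
  (monoBasis F α).ext H

theorem bilinearMap_ext {g h : FreeAlg F α →ₗ[F] FreeAlg F β →ₗ[F] A}
    (H : ∀ s t, g (monoBasis F α s) (monoBasis F β t) = h (monoBasis F α s) (monoBasis F β t)) :
    g = h :=
  linearMap_ext fun s => linearMap_ext fun t => H s t

theorem eval_mono (m : Ops F A) (v : α → A) (t : Mono α) :
    eval m v (monoBasis F α t) = evalMono m v t := by simp [eval]

theorem eval_X (m : Ops F A) (v : α → A) (x : α) : eval m v (X x) = v x := by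
  rw [X, eval_mono]; rfl

theorem eval_freeMul (m : Ops F A) (v : α → A) (w : Op) (a b : FreeAlg F α) :
    eval m v (freeMul w a b) = m w (eval m v a) (eval m v b) := by
  have h : (freeMul w).compr₂ (eval m v) = (m w).compl₁₂ (eval m v) (eval m v) :=
    bilinearMap_ext fun s t => by simp [freeMul_mono, eval_mono, evalMono]
  exact LinearMap.congr_fun₂ h a b

theorem repr_eq_zero_of_mem_span {B : Set (Mono α)} {p : FreeAlg F α}
    (hp : p ∈ Submodule.span F (monoBasis F α '' B)) {T : Mono α} (hT : T ∉ B) :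
    (monoBasis F α).repr p T = 0 :=
  Finsupp.notMem_support_iff.mp fun h => hT ((monoBasis F α).mem_span_image.mp hp h)

theorem repr_rename {r : α → β} (hr : Function.Injective r) (T : Mono α) (p : FreeAlg F α) :
    (monoBasis F β).repr (rename r p) (T.rename r) = (monoBasis F α).repr p T := by
  classical
  have h : (monoBasis F β).coord (T.rename r) ∘ₗ rename r = (monoBasis F α).coord T :=
    linearMap_ext fun t => by
      simp [rename_mono, Finsupp.single_apply, (rename_injective hr).eq_iff]
  exact LinearMap.congr_fun h p

/-! ### The free algebra with two associative products -/

/-- The two associative products on the free algebra; the product of two monomials is associated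
to the right. -/
def assocMul : Ops F (FreeAlg F α) := fun w =>
  extend fun s => extend fun t => monoBasis F α (app w s t)

@[simp] theorem assocMul_mono (w : Op) (s t : Mono α) :
    assocMul w (monoBasis F α s) (monoBasis F α t) = monoBasis F α (app w s t) := by
  simp [assocMul]

theorem assocMul_assoc (w : Op) (a b c : FreeAlg F α) :
    assocMul w (assocMul w a b) c = assocMul w a (assocMul w b c) := by
  have h : (assocMul w).compr₂ (assocMul w) =
      (LinearMap.llcomp F _ (FreeAlg F α) _).compl₁₂ (assocMul w) (assocMul w) :=
    bilinearMap_ext fun s t => linearMap_ext fun r => by simp [app_assoc]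
  exact LinearMap.congr_fun (LinearMap.congr_fun₂ h a b) c

theorem rename_assocMul (r : α → β) (w : Op) (a b : FreeAlg F α) :
    rename r (assocMul w a b) = assocMul w (rename r a) (rename r b) := by
  have h : (assocMul w).compr₂ (rename r) =
      ((assocMul w).compl₁₂ (rename r) (rename r) :
        FreeAlg F α →ₗ[F] FreeAlg F α →ₗ[F] FreeAlg F β) :=
    bilinearMap_ext fun s t => by simp [rename_mono, app_rename]
  exact LinearMap.congr_fun₂ h a b

theorem assocMul_mem_span {w : Op} {B C D : Set (Mono α)} (h : ∀ S ∈ B, ∀ T ∈ C, app w S T ∈ D)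
    {a b : FreeAlg F α} (ha : a ∈ Submodule.span F (monoBasis F α '' B))
    (hb : b ∈ Submodule.span F (monoBasis F α '' C)) :
    assocMul w a b ∈ Submodule.span F (monoBasis F α '' D) := by
  have hab := Submodule.apply_mem_map₂ (assocMul w) ha hb
  rw [Submodule.map₂_span_span] at hab
  refine Submodule.span_mono ?_ hab
  rintro _ ⟨_, ⟨S, hS, rfl⟩, _, ⟨T, hT, rfl⟩, rfl⟩
  exact ⟨_, h S hS T hT, by simp⟩

section Coefficients

variable {w : Op} {a b c : Mono α}

theorem repr_assocMul_of_not_rooted (ha : a.rooted w = false) (p q : FreeAlg F α) :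
    (monoBasis F α).repr (assocMul w p q) a = 0 := by
  have h : (assocMul w).compr₂ ((monoBasis F α).coord a) = 0 :=
    bilinearMap_ext fun s t => by
      classical
      have hne : app w s t ≠ a := by rintro rfl; simp at ha
      simp [hne]
  exact LinearMap.congr_fun₂ h p q

theorem repr_assocMul_op (ha : a.rooted w = false) (hb : b.rooted w = false)
    (p q : FreeAlg F α) :
    (monoBasis F α).repr (assocMul w p q) (op w a b) =
      (monoBasis F α).repr p a * (monoBasis F α).repr q b := by
  have h : (assocMul w).compr₂ ((monoBasis F α).coord (op w a b)) =
      (LinearMap.mul F F).compl₁₂ ((monoBasis F α).coord a) ((monoBasis F α).coord b) :=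
    bilinearMap_ext fun s t => by
      classical
      simp [Finsupp.single_apply, app_eq_op_iff ha hb, ← ite_and, and_comm]
  exact LinearMap.congr_fun₂ h p q

theorem repr_assocMul_op_op (ha : a.rooted w = false) (hb : b.rooted w = false)
    (hc : c.rooted w = false) (p q : FreeAlg F α) :
    (monoBasis F α).repr (assocMul w p q) (op w a (op w b c)) =
      (monoBasis F α).repr p a * (monoBasis F α).repr q (op w b c) +
        (monoBasis F α).repr p (op w a b) * (monoBasis F α).repr q c := by
  have hne : a ≠ op w a b := fun h => by rw [h] at ha; simp at ha
  have h : (assocMul w).compr₂ ((monoBasis F α).coord (op w a (op w b c))) =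
      (LinearMap.mul F F).compl₁₂ ((monoBasis F α).coord a) ((monoBasis F α).coord (op w b c)) +
      (LinearMap.mul F F).compl₁₂ ((monoBasis F α).coord (op w a b)) ((monoBasis F α).coord c) :=
    bilinearMap_ext fun s t => by
      classical
      simp only [LinearMap.compr₂_apply, assocMul_mono, Module.Basis.coord_apply,
        Module.Basis.repr_self, Finsupp.single_apply, app_eq_op_op_iff ha hb hc,
        LinearMap.add_apply, LinearMap.compl₁₂_apply, LinearMap.mul_apply']
      by_cases hsa : s = a
      · simp [hsa, hne]
      · by_cases hsab : s = op w a b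
        · simp [hsab, hne.symm]
        · simp [hsa, hsab]
  exact LinearMap.congr_fun₂ h p q

end Coefficients

/-! ### The expansion of brackets -/

/-- The expansion of all brackets into associative products. -/
def expand : FreeAlg F α →ₗ[F] FreeAlg F α :=
  eval (brackets assocMul) X

theorem expand_var (x : α) : expand (monoBasis F α (var x)) = monoBasis F α (var x) := by
  simp [expand, eval_mono, evalMono, X]

theorem expand_freeMul (w : Op) (a b : FreeAlg F α) :
    expand (freeMul w a b) =
      assocMul w (expand a) (expand b) - assocMul w (expand b) (expand a) := by
  simp [expand, eval_freeMul, brackets]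

theorem expand_op (w : Op) (s t : Mono α) :
    expand (monoBasis F α (op w s t)) =
      assocMul w (expand (monoBasis F α s)) (expand (monoBasis F α t)) -
        assocMul w (expand (monoBasis F α t)) (expand (monoBasis F α s)) := by
  rw [← freeMul_mono, expand_freeMul]

theorem expand_rename (r : α → β) (f : FreeAlg F α) :
    expand (rename r f) = rename r (expand f) := by
  have h : expand ∘ₗ rename r = (rename r ∘ₗ expand : FreeAlg F α →ₗ[F] FreeAlg F β) := by
    refine linearMap_ext fun t => ?_
    simp only [LinearMap.comp_apply]
    induction t with
    | var x => simp [rename_mono, Mono.rename, expand_var]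
    | op w s t hs ht =>
      rw [← freeMul_mono, rename_freeMul, expand_freeMul, expand_freeMul, hs, ht, map_sub,
        rename_assocMul, rename_assocMul]
  exact LinearMap.congr_fun h f

theorem expand_mono_mem_span (Q : Mono α → Mono α → Prop) (hvar : ∀ x, Q (var x) (var x))
    (hop : ∀ w s t S T, Q S s → Q T t → Q (app w S T) (op w s t) ∧ Q (app w T S) (op w s t))
    (t : Mono α) :
    expand (monoBasis F α t) ∈ Submodule.span F (monoBasis F α '' {T | Q T t}) := by
  induction t with
  | var x => rw [expand_var]; exact Submodule.subset_span ⟨_, hvar x, rfl⟩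
  | op w s t hs ht =>
    rw [expand_op]
    exact sub_mem
      (assocMul_mem_span (fun S hS T hT => (hop w s t S T hS hT).1) hs ht)
      (assocMul_mem_span (fun T hT S hS => (hop w s t S T hS hT).2) ht hs)

theorem expand_mono_mem_span_factorCount (w : Op) (t : Mono α) : expand (monoBasis F α t) ∈
    Submodule.span F (monoBasis F α '' {T | T.factorCount w = t.factorCount w}) :=
  expand_mono_mem_span (fun T t => T.factorCount w = t.factorCount w) (fun _ => rfl)
    (fun w' s t S T hS hT => ⟨by rw [factorCount_app, hS, hT, factorCount],
      by rw [factorCount_app, hS, hT, factorCount, add_comm]⟩) t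

theorem expand_mem_span_isNormal (f : FreeAlg F α) :
    expand f ∈ Submodule.span F (monoBasis F α '' {T | T.isNormal}) := by
  rw [← (monoBasis F α).linearCombination_repr f, Finsupp.linearCombination_apply, map_finsuppSum]
  refine sum_mem fun t _ => ?_
  simp only [map_smul]
  exact Submodule.smul_mem _ _ <| expand_mono_mem_span (fun T _ => T.isNormal) (fun _ => rfl)
    (fun w _ _ _ _ hS hT => ⟨isNormal_app w hS hT, isNormal_app w hT hS⟩) t

/-- The coefficient of a monomial in the expansion of a polynomial in the brackets. -/
def coef (T : Mono α) : FreeAlg F α →ₗ[F] F :=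
  (monoBasis F α).coord T ∘ₗ expand

theorem coef_apply (T : Mono α) (f : FreeAlg F α) :
    coef T f = (monoBasis F α).repr (expand f) T := rfl

theorem expand_eq_zero_iff (f : FreeAlg F α) : expand f = 0 ↔ ∀ T, coef T f = 0 := by
  rw [← (monoBasis F α).forall_coord_eq_zero_iff]; rfl

theorem coef_rename {r : α → β} (hr : Function.Injective r) (T : Mono α) (f : FreeAlg F α) :
    coef (T.rename r) (rename r f) = coef T f := by
  rw [coef_apply, coef_apply, expand_rename, repr_rename hr]

theorem coef_eq_zero_of_not_isNormal {T : Mono α} (hT : T.isNormal = false) (f : FreeAlg F α) :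
    coef T f = 0 :=
  repr_eq_zero_of_mem_span (expand_mem_span_isNormal f) (by simp [hT])

theorem coef_mono_eq_zero_of_vars_ne {T t : Mono α} (h : T.vars ≠ t.vars) :
    coef T (monoBasis F α t) = 0 :=
  repr_eq_zero_of_mem_span
    (expand_mono_mem_span (fun T t => T.vars = t.vars) (fun _ => rfl)
      (fun w _ _ _ _ hS hT => ⟨by rw [vars_app, hS, hT, Mono.vars],
        by rw [vars_app, hS, hT, Mono.vars, add_comm]⟩) t) h

theorem coef_mono_eq_zero_of_opCount_ne {u : Op} {T t : Mono α} (h : T.opCount u ≠ t.opCount u) :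
    coef T (monoBasis F α t) = 0 :=
  repr_eq_zero_of_mem_span
    (expand_mono_mem_span (fun T t => T.opCount u = t.opCount u) (fun _ => rfl)
      (fun w _ _ _ _ hS hT => ⟨by rw [opCount_app, hS, hT, Mono.opCount],
        by rw [opCount_app, hS, hT, Mono.opCount]; ring⟩) t) h

theorem coef_eq_zero_of_vars_ne {n : ℕ} {T : Mono (Fin n)}
    (h : T.vars ≠ (Finset.univ : Finset (Fin n)).val) {f : FreeAlg F (Fin n)}
    (hf : f ∈ multilinear F n) : coef T f = 0 := by
  have hle : multilinear F n ≤ LinearMap.ker (coef T) := by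
    rw [multilinear, Submodule.span_le]
    rintro _ ⟨t, ht, rfl⟩
    exact coef_mono_eq_zero_of_vars_ne (fun h' => h (h'.trans ht))
  exact hle hf

theorem coef_freeMul_of_not_rooted {w : Op} {T : Mono α} (hT : T.rooted w = false)
    (f g : FreeAlg F α) : coef T (freeMul w f g) = 0 := by
  simp [coef_apply, expand_freeMul, repr_assocMul_of_not_rooted hT]

theorem coef_op_freeMul {w : Op} {a b : Mono α} (ha : a.rooted w = false)
    (hb : b.rooted w = false) (f g : FreeAlg F α) :
    coef (op w a b) (freeMul w f g) = coef a f * coef b g - coef a g * coef b f := by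
  simp [coef_apply, expand_freeMul, repr_assocMul_op ha hb]

theorem coef_op_op_freeMul {w : Op} {a b c : Mono α} (ha : a.rooted w = false)
    (hb : b.rooted w = false) (hc : c.rooted w = false) (f g : FreeAlg F α) :
    coef (op w a (op w b c)) (freeMul w f g) =
      coef a f * coef (op w b c) g + coef (op w a b) f * coef c g -
        (coef a g * coef (op w b c) f + coef (op w a b) g * coef c f) := by
  simp [coef_apply, expand_freeMul, repr_assocMul_op_op ha hb hc]

/-! ### Coefficients as functions of bracket monomials -/

/-- The coefficient of a fixed monomial in the expansion, as a function of bracket monomials. -/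
def coefMono (T : Mono α) (t : Mono α) : F := coef T (monoBasis F α t)

/-- The coefficient function of a product of two factors with coefficient functions `a` and `b`;
see `coefMono_op`. -/
def pair (w : Op) (a b : Mono α → F) : Mono α → F
  | .var _ => 0
  | .op w' s t => if w' = w then a s * b t - a t * b s else 0

/-- The coefficient function of a product of three factors with coefficient functions `a`, `b`
and `c`; see `coefMono_op_op`. -/
def triple (w : Op) (a b c : Mono α → F) : Mono α → F
  | .var _ => 0
  | .op w' s t => if w' = w then a s * pair w b c t + pair w a b s * c t -
      (a t * pair w b c s + pair w a b t * c s) else 0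

theorem coef_eq_extend (T : Mono α) : coef T = extend (F := F) (coefMono T) :=
  linearMap_ext fun t => by simp [coefMono]

theorem coefMono_op {w : Op} {a b : Mono α} (ha : a.rooted w = false) (hb : b.rooted w = false) :
    (coefMono (op w a b) : Mono α → F) = pair w (coefMono a) (coefMono b) := by
  classical
  funext t
  cases t with
  | var x => simp [coefMono, coef_apply, expand_var, pair]
  | op w' s t =>
    rw [coefMono, ← freeMul_mono]
    by_cases h : w' = w
    · subst h; simp [coef_op_freeMul ha hb, pair, coefMono]
    · rw [coef_freeMul_of_not_rooted (by simp [Ne.symm h])]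
      simp [pair, h]

theorem coefMono_op_op {w : Op} {a b c : Mono α} (ha : a.rooted w = false)
    (hb : b.rooted w = false) (hc : c.rooted w = false) :
    (coefMono (op w a (op w b c)) : Mono α → F) =
      triple w (coefMono a) (coefMono b) (coefMono c) := by
  classical
  funext t
  cases t with
  | var x => simp [coefMono, coef_apply, expand_var, triple]
  | op w' s t =>
    rw [coefMono, ← freeMul_mono]
    by_cases h : w' = w
    · subst h
      simp only [coef_op_op_freeMul ha hb hc, triple, if_true, ← coefMono_op hb hc,
        ← coefMono_op ha hb]
      rfl
    · rw [coef_freeMul_of_not_rooted (by simp [Ne.symm h])]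
      simp [triple, h]

section PairTriple

variable (w : Op) (a b c : Mono α → F)

theorem pair_swap : pair w b a = -pair w a b := by
  funext t; cases t with
  | var x => simp [pair]
  | op w' s t => simp only [pair, Pi.neg_apply]; split <;> ring

@[simp] theorem pair_neg_left : pair w (-a) b = -pair w a b := by
  funext t; cases t with
  | var x => simp [pair]
  | op w' s t => simp only [pair, Pi.neg_apply]; split <;> ring

@[simp] theorem pair_neg_right : pair w a (-b) = -pair w a b := by
  funext t; cases t with
  | var x => simp [pair]
  | op w' s t => simp only [pair, Pi.neg_apply]; split <;> ring

theorem pair_add_right (b' : Mono α → F) : pair w a (b + b') = pair w a b + pair w a b' := by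
  funext t; cases t with
  | var x => simp [pair]
  | op w' s t => simp only [pair, Pi.add_apply]; split <;> ring

@[simp] theorem pair_zero_right : pair w a 0 = 0 := by
  funext t; cases t <;> simp [pair]

@[simp] theorem triple_neg_left : triple w (-a) b c = -triple w a b c := by
  funext t; cases t with
  | var x => simp [triple]
  | op w' s t => simp only [triple, pair_neg_left, Pi.neg_apply]; split <;> ring

@[simp] theorem triple_neg_mid : triple w a (-b) c = -triple w a b c := by
  funext t; cases t with
  | var x => simp [triple]
  | op w' s t => simp only [triple, pair_neg_left, pair_neg_right, Pi.neg_apply]; split <;> ring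

@[simp] theorem triple_neg_right : triple w a b (-c) = -triple w a b c := by
  funext t; cases t with
  | var x => simp [triple]
  | op w' s t => simp only [triple, pair_neg_right, Pi.neg_apply]; split <;> ring

theorem triple_reverse : triple w c b a = triple w a b c := by
  funext t; cases t with
  | var x => simp [triple]
  | op w' s t =>
    simp only [triple, pair_swap w b c, pair_swap w a b, Pi.neg_apply]; split <;> ring

theorem triple_shuffle : triple w a b c + triple w b a c + triple w b c a = 0 := by
  funext t; cases t with
  | var x => simp [triple]
  | op w' s t =>
    simp only [triple, Pi.add_apply, Pi.zero_apply, pair_swap w a b, pair_swap w a c,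
      Pi.neg_apply]
    split <;> ring

end PairTriple

/-! ### Brackets are determined by their expansions -/

/-- Each of the two operations is a Lie bracket. -/
structure IsLie (m : Ops F A) : Prop where
  anticomm : ∀ w a b, m w a b + m w b a = 0
  jacobi : ∀ w a b c, m w a (m w b c) + m w b (m w c a) + m w c (m w a b) = 0

theorem isLie_brackets_of_assoc {m : Ops F A}
    (hm : ∀ w a b c, m w (m w a b) c = m w a (m w b c)) : IsLie (brackets m) := by
  constructor
  · intro w a b
    simp [brackets]
  · intro w a b c
    simp only [brackets, LinearMap.sub_apply, LinearMap.flip_apply, map_sub, hm]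
    abel

section Dynkin

variable (m : Ops F A) (v : α → A)

variable (F A) in
/-- What the Dynkin operator attaches to a monomial in the associative products: the right-normed
bracketing, divided at each node by the number of factors of the product (`value`), and the
action on `A` by iterated brackets with the factors (`action`). -/
structure DynkinData where
  value : A
  action : Op → A →ₗ[F] A

/-- The Dynkin operator on monomials. A product of `k` factors is the `k`-th part of its
right-normed bracketing; the bracketing of the `j` factors of `t` is `j` times its value. -/
def dynkin : Mono α → DynkinData F A
  | .var x => ⟨v x, fun w => m w (v x)⟩
  | .op w s t =>
    let y : A := (s.factorCount w + t.factorCount w : F)⁻¹ • (t.factorCount w : F) •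
      (dynkin s).action w (dynkin t).value
    ⟨y, fun w' => if w' = w then (dynkin s).action w ∘ₗ (dynkin t).action w else m w' y⟩

/-- The linear extension of the values of the Dynkin operator. -/
def dynkinValue : FreeAlg F α →ₗ[F] A := extend fun t => (dynkin m v t).value

/-- The linear extension of the actions of the Dynkin operator. -/
def dynkinAction (w : Op) : FreeAlg F α →ₗ[F] A →ₗ[F] A := extend fun t => (dynkin m v t).action w

/-- The operator that multiplies a monomial by its number of factors with respect to `w`. -/
def countFactors (w : Op) : FreeAlg F α →ₗ[F] FreeAlg F α :=
  extend fun t => (t.factorCount w : F) • monoBasis F α t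

theorem countFactors_expand_mono (w : Op) (t : Mono α) :
    countFactors w (expand (monoBasis F α t)) =
      (t.factorCount w : F) • expand (monoBasis F α t) := by
  have h : Set.EqOn (countFactors w)
      ((t.factorCount w : F) • (LinearMap.id : FreeAlg F α →ₗ[F] FreeAlg F α))
      (monoBasis F α '' {T | T.factorCount w = t.factorCount w}) := by
    rintro _ ⟨T, hT, rfl⟩
    rw [Set.mem_ofPred_eq] at hT
    simp [countFactors, hT]
  exact LinearMap.eqOn_span h (expand_mono_mem_span_factorCount w t)

theorem dynkin_action_of_not_rooted {w : Op} {t : Mono α} (h : t.rooted w = false) :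
    (dynkin m v t).action w = m w (dynkin m v t).value := by
  cases t with
  | var x => rfl
  | op w' s t =>
    have : w ≠ w' := fun h' => by simp [h'] at h
    simp [dynkin, this]

theorem dynkin_action_app (w : Op) (s t : Mono α) : (dynkin m v (app w s t)).action w =
    (dynkin m v s).action w ∘ₗ (dynkin m v t).action w := by
  induction s using app_induction (w := w) with
  | base s hs => simp [app_of_not_rooted hs, dynkin]
  | step a b hb => simp [dynkin, hb, LinearMap.comp_assoc]

theorem dynkin_value_app [CharZero F] (w : Op) (s t : Mono α) :
    (s.factorCount w + t.factorCount w : F) • (dynkin m v (app w s t)).value =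
      (t.factorCount w : F) • (dynkin m v s).action w (dynkin m v t).value := by
  have hne (s : Mono α) : (s.factorCount w + t.factorCount w : F) ≠ 0 := by
    exact_mod_cast (Nat.add_pos_left (factorCount_pos w s) _).ne'
  induction s using app_induction (w := w) with
  | base s hs => rw [app_of_not_rooted hs, dynkin, smul_inv_smul₀ (hne s)]
  | step a b hb =>
    have hab := hne (op w a b)
    simp only [factorCount, if_pos, Nat.cast_add] at hab ⊢
    rw [app_op, dynkin, factorCount_app, if_pos rfl, Nat.cast_add, ← map_smul, hb, ← add_assoc,
      smul_inv_smul₀ hab]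
    simp [dynkin]

theorem dynkinAction_assocMul (w : Op) (p q : FreeAlg F α) :
    dynkinAction m v w (assocMul w p q) = dynkinAction m v w p ∘ₗ dynkinAction m v w q := by
  have h : (assocMul w).compr₂ (dynkinAction m v w) =
      (LinearMap.llcomp F A A A).compl₁₂ (dynkinAction m v w) (dynkinAction m v w) :=
    bilinearMap_ext fun s t => LinearMap.ext fun x => by simp [dynkinAction, dynkin_action_app]
  exact LinearMap.congr_fun₂ h p q

theorem dynkinAction_assocMul_of_ne {w w' : Op} (hw : w' ≠ w) (p q : FreeAlg F α) :
    dynkinAction m v w (assocMul w' p q) = m w (dynkinValue m v (assocMul w' p q)) := by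
  have h : (assocMul w').compr₂ (dynkinAction m v w) =
      (assocMul w').compr₂ (m w ∘ₗ dynkinValue m v) :=
    bilinearMap_ext fun s t => by
      simp [dynkinAction, dynkinValue,
        dynkin_action_of_not_rooted m v (w := w) (t := app w' s t) (by simp [hw])]
  exact LinearMap.congr_fun₂ h p q

theorem dynkinValue_assocMul [CharZero F] (w : Op) (p q : FreeAlg F α) :
    dynkinValue m v (assocMul w (countFactors w p) q + assocMul w p (countFactors w q)) =
      dynkinAction m v w p (dynkinValue m v (countFactors w q)) := by
  have h : ((assocMul w).compl₁₂ (countFactors w) LinearMap.id +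
      (assocMul w).compl₁₂ LinearMap.id (countFactors w)).compr₂ (dynkinValue m v) =
      (dynkinAction m v w).compl₁₂ LinearMap.id (dynkinValue m v ∘ₗ countFactors w) :=
    bilinearMap_ext fun s t => by
      simpa [dynkinAction, dynkinValue, countFactors, ← add_smul] using dynkin_value_app m v w s t
  exact LinearMap.congr_fun₂ h p q

variable {m}

theorem IsLie.eval_op_comp (hm : IsLie m) (w : Op) (a b : A) :
    m w a ∘ₗ m w b - m w b ∘ₗ m w a = m w (m w a b) := by
  ext x
  have j := hm.jacobi w a b x
  rw [eq_neg_of_add_eq_zero_left (hm.anticomm w x a),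
    eq_neg_of_add_eq_zero_left (hm.anticomm w x (m w a b)), map_neg] at j
  simp only [LinearMap.sub_apply, LinearMap.comp_apply]
  rw [← sub_eq_zero, ← j]
  abel

/-- Anticommutativity merges the two terms of the expansion of a bracket of `s` and `t`. -/
theorem dynkinValue_expand_op [CharZero F] (hm : IsLie m) (w : Op) {s t : Mono α}
    (hs : dynkinValue m v (expand (monoBasis F α s)) = evalMono m v s)
    (ht : dynkinValue m v (expand (monoBasis F α t)) = evalMono m v t)
    (hs' : dynkinAction m v w (expand (monoBasis F α s)) = m w (evalMono m v s))
    (ht' : dynkinAction m v w (expand (monoBasis F α t)) = m w (evalMono m v t)) :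
    dynkinValue m v (expand (monoBasis F α (op w s t))) = evalMono m v (op w s t) := by
  have hne : (s.factorCount w + t.factorCount w : F) ≠ 0 := by
    exact_mod_cast (Nat.add_pos_left (factorCount_pos w s) _).ne'
  have hst := dynkinValue_assocMul m v w (expand (monoBasis F α s)) (expand (monoBasis F α t))
  have hts := dynkinValue_assocMul m v w (expand (monoBasis F α t)) (expand (monoBasis F α s))
  simp only [countFactors_expand_mono, map_smul, LinearMap.smul_apply, map_add, hs, ht, hs', ht',
    eq_neg_of_add_eq_zero_left (hm.anticomm w (evalMono m v t) (evalMono m v s))] at hst hts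
  refine smul_right_injective A hne ?_
  simp only [expand_op, map_sub, evalMono, smul_sub, add_smul]
  rw [hst, add_comm, hts, smul_neg]
  abel

theorem dynkin_expand_mono [CharZero F] (hm : IsLie m) (t : Mono α) :
    dynkinValue m v (expand (monoBasis F α t)) = evalMono m v t ∧
      ∀ w, dynkinAction m v w (expand (monoBasis F α t)) = m w (evalMono m v t) := by
  induction t with
  | var x => simp [expand_var, dynkinValue, dynkinAction, dynkin, evalMono]
  | op w s t hs ht =>
    have hvalue := dynkinValue_expand_op v hm w hs.1 ht.1 (hs.2 w) (ht.2 w)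
    refine ⟨hvalue, fun w' => ?_⟩
    by_cases h : w = w'
    · subst h
      rw [expand_op, map_sub, dynkinAction_assocMul, dynkinAction_assocMul, hs.2, ht.2,
        hm.eval_op_comp, evalMono]
    · rw [← hvalue, expand_op, map_sub, map_sub, map_sub, dynkinAction_assocMul_of_ne m v h,
        dynkinAction_assocMul_of_ne m v h]

theorem dynkinValue_expand [CharZero F] (hm : IsLie m) (f : FreeAlg F α) :
    dynkinValue m v (expand f) = eval m v f := by
  have h : dynkinValue m v ∘ₗ expand = eval m v := linearMap_ext fun t => by
    rw [LinearMap.comp_apply, (dynkin_expand_mono v hm t).1, eval_mono]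
  exact LinearMap.congr_fun h f

theorem IsLie.eval_eq_zero_of_expand_eq_zero [CharZero F] (hm : IsLie m) {f : FreeAlg F α}
    (hf : expand f = 0) : eval m v f = 0 := by
  rw [← dynkinValue_expand v hm, hf, map_zero]

end Dynkin

/-! ### Consequences -/

section Consequences

variable {Y Z : Type*} {S : Set (FreeAlg F Y)}

theorem subst_mem_consequences {g : FreeAlg F Y} (hg : g ∈ S) (v : Y → FreeAlg F α) :
    subst v g ∈ consequences S α := by
  simp only [consequences, Submodule.mem_sInf]
  exact fun I hI => hI.2 g hg v

theorem eval_subst (m : Ops F A) (v : β → A) (v' : α → FreeAlg F β) (f : FreeAlg F α) :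
    eval m v (subst v' f) = eval m (fun x => eval m v (v' x)) f := by
  have h : eval m v ∘ₗ subst v' = eval m fun x => eval m v (v' x) := linearMap_ext fun t => by
    simp only [LinearMap.comp_apply, eval_mono]
    induction t with
    | var x => simp [evalMono]
    | op w s t hs ht => simp [evalMono, eval_freeMul, hs, ht]
  exact LinearMap.congr_fun h f

theorem subst_X (f : FreeAlg F α) : subst X f = f := by
  have h : subst X = (LinearMap.id : FreeAlg F α →ₗ[F] _) := linearMap_ext fun t => by
    rw [LinearMap.id_apply, eval_mono]
    induction t with
    | var x => rfl
    | op w s t hs ht => rw [evalMono, hs, ht, freeMul_mono]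
  exact LinearMap.congr_fun h f

theorem isIdeal_ker_eval (m : Ops F A) (v : α → A) : IsIdeal (LinearMap.ker (eval m v)) := by
  intro w a b ha
  rw [LinearMap.mem_ker] at ha
  simp [eval_freeMul, ha]

theorem consequences_le_ker_eval {m : Ops F A} (hS : ∀ g ∈ S, ∀ v : Y → A, eval m v g = 0)
    (v : α → A) : consequences S α ≤ LinearMap.ker (eval m v) :=
  sInf_le ⟨isIdeal_ker_eval m v, fun g hg v' => by
    rw [LinearMap.mem_ker, eval_subst]; exact hS g hg _⟩

theorem evalMono_quotMul {I : Submodule F (FreeAlg F α)} (hI : IsIdeal I)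
    (v : Y → FreeAlg F α) (t : Mono Y) :
    evalMono (quotMul I hI) (fun x => I.mkQ (v x)) t = I.mkQ (evalMono freeMul v t) := by
  induction t with
  | var x => rfl
  | op w s t hs ht => rw [evalMono, hs, ht, quotMul_mk]; rfl

theorem eval_quotMul {I : Submodule F (FreeAlg F α)} (hI : IsIdeal I)
    (v : Y → FreeAlg F α) (f : FreeAlg F Y) :
    eval (quotMul I hI) (fun x => I.mkQ (v x)) f = I.mkQ (subst v f) := by
  have h : eval (quotMul I hI) (fun x => I.mkQ (v x)) = I.mkQ ∘ₗ subst v :=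
    linearMap_ext fun t => by rw [LinearMap.comp_apply, eval_mono, eval_mono, evalMono_quotMul]
  exact LinearMap.congr_fun h f

theorem eval_quotMul_eq_zero {g : FreeAlg F Y} (hg : g ∈ S) (v : Y → FreeAlg F α) :
    eval (quotMul _ (isIdeal_consequences S α)) (fun x => (consequences S α).mkQ (v x)) g = 0 := by
  rw [eval_quotMul, Submodule.mkQ_apply, Submodule.Quotient.mk_eq_zero]
  exact subst_mem_consequences hg v

theorem subst_mem_consequences_of_mem {g : FreeAlg F β} (hg : g ∈ consequences S β)
    (v : β → FreeAlg F α) : subst v g ∈ consequences S α := by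
  have h : consequences S β ≤ (consequences S α).comap (subst v) :=
    sInf_le ⟨fun w a b ha => by
      simp only [Submodule.mem_comap, eval_freeMul] at ha ⊢
      exact isIdeal_consequences S α w _ _ ha, fun g hg v' => by
      rw [Submodule.mem_comap, eval_subst]; exact subst_mem_consequences hg _⟩
  exact h hg

theorem consequences_le {S' : Set (FreeAlg F Z)} (h : ∀ g ∈ S, g ∈ consequences S' Y) :
    consequences S α ≤ consequences S' α :=
  sInf_le ⟨isIdeal_consequences S' α, fun g hg v => subst_mem_consequences_of_mem (h g hg) v⟩

end Consequences

variable (F) in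
/-- The identities of two Lie brackets. -/
def lieIds : Set (FreeAlg F ℕ) :=
  {anticomm F .circ, anticomm F .bullet, jacobi F .circ, jacobi F .bullet}

theorem anticomm_mem_lieIds (w : Op) : anticomm F w ∈ lieIds F := by cases w <;> simp [lieIds]

theorem jacobi_mem_lieIds (w : Op) : jacobi F w ∈ lieIds F := by cases w <;> simp [lieIds]

theorem eval_anticomm (m : Ops F A) (v : ℕ → A) (w : Op) :
    eval m v (anticomm F w) = m w (v 0) (v 1) + m w (v 1) (v 0) := by
  simp [anticomm, eval_freeMul, eval_X]

theorem eval_jacobi (m : Ops F A) (v : ℕ → A) (w : Op) :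
    eval m v (jacobi F w) = m w (v 0) (m w (v 1) (v 2)) +
      m w (v 1) (m w (v 2) (v 0)) + m w (v 2) (m w (v 0) (v 1)) := by
  simp [jacobi, eval_freeMul, eval_X]

theorem IsLie.eval_eq_zero {m : Ops F A} (hm : IsLie m) {g : FreeAlg F ℕ} (hg : g ∈ lieIds F)
    (v : ℕ → A) : eval m v g = 0 := by
  simp only [lieIds, Set.mem_insert_iff, Set.mem_singleton_iff] at hg
  rcases hg with rfl | rfl | rfl | rfl
  · rw [eval_anticomm, hm.anticomm]
  · rw [eval_anticomm, hm.anticomm]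
  · rw [eval_jacobi, hm.jacobi]
  · rw [eval_jacobi, hm.jacobi]

theorem isLie_quotMul (α : Type*) :
    IsLie (quotMul _ (isIdeal_consequences (lieIds F) α)) := by
  constructor
  · intro w a b
    obtain ⟨a, rfl⟩ := Submodule.mkQ_surjective _ a
    obtain ⟨b, rfl⟩ := Submodule.mkQ_surjective _ b
    simpa [eval_anticomm] using
      eval_quotMul_eq_zero (anticomm_mem_lieIds w) (fun n => if n = 0 then a else b)
  · intro w a b c
    obtain ⟨a, rfl⟩ := Submodule.mkQ_surjective _ a
    obtain ⟨b, rfl⟩ := Submodule.mkQ_surjective _ b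
    obtain ⟨c, rfl⟩ := Submodule.mkQ_surjective _ c
    simpa [eval_jacobi] using eval_quotMul_eq_zero (jacobi_mem_lieIds w)
      (fun n => if n = 0 then a else if n = 1 then b else c)

theorem mem_consequences_lieIds_iff [CharZero F] (f : FreeAlg F α) :
    f ∈ consequences (lieIds F) α ↔ expand f = 0 := by
  constructor
  · intro hf
    exact consequences_le_ker_eval (fun g hg v =>
      (isLie_brackets_of_assoc assocMul_assoc).eval_eq_zero hg v) X hf
  · intro hf
    have h := (isLie_quotMul α).eval_eq_zero_of_expand_eq_zero
      (fun x => (consequences (lieIds F) α).mkQ (X x)) hf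
    rwa [eval_quotMul, subst_X, Submodule.mkQ_apply, Submodule.Quotient.mk_eq_zero] at h

/-! ### Associative interchange algebras -/

/-- The operations of an associative interchange algebra. -/
structure IsAI (m : Ops F A) : Prop where
  assoc : ∀ w a b c, m w (m w a b) c = m w a (m w b c)
  interchange : ∀ w a b c d,
    m w (m w.swap a b) (m w.swap c d) = m w.swap (m w a c) (m w b d)

theorem eval_assoc (m : Ops F A) (v : ℕ → A) (w : Op) : eval m v (assoc F w) =
    m w (m w (v 0) (v 1)) (v 2) - m w (v 0) (m w (v 1) (v 2)) := by
  simp [assoc, eval_freeMul, eval_X]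

theorem eval_interchange (m : Ops F A) (v : ℕ → A) : eval m v (interchange F) =
    m .bullet (m .circ (v 0) (v 1)) (m .circ (v 2) (v 3)) -
      m .circ (m .bullet (v 0) (v 2)) (m .bullet (v 1) (v 3)) := by
  simp [interchange, eval_freeMul, eval_X]

theorem assoc_mem_assocInterchange (w : Op) : assoc F w ∈ assocInterchange F := by
  cases w <;> simp [assocInterchange]

theorem interchange_mem_assocInterchange : interchange F ∈ assocInterchange F := by
  simp [assocInterchange]

theorem isAI_mulAI (α : Type*) : IsAI (mulAI F α) := by
  have interchange (a b c d : FreeAI F α) :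
      mulAI F α .bullet (mulAI F α .circ a b) (mulAI F α .circ c d) =
        mulAI F α .circ (mulAI F α .bullet a c) (mulAI F α .bullet b d) := by
    obtain ⟨a, rfl⟩ := Submodule.mkQ_surjective _ a
    obtain ⟨b, rfl⟩ := Submodule.mkQ_surjective _ b
    obtain ⟨c, rfl⟩ := Submodule.mkQ_surjective _ c
    obtain ⟨d, rfl⟩ := Submodule.mkQ_surjective _ d
    have h := eval_quotMul_eq_zero interchange_mem_assocInterchange
      (fun n => if n = 0 then a else if n = 1 then b else if n = 2 then c else d)
    rw [eval_interchange, sub_eq_zero] at h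
    simpa [mulAI] using h
  constructor
  · intro w a b c
    obtain ⟨a, rfl⟩ := Submodule.mkQ_surjective _ a
    obtain ⟨b, rfl⟩ := Submodule.mkQ_surjective _ b
    obtain ⟨c, rfl⟩ := Submodule.mkQ_surjective _ c
    have h := eval_quotMul_eq_zero (assoc_mem_assocInterchange w)
      (fun n => if n = 0 then a else if n = 1 then b else c)
    rw [eval_assoc, sub_eq_zero] at h
    simpa [mulAI] using h
  · rintro (_ | _) a b c d
    · exact (interchange a c b d).symm
    · exact interchange a b c d

section EvalAI

variable {m : Ops F A}

theorem IsAI.eval_eq_zero (hm : IsAI m) {g : FreeAlg F ℕ} (hg : g ∈ assocInterchange F)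
    (v : ℕ → A) : eval m v g = 0 := by
  simp only [assocInterchange, Set.mem_insert_iff, Set.mem_singleton_iff] at hg
  rcases hg with rfl | rfl | rfl
  · rw [eval_assoc, hm.assoc, sub_self]
  · rw [eval_assoc, hm.assoc, sub_self]
  · rw [eval_interchange, sub_eq_zero]
    exact hm.interchange .bullet _ _ _ _

theorem IsAI.evalMono_app (hm : IsAI m) (v : α → A) (w : Op) (s t : Mono α) :
    evalMono m v (app w s t) = m w (evalMono m v s) (evalMono m v t) := by
  induction s using app_induction (w := w) with
  | base s hs => rw [app_of_not_rooted hs]; rfl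
  | step a b hb => rw [app_op, evalMono, hb, evalMono, hm.assoc]

theorem IsAI.eval_assocMul (hm : IsAI m) (v : α → A) (w : Op) (p q : FreeAlg F α) :
    eval m v (assocMul w p q) = m w (eval m v p) (eval m v q) := by
  have h : (assocMul w).compr₂ (eval m v) = (m w).compl₁₂ (eval m v) (eval m v) :=
    bilinearMap_ext fun s t => by simp [eval_mono, hm.evalMono_app]
  exact LinearMap.congr_fun₂ h p q

theorem IsAI.eval_expand (hm : IsAI m) (v : α → A) (f : FreeAlg F α) :
    eval m v (expand f) = eval (brackets m) v f := by
  have h : eval m v ∘ₗ expand = eval (brackets m) v := linearMap_ext fun t => by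
    rw [LinearMap.comp_apply]
    induction t with
    | var x => rw [expand_var, eval_mono, eval_mono]; rfl
    | op w s t hs ht =>
      rw [eval_mono] at hs ht
      rw [expand_op, map_sub, hm.eval_assocMul, hm.eval_assocMul, hs, ht, eval_mono]
      simp [evalMono, brackets]
  exact LinearMap.congr_fun h f

/-- The operations `m` with the operation `u` replaced by its opposite. -/
def reverse (u : Op) (m : Ops F A) : Ops F A := fun w => if w = u then (m w).flip else m w

theorem IsAI.reverse (hm : IsAI m) (u : Op) : IsAI (reverse u m) := by
  constructor
  · intro w a b c
    by_cases h : w = u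
    · simpa [Interchange.reverse, h] using (hm.assoc u c b a).symm
    · simpa [Interchange.reverse, h] using hm.assoc w a b c
  · intro w a b c d
    by_cases h : w = u
    · subst h
      simpa [Interchange.reverse, w.swap_ne] using hm.interchange w c d a b
    · obtain rfl : w.swap = u := by cases w <;> cases u <;> first | rfl | exact absurd rfl h
      simpa [Interchange.reverse, w.swap_ne.symm] using hm.interchange w b a d c

end EvalAI

/-! ### Identities of the brackets -/

/-- A polynomial in two brackets that vanishes in all associative interchange algebras, expressed
in terms of its expansion. -/
def IsBracketId (f : FreeAlg F α) : Prop :=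
  expand f ∈ consequences (assocInterchange F) α

theorem IsBracketId.eval_eq_zero {m : Ops F A} {f : FreeAlg F α} (hf : IsBracketId f)
    (hm : IsAI m) (v : α → A) : eval (brackets m) v f = 0 := by
  rw [← hm.eval_expand]
  exact consequences_le_ker_eval (fun g hg v => hm.eval_eq_zero hg v) v hf

theorem rename_eq_subst (r : α → β) : rename r = subst (F := F) fun x => X (r x) :=
  linearMap_ext fun t => by
    rw [eval_mono, rename_mono]
    induction t with
    | var x => rfl
    | op w s t hs ht => rw [evalMono, ← hs, ← ht, freeMul_mono]; rfl

theorem rename_rename {γ : Type*} (r : α → β) (q : β → γ) (f : FreeAlg F α) :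
    rename q (rename r f) = rename (q ∘ r) f := by
  have h : rename q ∘ₗ rename r = rename (F := F) (q ∘ r) := linearMap_ext fun t => by
    simp [rename_mono, Mono.rename_rename]
  exact LinearMap.congr_fun h f

theorem rename_id (f : FreeAlg F α) : rename id f = f := by
  rw [rename_eq_subst]
  exact subst_X f

theorem mkQ_rename_expand_eq_eval (r : α → β) (f : FreeAlg F α) :
    (consequences (assocInterchange F) β).mkQ (rename r (expand f)) =
      eval (brackets (mulAI F β))
        (fun x => (consequences (assocInterchange F) β).mkQ (X (r x))) f := by
  rw [← (isAI_mulAI β).eval_expand, mulAI, eval_quotMul, rename_eq_subst]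

theorem isBracketId_of_eval_eq_zero {f : FreeAlg F α}
    (h : eval (brackets (mulAI F α))
      (fun x => (consequences (assocInterchange F) α).mkQ (X x)) f = 0) : IsBracketId f := by
  rw [IsBracketId, ← Submodule.Quotient.mk_eq_zero, ← Submodule.mkQ_apply, ← rename_id (expand f),
    mkQ_rename_expand_eq_eval]
  exact h

instance [IsEmpty α] : IsEmpty (Mono α) :=
  ⟨fun t => by
    induction t with
    | var x => exact isEmptyElim x
    | op _ _ _ h _ => exact h⟩

theorem mem_identities_iff (r : α ↪ β) (f : FreeAlg F α) :
    f ∈ identities (brackets (mulAI F β)) α ↔ IsBracketId f := by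
  simp only [identities, Submodule.mem_iInf, LinearMap.mem_ker]
  refine ⟨fun h => ?_, fun h v => h.eval_eq_zero (isAI_mulAI β) v⟩
  have hr : rename r (expand f) ∈ consequences (assocInterchange F) β := by
    rw [← Submodule.Quotient.mk_eq_zero, ← Submodule.mkQ_apply, mkQ_rename_expand_eq_eval, h]
  obtain _ | _ := isEmpty_or_nonempty α
  · have : Subsingleton (FreeAlg F α) := (monoBasis F α).repr.injective.subsingleton
    rw [IsBracketId, Subsingleton.elim (expand f) 0]
    exact Submodule.zero_mem _
  · have hinv := rename_mem_consequences _ (Function.invFun r) hr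
    rwa [rename_rename, Function.invFun_comp r.injective, rename_id] at hinv

theorem mem_allIds_iff {n : ℕ} (f : FreeAlg F (Fin n)) :
    f ∈ allIds F n ↔ f ∈ multilinear F n ∧ IsBracketId f := by
  rw [allIds, Submodule.mem_inf, mem_identities_iff Fin.valEmbedding]

/-- Multiplication of the monomials with an odd number of operations `u` by `-1`, which is the
effect of `reverse u` on polynomials in the brackets. -/
def signOp (u : Op) : FreeAlg F α →ₗ[F] FreeAlg F α :=
  extend fun t => (-1 : F) ^ t.opCount u • monoBasis F α t

theorem eval_signOp (u : Op) (m : Ops F A) (v : α → A) (f : FreeAlg F α) :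
    eval (brackets m) v (signOp u f) = eval (brackets (reverse u m)) v f := by
  have h : eval (brackets m) v ∘ₗ signOp u = eval (brackets (reverse u m)) v :=
    linearMap_ext fun t => by
      rw [LinearMap.comp_apply, signOp, extend_mono, map_smul, eval_mono, eval_mono]
      induction t with
      | var x => simp [evalMono, opCount]
      | op w s t hs ht =>
        have hmul : ((-1 : F) ^ (s.opCount u + t.opCount u)) •
            brackets m w (evalMono (brackets m) v s) (evalMono (brackets m) v t) =
            brackets m w (evalMono (brackets (reverse u m)) v s)
              (evalMono (brackets (reverse u m)) v t) := by
          rw [← hs, ← ht, map_smul, map_smul, LinearMap.smul_apply, smul_smul, ← pow_add, add_comm]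
        by_cases h : w = u
        · rw [opCount, if_pos h, add_assoc, pow_add, pow_one, mul_smul, evalMono, hmul]
          simp [evalMono, brackets, reverse, h]
        · rw [opCount, if_neg h, zero_add, evalMono, hmul]
          simp [evalMono, brackets, reverse, h]
  exact LinearMap.congr_fun h f

theorem IsBracketId.signOp {f : FreeAlg F α} (hf : IsBracketId f) (u : Op) :
    IsBracketId (signOp u f) := by
  apply isBracketId_of_eval_eq_zero
  rw [eval_signOp]
  exact hf.eval_eq_zero ((isAI_mulAI α).reverse u) _

theorem coef_signOp (u : Op) (T : Mono α) (f : FreeAlg F α) :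
    coef T (signOp u f) = (-1 : F) ^ T.opCount u * coef T f := by
  have h : coef T ∘ₗ signOp u = ((-1 : F) ^ T.opCount u) • (coef T : FreeAlg F α →ₗ[F] F) :=
    linearMap_ext fun t => by
      rw [LinearMap.comp_apply, signOp, extend_mono, map_smul, LinearMap.smul_apply]
      by_cases h : T.opCount u = t.opCount u
      · rw [h]
      · rw [coef_mono_eq_zero_of_opCount_ne h, smul_zero, smul_zero]
  exact LinearMap.congr_fun h f

/-! ### Rewriting monomials by associativity and interchange -/

/-- One application of associativity or of the interchange law inside a monomial. -/
inductive Rewrite : Mono α → Mono α → Prop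
  | assoc (w a b c) : Rewrite (.op w (.op w a b) c) (.op w a (.op w b c))
  | interchange (w a b c d) : Rewrite (.op w (.op w.swap a b) (.op w.swap c d))
      (.op w.swap (.op w a c) (.op w b d))
  | left (w s s₁ t) : Rewrite s s₁ → Rewrite (.op w s t) (.op w s₁ t)
  | right (w s t t₁) : Rewrite t t₁ → Rewrite (.op w s t) (.op w s t₁)

/-- The two products on the classes of monomials up to rewriting. -/
def classOp (w : Op) : Quot (@Rewrite α) → Quot (@Rewrite α) → Quot (@Rewrite α) :=
  Quot.map₂ (op w) (fun s _ _ h => .right w s _ _ h) (fun _ _ t h => .left w _ _ t h)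

/-- The associative interchange algebra with the classes of monomials as a basis. -/
def classMul : Ops F (Quot (@Rewrite α) →₀ F) := fun w =>
  Finsupp.basisSingleOne.constr F fun S =>
    Finsupp.basisSingleOne.constr F fun T => Finsupp.single (classOp w S T) 1

theorem classMul_single (w : Op) (S T : Quot (@Rewrite α)) (x y : F) :
    classMul w (.single S x) (.single T y) = Finsupp.single (classOp w S T) (x * y) := by
  simp [classMul, Module.Basis.constr_apply]

theorem classOp_assoc (w : Op) (S T R : Quot (@Rewrite α)) :
    classOp w (classOp w S T) R = classOp w S (classOp w T R) := by
  induction S, T, R using Quot.induction_on₃ with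
  | _ s t r => exact Quot.sound (.assoc w s t r)

theorem classOp_interchange (w : Op) (S T R Q : Quot (@Rewrite α)) :
    classOp w (classOp w.swap S T) (classOp w.swap R Q) =
      classOp w.swap (classOp w S R) (classOp w T Q) := by
  induction S, T, R using Quot.induction_on₃ with
  | _ s t r => induction Q using Quot.ind with
    | mk q => exact Quot.sound (.interchange w s t r q)

theorem isAI_classMul : IsAI (classMul (F := F) (α := α)) where
  assoc w a b c := by
    induction a using Finsupp.induction_linear with
    | zero => simp
    | add _ _ h h' => simp [h, h']
    | single S x => induction b using Finsupp.induction_linear with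
      | zero => simp
      | add _ _ h h' => simp [h, h']
      | single T y => induction c using Finsupp.induction_linear with
        | zero => simp
        | add _ _ h h' => simp [h, h']
        | single R z => simp only [classMul_single, classOp_assoc, mul_assoc]
  interchange w a b c d := by
    induction a using Finsupp.induction_linear with
    | zero => simp
    | add _ _ h h' => simp [h, h']
    | single S x => induction b using Finsupp.induction_linear with
      | zero => simp
      | add _ _ h h' => simp [h, h']
      | single T y => induction c using Finsupp.induction_linear with
        | zero => simp
        | add _ _ h h' => simp [h, h']
        | single R z => induction d using Finsupp.induction_linear with
          | zero => simp
          | add _ _ h h' => simp [h, h']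
          | single Q k =>
            simp only [classMul_single, classOp_interchange, mul_mul_mul_comm x y z k]

theorem evalMono_classMul (t : Mono α) :
    evalMono classMul (fun x => Finsupp.single (.mk _ (var x)) (1 : F)) t =
      Finsupp.single (.mk _ t) 1 := by
  induction t with
  | var x => rfl
  | op w s t hs ht => rw [evalMono, hs, ht, classMul_single, mul_one]; rfl

theorem consequences_le_ker_extend {g : Mono α → F} (hg : ∀ s t, Rewrite s t → g s = g t) :
    consequences (assocInterchange F) α ≤ LinearMap.ker (extend g) := by
  have h : extend g = Finsupp.linearCombination F (Quot.lift g hg) ∘ₗ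
      eval classMul (fun x => Finsupp.single (.mk _ (var x)) (1 : F)) :=
    linearMap_ext fun t => by simp [eval_mono, evalMono_classMul]
  rw [h]
  exact (consequences_le_ker_eval (fun _ hp => isAI_classMul.eval_eq_zero hp) _).trans
    (LinearMap.ker_le_ker_comp _ _)

theorem IsBracketId.extend_expand_eq_zero {f : FreeAlg F α} (hf : IsBracketId f) {g : Mono α → F}
    (hg : ∀ s t, Rewrite s t → g s = g t) : extend g (expand f) = 0 :=
  consequences_le_ker_extend hg hf

namespace Mono

/-- Boolean equality of monomials, which computes well in the kernel. -/
def beq [DecidableEq α] : Mono α → Mono α → Bool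
  | .var x, .var y => decide (x = y)
  | .op w a b, .op w' a' b' => decide (w = w') && beq a a' && beq b b'
  | _, _ => false

theorem beq_iff [DecidableEq α] (s t : Mono α) : beq s t = true ↔ s = t := by
  induction s generalizing t with
  | var x => cases t <;> simp [beq]
  | op w a b ha hb => cases t <;> simp [beq, ha, hb, and_assoc]

instance [DecidableEq α] : DecidableEq (Mono α) := fun s t => decidable_of_iff _ (beq_iff s t)

/-- The number of indeterminates of a monomial, with multiplicities. -/
def size : Mono α → ℕ
  | .var _ => 1
  | .op _ s t => s.size + t.size

theorem size_pos (t : Mono α) : 0 < t.size := by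
  induction t with
  | var _ => exact one_pos
  | op _ s t hs _ => exact Nat.add_pos_left hs _

theorem size_app (w : Op) (s t : Mono α) : (app w s t).size = s.size + t.size := by
  induction s using app_induction (w := w) with
  | base s hs => rw [app_of_not_rooted hs, size]
  | step a b hb => rw [app_op, size, hb, size, add_assoc]

theorem size_norm (t : Mono α) : t.norm.size = t.size := by
  induction t with
  | var x => rfl
  | op w s t hs ht => rw [norm, size_app, hs, ht, size]

theorem card_vars (t : Mono α) : t.vars.card = t.size := by
  induction t with
  | var x => rfl
  | op w s t hs ht => rw [vars, Multiset.card_add, hs, ht, size]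

theorem size_rewrite {s t : Mono α} (h : Rewrite s t) : s.size = t.size := by
  induction h with
  | assoc w a b c => simp only [size]; omega
  | interchange w a b c d => simp only [size]; omega
  | left w s s' t _ ih => simp only [size]; omega
  | right w s t t' _ ih => simp only [size]; omega

/-- The decompositions of a right-associated monomial as a product of two factors. -/
def splits (w : Op) : Mono α → List (Mono α × Mono α)
  | .var _ => []
  | .op w' a b => if w' = w then (a, b) :: (splits w b).map fun p => (.op w a p.1, p.2) else []

theorem mem_splits_app (w : Op) (s t : Mono α) : (s, t) ∈ splits w (app w s t) := by
  induction s using app_induction (w := w) with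
  | base s hs => simp [app_of_not_rooted hs, splits]
  | step a b hb =>
    simp only [app_op, splits, if_true, List.mem_cons, List.mem_map]
    exact Or.inr ⟨_, hb, rfl⟩

/-- The normal forms of the monomials that arise by one application of the interchange law.
The first argument bounds the depth. -/
def nbrs : ℕ → Mono α → List (Mono α)
  | 0, _ => []
  | _ + 1, .var _ => []
  | n + 1, .op w s t => (splits w (.op w s t)).flatMap fun p =>
      (nbrs n p.1).map (app w · p.2) ++ ((nbrs n p.2).map (app w p.1 ·) ++
        (splits w.swap p.1).flatMap fun a => (splits w.swap p.2).map fun c =>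
          app w.swap (app w a.1 c.1) (app w a.2 c.2))

section Nbrs

variable {n : ℕ} {w : Op} {s t r : Mono α}

theorem mem_nbrs_app (h : r ∈ (nbrs n s).map (app w · t) ++ ((nbrs n t).map (app w s ·) ++
    (splits w.swap s).flatMap fun a => (splits w.swap t).map fun c =>
      app w.swap (app w a.1 c.1) (app w a.2 c.2))) : r ∈ nbrs (n + 1) (app w s t) := by
  have hs := mem_splits_app w s t
  have hw := rooted_app w w s t
  generalize app w s t = p at hs hw
  cases p with
  | var x => simp [splits] at hs
  | op w' a b =>
    obtain rfl : w' = w := by simpa using hw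
    rw [nbrs, List.mem_flatMap]
    exact ⟨_, hs, h⟩

theorem app_mem_nbrs_left (h : r ∈ nbrs n s) : app w r t ∈ nbrs (n + 1) (app w s t) :=
  mem_nbrs_app (List.mem_append_left _ (List.mem_map_of_mem h))

theorem app_mem_nbrs_right (h : r ∈ nbrs n t) : app w s r ∈ nbrs (n + 1) (app w s t) :=
  mem_nbrs_app (List.mem_append_right _ (List.mem_append_left _ (List.mem_map_of_mem h)))

theorem interchange_mem_nbrs (w : Op) (a b c d : Mono α) :
    app w.swap (app w a c) (app w b d) ∈
      nbrs (n + 1) (app w (app w.swap a b) (app w.swap c d)) := by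
  refine mem_nbrs_app (List.mem_append_right _ (List.mem_append_right _ ?_))
  simp only [List.mem_flatMap, List.mem_map]
  exact ⟨(a, b), mem_splits_app _ _ _, (c, d), mem_splits_app _ _ _, rfl⟩

theorem interchange_symm_mem_nbrs (w : Op) (a b c d : Mono α) :
    app w (app w.swap a b) (app w.swap c d) ∈
      nbrs (n + 1) (app w.swap (app w a c) (app w b d)) := by
  simpa using interchange_mem_nbrs w.swap a c b d

theorem norm_rewrite (h : Rewrite s t) (hn : s.size ≤ n) :
    s.norm = t.norm ∨ s.norm ∈ nbrs n t.norm ∧ t.norm ∈ nbrs n s.norm := by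
  induction h generalizing n with
  | assoc w a b c => exact Or.inl (by simp [norm, app_assoc])
  | interchange w a b c d =>
    obtain ⟨n, rfl⟩ := Nat.exists_eq_add_one.mpr ((size_pos _).trans_le hn)
    exact Or.inr ⟨interchange_symm_mem_nbrs w _ _ _ _, interchange_mem_nbrs w _ _ _ _⟩
  | left w s s' t _ ih =>
    obtain ⟨n, rfl⟩ := Nat.exists_eq_add_one.mpr ((size_pos _).trans_le hn)
    have ht := t.size_pos
    rw [size] at hn
    rcases ih (n := n) (by omega) with h | ⟨hs, hs'⟩
    · exact Or.inl (by rw [norm, norm, h])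
    · exact Or.inr ⟨app_mem_nbrs_left hs, app_mem_nbrs_left hs'⟩
  | right w s t t' _ ih =>
    obtain ⟨n, rfl⟩ := Nat.exists_eq_add_one.mpr ((size_pos _).trans_le hn)
    have hs := s.size_pos
    rw [size] at hn
    rcases ih (n := n) (by omega) with h | ⟨ht, ht'⟩
    · exact Or.inl (by rw [norm, norm, h])
    · exact Or.inr ⟨app_mem_nbrs_right ht, app_mem_nbrs_right ht'⟩

end Nbrs

/-- The list consists of different monomials of degree `n` and is closed under interchange. -/
def closed [DecidableEq α] (n : ℕ) (L : List (Mono α)) : Bool :=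
  decide L.Nodup && L.all fun T => T.size == n && (nbrs n T).all fun S => decide (S ∈ L)

/-- Closure of a list of monomials of degree `n` under interchange: `new` are those whose
neighbours are still to be added. The second argument bounds the number of rounds. -/
def close [DecidableEq α] (n : ℕ) : ℕ → List (Mono α) → List (Mono α) → List (Mono α)
  | 0, L, _ => L
  | k + 1, L, new => match ((new.flatMap (nbrs n)).filter fun T => decide (T ∉ L)).dedup with
    | [] => L
    | T :: new' => close n k (L ++ T :: new') (T :: new')

/-- The list `K` consists of the monomials that are equivalent to its head under interchange and
have the same parity of the number of `∘`. The number of rounds in `close` need not be justified,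
because the result is tested by `closed`. -/
def isParityClass [DecidableEq α] : List (Mono α) → Bool
  | [] => false
  | T :: K =>
    let L := close T.size T.size [T] [T]
    closed T.size L &&
      (L.filter fun S => S.opCount .circ % 2 == T.opCount .circ % 2).isPerm (T :: K)

theorem norm_mem_iff_of_rewrite [DecidableEq α] {n : ℕ} {L : List (Mono α)}
    (hL : closed n L = true) {s t : Mono α} (h : Rewrite s t) : s.norm ∈ L ↔ t.norm ∈ L := by
  simp only [closed, Bool.and_eq_true, decide_eq_true_eq, List.all_eq_true, beq_iff_eq] at hL
  by_cases hs : s.size = n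
  · rcases norm_rewrite h hs.le with h | ⟨h₁, h₂⟩
    · rw [h]
    · exact ⟨fun h => (hL.2 _ h).2 _ h₂, fun h => (hL.2 _ h).2 _ h₁⟩
  · have ht : t.size ≠ n := size_rewrite h ▸ hs
    rw [← size_norm] at hs ht
    exact iff_of_false (fun h => hs (hL.2 _ h).1) (fun h => ht (hL.2 _ h).1)

end Mono

theorem sum_repr_eq_extend_norm_mem [DecidableEq α] {L : List (Mono α)} (hL : L.Nodup)
    {p : FreeAlg F α} (hp : p ∈ Submodule.span F (monoBasis F α '' {T | T.isNormal})) :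
    (L.map fun T => (monoBasis F α).repr p T).sum =
      extend (fun t => if t.norm ∈ L then (1 : F) else 0) p := by
  induction hp using Submodule.span_induction with
  | zero => simp
  | add p q _ _ hp hq => simp [List.sum_map_add, hp, hq]
  | smul c p _ hp => simp [List.sum_map_mul_left, hp]
  | mem _ hx =>
    obtain ⟨T, hT, rfl⟩ := hx
    rw [extend_mono, norm_of_isNormal hT, Module.Basis.repr_self,
      ← List.sum_toFinset _ hL]
    simp [Finsupp.single_apply]

theorem IsBracketId.sum_coef_eq_zero_of_closed [DecidableEq α] {n : ℕ} {L : List (Mono α)}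
    (hL : closed n L = true) {f : FreeAlg F α} (hf : IsBracketId f) :
    (L.map fun T => coef T f).sum = 0 := by
  have hnodup : L.Nodup := by
    rw [closed, Bool.and_eq_true, decide_eq_true_eq] at hL
    exact hL.1
  simp only [coef_apply]
  rw [sum_repr_eq_extend_norm_mem hnodup (expand_mem_span_isNormal f)]
  exact hf.extend_expand_eq_zero fun s t h => if_congr (norm_mem_iff_of_rewrite hL h) rfl rfl

theorem two_mul_sum_filter_parity {R ι : Type*} [CommRing R] (L : List ι) (p : ι → ℕ) (c : ι → R)
    (k : ℕ) : 2 * ((L.filter fun i => p i % 2 == k % 2).map c).sum =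
      (L.map c).sum + (-1) ^ k * (L.map fun i => (-1) ^ p i * c i).sum := by
  induction L with
  | nil => simp
  | cons i L ih =>
    have hsign : (-1 : R) ^ k * (-1) ^ p i = if p i % 2 == k % 2 then 1 else -1 := by
      rw [← pow_add, neg_one_pow_eq_ite]
      refine if_congr ?_ rfl rfl
      rw [Nat.even_iff, beq_iff_eq]
      omega
    rw [List.filter_cons, List.map_cons, List.map_cons, List.sum_cons, List.sum_cons, mul_add,
      ← mul_assoc, hsign]
    split
    · rw [List.map_cons, List.sum_cons, mul_add, ih]; ring
    · rw [ih]; ring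

theorem IsBracketId.sum_coef_eq_zero_of_isParityClass [NeZero (2 : F)] [DecidableEq α]
    {K : List (Mono α)} (hK : isParityClass K = true) {f : FreeAlg F α} (hf : IsBracketId f) :
    (K.map fun T => coef T f).sum = 0 := by
  cases K with
  | nil => simp
  | cons T K =>
    simp only [isParityClass, Bool.and_eq_true, List.isPerm_iff] at hK
    have hsigned := (hf.signOp .circ).sum_coef_eq_zero_of_closed hK.1
    simp only [coef_signOp] at hsigned
    have h := two_mul_sum_filter_parity (close T.size T.size [T] [T]) (opCount .circ)
      (fun S => coef S f) (T.opCount .circ)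
    rw [hf.sum_coef_eq_zero_of_closed hK.1, hsigned, mul_zero, add_zero] at h
    rw [← (hK.2.map _).sum_eq]
    exact (mul_eq_zero.mp h).resolve_left two_ne_zero

section Rename

variable {n : ℕ}

theorem coef_rename_perm (g : Equiv.Perm α) (T : Mono α) (f : FreeAlg F α) :
    coef (T.rename g) f = coef T (rename g.symm f) := by
  rw [← coef_rename g.symm.injective, Mono.rename_rename, g.symm_comp_self, Mono.rename_id]

theorem bijective_of_vars_rename {g : Fin n → Fin n} {T : Mono (Fin n)}
    (h : (T.rename g).vars = (Finset.univ : Finset (Fin n)).val) : Function.Bijective g := by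
  rw [← Finite.surjective_iff_bijective]
  intro x
  have hx : x ∈ (T.rename g).vars := by rw [h]; exact Finset.mem_univ x
  rw [vars_rename, Multiset.mem_map] at hx
  exact hx.imp fun _ => And.right

theorem coef_rename_of_not_bijective {g : Fin n → Fin n} (hg : ¬ Function.Bijective g)
    (T : Mono (Fin n)) {f : FreeAlg F (Fin n)} (hf : f ∈ multilinear F n) :
    coef (T.rename g) f = 0 :=
  coef_eq_zero_of_vars_ne (fun h => hg (bijective_of_vars_rename h)) hf

theorem sum_coef_rename_eq_zero_of_isParityClass [NeZero (2 : F)] {K : List (Mono (Fin n))}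
    (hK : isParityClass K = true) {f : FreeAlg F (Fin n)} (hf : f ∈ allIds F n)
    (g : Fin n → Fin n) : (K.map fun T => coef (T.rename g) f).sum = 0 := by
  by_cases hg : Function.Bijective g
  · obtain ⟨g, rfl⟩ : ∃ e : Equiv.Perm (Fin n), ⇑e = g := ⟨Equiv.ofBijective g hg, rfl⟩
    simp only [coef_rename_perm]
    exact ((mem_allIds_iff _).mp
      (rename_mem_allIds g.symm hf)).2.sum_coef_eq_zero_of_isParityClass hK
  · exact List.sum_eq_zero <| List.forall_mem_map.mpr fun T _ =>
      coef_rename_of_not_bijective hg T hf.1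

end Rename

/-! ### Enumeration of the monomials of degree six -/

namespace Mono

/-- The monomials obtained by reversing products with two or three factors; none if there is a
product with more factors. -/
def variants : Mono α → List (Mono α)
  | .var x => [.var x]
  | .op w a (.op w' b c) =>
    if w' = w then
      if c.rooted w then [] else
        (variants a).flatMap fun x => (variants b).flatMap fun y => (variants c).flatMap fun z =>
          [.op w x (.op w y z), .op w z (.op w y x)]
    else (variants a).flatMap fun x => (variants (.op w' b c)).flatMap fun y =>
      [.op w x y, .op w y x]
  | .op w a (.var y) => (variants a).flatMap fun x => [.op w x (.var y), .op w (.var y) x]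

theorem rooted_of_mem_variants {s t : Mono α} (h : s ∈ t.variants) (w : Op) :
    s.rooted w = t.rooted w := by
  cases t with
  | var x => simp only [variants, List.mem_singleton] at h; rw [h]
  | op w' a b =>
    cases b with
    | var y =>
      simp only [variants, List.mem_flatMap, List.mem_cons, List.not_mem_nil, or_false] at h
      obtain ⟨x, -, rfl | rfl⟩ := h <;> rfl
    | op w'' b c =>
      rw [variants] at h
      split at h
      · split at h
        · simp at h
        · simp only [List.mem_flatMap, List.mem_cons, List.not_mem_nil, or_false] at h
          obtain ⟨x, -, y, -, z, -, rfl | rfl⟩ := h <;> rfl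
      · simp only [List.mem_flatMap, List.mem_cons, List.not_mem_nil, or_false] at h
        obtain ⟨x, -, y, -, rfl | rfl⟩ := h <;> rfl

/-- The list of indeterminates of a monomial, from left to right. -/
def leaves : Mono α → List α
  | .var x => [x]
  | .op _ s t => s.leaves ++ t.leaves

theorem length_leaves (t : Mono α) : t.leaves.length = t.size := by
  induction t with
  | var x => rfl
  | op w s t hs ht => simp [leaves, size, hs, ht]

section Standard

variable (n : ℕ) [NeZero n]

/-- The monomial with its indeterminates replaced by `k, k + 1, …`, from left to right. -/
def standard (k : ℕ) : Mono α → Mono (Fin n)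
  | .var _ => .var (Fin.ofNat n k)
  | .op w s t => .op w (s.standard k) (t.standard (k + s.size))

/-- All monomials of degree `d` in the indeterminates `k, k + 1, …`, in this order. The first
numerical argument bounds the recursion. -/
def standards : ℕ → ℕ → ℕ → List (Mono (Fin n))
  | 0, _, _ => []
  | m + 1, d, k => if d = 1 then [.var (Fin.ofNat n k)] else
      (List.range (d - 1)).flatMap fun i => (standards m (i + 1) k).flatMap fun s =>
        (standards m (d - 1 - i) (k + (i + 1))).flatMap fun t =>
          [.op .circ s t, .op .bullet s t]

theorem standard_mem_standards (t : Mono α) {m : ℕ} (k : ℕ) (hm : t.size ≤ m) :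
    t.standard n k ∈ standards n m t.size k := by
  induction t generalizing m k with
  | var x =>
    obtain ⟨m, rfl⟩ := Nat.exists_eq_add_one.mpr ((size_pos _).trans_le hm)
    simp [standards, size, standard]
  | op w s t hs ht =>
    obtain ⟨m, rfl⟩ := Nat.exists_eq_add_one.mpr ((size_pos _).trans_le hm)
    have hs_pos := s.size_pos
    have ht_pos := t.size_pos
    rw [size] at hm
    have hsize : s.size - 1 + 1 = s.size := by omega
    have hsize' : (op w s t).size - 1 - (s.size - 1) = t.size := by rw [size]; omega
    rw [standards, if_neg (by rw [size]; omega), List.mem_flatMap]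
    refine ⟨s.size - 1, by rw [size, List.mem_range]; omega, ?_⟩
    rw [hsize, hsize']
    simp only [List.mem_flatMap]
    refine ⟨_, hs k (by omega), _, ht (k + s.size) (by omega), ?_⟩
    cases w <;> simp [standard]

variable {n}

theorem rename_standard (t : Mono α) (k : ℕ) (g : Fin n → α)
    (hg : ∀ i < t.size, t.leaves[i]? = some (g (Fin.ofNat n (k + i)))) :
    (t.standard n k).rename g = t := by
  induction t generalizing k with
  | var x => simpa [standard, rename, leaves, size, eq_comm] using hg 0
  | op w s t hs ht =>
    simp only [size, leaves] at hg
    rw [standard, rename, hs k, ht (k + s.size)]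
    · intro i hi
      rw [add_assoc, ← hg (s.size + i) (by omega),
        List.getElem?_append_right (by rw [length_leaves]; omega), length_leaves,
        Nat.add_sub_cancel_left]
    · intro i hi
      rw [← hg i (by omega), List.getElem?_append_left (by rw [length_leaves]; omega)]

theorem rooted_standard (t : Mono α) (k : ℕ) (w : Op) :
    (t.standard n k).rooted w = t.rooted w := by
  cases t <;> rfl

theorem isNormal_standard (t : Mono α) (k : ℕ) : (t.standard n k).isNormal = t.isNormal := by
  induction t generalizing k with
  | var x => rfl
  | op w s t hs ht => simp only [standard, isNormal, hs, ht, rooted_standard]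

theorem exists_perm_rename_standard {T : Mono (Fin n)}
    (hT : T.vars = (Finset.univ : Finset (Fin n)).val) :
    ∃ g : Equiv.Perm (Fin n), (T.standard n 0).rename g = T := by
  have hsize : T.size = n := by rw [← card_vars, hT, Finset.card_val, Finset.card_fin]
  let g : Fin n → Fin n := fun i => T.leaves[i]'(by rw [length_leaves, hsize]; exact i.2)
  have hg : (T.standard n 0).rename g = T := rename_standard T 0 g fun i hi => by
    rw [hsize] at hi
    rw [List.getElem?_eq_getElem (by rw [length_leaves, hsize]; exact hi)]
    simp [g, Nat.mod_eq_of_lt hi]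
  exact ⟨Equiv.ofBijective g (bijective_of_vars_rename (hg ▸ hT)), hg⟩

end Standard

end Mono

section Variants

variable {w : Op} {a b c s x y z : Mono α}

theorem coefMono_pair_variant (ha : a.rooted w = false) (hb : b.rooted w = false)
    (hx : x.rooted w = false) (hy : y.rooted w = false)
    (hxa : (coefMono x : Mono α → F) = coefMono a ∨ (coefMono x : Mono α → F) = -coefMono a)
    (hyb : (coefMono y : Mono α → F) = coefMono b ∨ (coefMono y : Mono α → F) = -coefMono b)
    (hs : s = op w x y ∨ s = op w y x) :
    (coefMono s : Mono α → F) = coefMono (op w a b) ∨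
      (coefMono s : Mono α → F) = -coefMono (op w a b) := by
  rw [coefMono_op ha hb]
  rcases hs with rfl | rfl <;> rcases hxa with hxa | hxa <;> rcases hyb with hyb | hyb <;>
    simp [coefMono_op, hx, hy, hxa, hyb, pair_swap w (coefMono a) (coefMono b)]

theorem coefMono_triple_variant (ha : a.rooted w = false) (hb : b.rooted w = false)
    (hc : c.rooted w = false) (hx : x.rooted w = false) (hy : y.rooted w = false)
    (hz : z.rooted w = false)
    (hxa : (coefMono x : Mono α → F) = coefMono a ∨ (coefMono x : Mono α → F) = -coefMono a)
    (hyb : (coefMono y : Mono α → F) = coefMono b ∨ (coefMono y : Mono α → F) = -coefMono b)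
    (hzc : (coefMono z : Mono α → F) = coefMono c ∨ (coefMono z : Mono α → F) = -coefMono c)
    (hs : s = op w x (op w y z) ∨ s = op w z (op w y x)) :
    (coefMono s : Mono α → F) = coefMono (op w a (op w b c)) ∨
      (coefMono s : Mono α → F) = -coefMono (op w a (op w b c)) := by
  have hs' : (coefMono s : Mono α → F) = triple w (coefMono x) (coefMono y) (coefMono z) := by
    rcases hs with rfl | rfl
    · exact coefMono_op_op hx hy hz
    · rw [coefMono_op_op hz hy hx, triple_reverse]
  rw [hs', coefMono_op_op ha hb hc]
  rcases hxa with hxa | hxa <;> rcases hyb with hyb | hyb <;> rcases hzc with hzc | hzc <;>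
    simp [hxa, hyb, hzc]

theorem coefMono_of_mem_variants {s t : Mono α} (h : s ∈ t.variants) (ht : t.isNormal = true) :
    (coefMono s : Mono α → F) = coefMono t ∨ (coefMono s : Mono α → F) = -coefMono t := by
  induction t using variants.induct generalizing s with
  | case1 x => rw [variants, List.mem_singleton] at h; exact Or.inl (by rw [h])
  | case2 a w b c hc => simp [variants, hc] at h
  | case3 a w b c hc ihc ihb iha =>
    rw [Bool.not_eq_true] at hc
    simp only [isNormal, Bool.and_eq_true, Bool.not_eq_true'] at ht
    simp only [variants, hc, if_true, Bool.false_eq_true, if_false, List.mem_flatMap,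
      List.mem_cons, List.not_mem_nil, or_false] at h
    obtain ⟨⟨ha, ha'⟩, ⟨hb, hb'⟩, hc'⟩ := ht
    obtain ⟨x, hx, y, hy, z, hz, hs⟩ := h
    exact coefMono_triple_variant ha hb hc ((rooted_of_mem_variants hx w).trans ha)
      ((rooted_of_mem_variants hy w).trans hb) ((rooted_of_mem_variants hz w).trans hc)
      (iha hx ha') (ihb hy hb') (ihc hz hc') hs
  | case4 w a w' b c hw ihb iha =>
    rw [isNormal, Bool.and_eq_true, Bool.and_eq_true, Bool.not_eq_true'] at ht
    rw [variants, if_neg hw] at h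
    simp only [List.mem_flatMap, List.mem_cons, List.not_mem_nil, or_false] at h
    obtain ⟨⟨ha, ha'⟩, hb'⟩ := ht
    obtain ⟨x, hx, y, hy, hs⟩ := h
    have hb : (op w' b c).rooted w = false := decide_eq_false hw
    exact coefMono_pair_variant ha hb ((rooted_of_mem_variants hx w).trans ha)
      ((rooted_of_mem_variants hy w).trans hb) (iha hx ha') (ihb hy hb') hs
  | case5 w a y iha =>
    simp only [isNormal, Bool.and_eq_true, Bool.not_eq_true'] at ht
    simp only [variants, List.mem_flatMap, List.mem_cons, List.not_mem_nil, or_false] at h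
    obtain ⟨⟨ha, ha'⟩, -⟩ := ht
    obtain ⟨x, hx, hs⟩ := h
    exact coefMono_pair_variant ha rfl ((rooted_of_mem_variants hx w).trans ha) rfl
      (iha hx ha') (Or.inl rfl) hs

end Variants

theorem coef_eq_zero_of_mem_variants {T s : Mono α} (hT : T ∈ s.variants) (hs : s.isNormal = true)
    {f : FreeAlg F α} (h : coef T f = 0) : coef s f = 0 := by
  rw [coef_eq_extend] at h ⊢
  rcases coefMono_of_mem_variants (F := F) hT hs with e | e
  · rwa [e] at h
  · rwa [e, map_neg, LinearMap.neg_apply, neg_eq_zero] at h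

namespace Mono

section Trees

variable (u : Op) (a b c d e f : α)

/-- The monomial `a ∘ ((b ∘ (c • d)) • (e ∘ f))`, `∘` being `u`. -/
def treeR : Mono α :=
  op u (var a) (op u.swap (op u (var b) (op u.swap (var c) (var d))) (op u (var e) (var f)))

/-- The monomial `(a • (b ∘ c)) ∘ (d • e) ∘ f`, `∘` being `u`. -/
def treeQ : Mono α :=
  op u (op u.swap (var a) (op u (var b) (var c))) (op u (op u.swap (var d) (var e)) (var f))

/-- The monomial `(a • b) ∘ (c • (d ∘ e)) ∘ f`, `∘` being `u`. -/
def treeQ' : Mono α :=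
  op u (op u.swap (var a) (var b)) (op u (op u.swap (var c) (op u (var d) (var e))) (var f))

/-- The monomial `(a • b) ∘ (c • d) ∘ (e • f)`, `∘` being `u`. -/
def treeN : Mono α :=
  op u (op u.swap (var a) (var b))
    (op u (op u.swap (var c) (var d)) (op u.swap (var e) (var f)))

/-- The monomial `(a ∘ b ∘ c) • (d ∘ e ∘ f)`, `∘` being `u`. -/
def treeS : Mono α :=
  op u.swap (op u (var a) (op u (var b) (var c))) (op u (var d) (op u (var e) (var f)))

/-- The monomial `(a • (b ∘ c)) ∘ (d • (e ∘ f))`, `∘` being `u`. -/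
def treeU : Mono α :=
  op u (op u.swap (var a) (op u (var b) (var c))) (op u.swap (var d) (op u (var e) (var f)))

/-- The monomial `((a ∘ b) • (c ∘ d)) ∘ (e • f)`, `∘` being `u`. -/
def treeW : Mono α :=
  op u (op u.swap (op u (var a) (var b)) (op u (var c) (var d))) (op u.swap (var e) (var f))

/-- The monomial `(a • b) ∘ (c • (d ∘ e ∘ f))`, `∘` being `u`. -/
def treeY : Mono α :=
  op u (op u.swap (var a) (var b)) (op u.swap (var c) (op u (var d) (op u (var e) (var f))))

/-- The monomial `(a ∘ b) • (c ∘ d ∘ (e • f))`, `∘` being `u`. -/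
def treeA : Mono α :=
  op u.swap (op u (var a) (var b)) (op u (var c) (op u (var d) (op u.swap (var e) (var f))))

/-- The monomial `(a ∘ (b • c)) • (d ∘ e ∘ f)`, `∘` being `u`. -/
def treeB : Mono α :=
  op u.swap (op u (var a) (op u.swap (var b) (var c))) (op u (var d) (op u (var e) (var f)))

/-- The monomial `(a ∘ b) • (c ∘ (d • (e ∘ f)))`, `∘` being `u`. -/
def treeD : Mono α :=
  op u.swap (op u (var a) (var b)) (op u (var c) (op u.swap (var d) (op u (var e) (var f))))

end Trees

/-- The monomials of degree `6` to which the others can be reduced: up to interchange, reversal of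
products and renaming, every monomial is one of these or alone in its parity class. -/
def representatives (u : Op) : List (Mono (Fin 6)) :=
  [treeR, treeQ, treeQ', treeN, treeS, treeU, treeW, treeY, treeA, treeB, treeD].map
    fun tree => tree u 0 1 2 3 4 5

/-- The monomial is alone in its parity class, or is a variant of a representative. -/
def covered (s : Mono (Fin 6)) : Bool :=
  isParityClass [s] || s.variants.any fun T =>
    (representatives .circ ++ representatives .bullet).any fun r =>
      beq T (r.rename fun i : Fin 6 => T.leaves.getD i 0)

theorem covered_standards :
    ((standards 6 6 6 0).all fun s => !s.isNormal || covered s) = true := by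
  decide +kernel

end Mono

theorem coef_eq_zero_of_covered [NeZero (2 : F)] {s : Mono (Fin 6)} (hs : s.isNormal = true)
    (hcov : covered s = true) {f : FreeAlg F (Fin 6)} (hf : IsBracketId f)
    (h : ∀ u, ∀ r ∈ representatives u, ∀ g : Fin 6 → Fin 6, coef (r.rename g) f = 0) :
    coef s f = 0 := by
  rw [covered, Bool.or_eq_true] at hcov
  rcases hcov with halone | hvariant
  · simpa using hf.sum_coef_eq_zero_of_isParityClass halone
  · obtain ⟨T, hT, hr⟩ := List.any_eq_true.mp hvariant
    obtain ⟨r, hr, hTr⟩ := List.any_eq_true.mp hr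
    refine coef_eq_zero_of_mem_variants hT hs ?_
    rw [(beq_iff _ _).mp hTr]
    rcases List.mem_append.mp hr with hr | hr
    · exact h .circ r hr _
    · exact h .bullet r hr _

theorem expand_eq_zero_of_representatives [NeZero (2 : F)] {f : FreeAlg F (Fin 6)}
    (hf : f ∈ allIds F 6)
    (h : ∀ u, ∀ r ∈ representatives u, ∀ g : Fin 6 → Fin 6, coef (r.rename g) f = 0) :
    expand f = 0 := by
  rw [expand_eq_zero_iff]
  intro T
  by_cases hvars : T.vars = (Finset.univ : Finset (Fin 6)).val
  swap
  · exact coef_eq_zero_of_vars_ne hvars hf.1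
  by_cases hnormal : T.isNormal = true
  swap
  · exact coef_eq_zero_of_not_isNormal (by simpa using hnormal) f
  obtain ⟨g, hg⟩ := exists_perm_rename_standard hvars
  have hstd : (T.standard 6 0).isNormal = true := by rw [isNormal_standard, hnormal]
  have hcov : covered (T.standard 6 0) = true := by
    have hsize : T.size = 6 := by rw [← card_vars, hvars]; rfl
    have := List.all_eq_true.mp covered_standards _ (hsize ▸ standard_mem_standards 6 T 0 hsize.le)
    rwa [hstd, Bool.not_true, Bool.false_or] at this
  rw [← hg, coef_rename_perm]
  refine coef_eq_zero_of_covered hstd hcov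
    ((mem_allIds_iff _).mp (rename_mem_allIds g.symm hf)).2 fun u r hr g' => ?_
  rw [← coef_rename_perm, Mono.rename_rename]
  exact h u r hr _

/-! ### Symmetries of the coefficients of representatives -/

section TreeSymmetries

variable (u : Op) (p : FreeAlg F α) (a b c d e f : α)

theorem triple_add_of_mid (w : Op) (x y z : Mono α → F) :
    triple w x z y + triple w z x y = -triple w x y z := by
  have h := triple_shuffle w x y z
  rw [← triple_reverse w y x z, ← triple_reverse w y z x] at h
  rw [eq_neg_iff_add_eq_zero, ← h]
  abel

theorem coefMono_treeR : (coefMono (treeR u a b c d e f) : Mono α → F) =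
    pair u (coefMono (var a)) (pair u.swap
      (pair u (coefMono (var b)) (pair u.swap (coefMono (var c)) (coefMono (var d))))
      (pair u (coefMono (var e)) (coefMono (var f)))) := by
  simp [treeR, coefMono_op]

theorem coefMono_treeQ : (coefMono (treeQ u a b c d e f) : Mono α → F) =
    triple u (pair u.swap (coefMono (var a)) (pair u (coefMono (var b)) (coefMono (var c))))
      (pair u.swap (coefMono (var d)) (coefMono (var e))) (coefMono (var f)) := by
  simp [treeQ, coefMono_op, coefMono_op_op]

theorem coefMono_treeQ' : (coefMono (treeQ' u a b c d e f) : Mono α → F) =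
    triple u (pair u.swap (coefMono (var a)) (coefMono (var b)))
      (pair u.swap (coefMono (var c)) (pair u (coefMono (var d)) (coefMono (var e))))
      (coefMono (var f)) := by
  simp [treeQ', coefMono_op, coefMono_op_op]

theorem coefMono_treeN : (coefMono (treeN u a b c d e f) : Mono α → F) =
    triple u (pair u.swap (coefMono (var a)) (coefMono (var b)))
      (pair u.swap (coefMono (var c)) (coefMono (var d)))
      (pair u.swap (coefMono (var e)) (coefMono (var f))) := by
  simp [treeN, coefMono_op, coefMono_op_op]

theorem coefMono_treeS : (coefMono (treeS u a b c d e f) : Mono α → F) =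
    pair u.swap (triple u (coefMono (var a)) (coefMono (var b)) (coefMono (var c)))
      (triple u (coefMono (var d)) (coefMono (var e)) (coefMono (var f))) := by
  simp [treeS, coefMono_op, coefMono_op_op]

theorem coefMono_treeU : (coefMono (treeU u a b c d e f) : Mono α → F) =
    pair u (pair u.swap (coefMono (var a)) (pair u (coefMono (var b)) (coefMono (var c))))
      (pair u.swap (coefMono (var d)) (pair u (coefMono (var e)) (coefMono (var f)))) := by
  simp [treeU, coefMono_op]

theorem coefMono_treeW : (coefMono (treeW u a b c d e f) : Mono α → F) =
    pair u (pair u.swap (pair u (coefMono (var a)) (coefMono (var b)))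
      (pair u (coefMono (var c)) (coefMono (var d))))
      (pair u.swap (coefMono (var e)) (coefMono (var f))) := by
  simp [treeW, coefMono_op]

theorem coefMono_treeY : (coefMono (treeY u a b c d e f) : Mono α → F) =
    pair u (pair u.swap (coefMono (var a)) (coefMono (var b))) (pair u.swap (coefMono (var c))
      (triple u (coefMono (var d)) (coefMono (var e)) (coefMono (var f)))) := by
  simp [treeY, coefMono_op, coefMono_op_op]

theorem coefMono_treeA : (coefMono (treeA u a b c d e f) : Mono α → F) =
    pair u.swap (pair u (coefMono (var a)) (coefMono (var b))) (triple u (coefMono (var c))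
      (coefMono (var d)) (pair u.swap (coefMono (var e)) (coefMono (var f)))) := by
  simp [treeA, coefMono_op, coefMono_op_op]

theorem coefMono_treeB : (coefMono (treeB u a b c d e f) : Mono α → F) =
    pair u.swap (pair u (coefMono (var a)) (pair u.swap (coefMono (var b)) (coefMono (var c))))
      (triple u (coefMono (var d)) (coefMono (var e)) (coefMono (var f))) := by
  simp [treeB, coefMono_op, coefMono_op_op]

theorem coefMono_treeD : (coefMono (treeD u a b c d e f) : Mono α → F) =
    pair u.swap (pair u (coefMono (var a)) (coefMono (var b))) (pair u (coefMono (var c))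
      (pair u.swap (coefMono (var d)) (pair u (coefMono (var e)) (coefMono (var f))))) := by
  simp [treeD, coefMono_op]

theorem coef_treeR_swap_right :
    coef (treeR u a b c d f e) p = -coef (treeR u a b c d e f) p := by
  simp [coef_eq_extend, coefMono_treeR, pair_swap u (coefMono (var e)) (coefMono (var f))]

theorem coef_treeQ_swap_right :
    coef (treeQ u a b c e d f) p = -coef (treeQ u a b c d e f) p := by
  simp [coef_eq_extend, coefMono_treeQ, pair_swap u.swap (coefMono (var d)) (coefMono (var e))]

theorem coef_treeN_swap_left :
    coef (treeN u b a c d e f) p = -coef (treeN u a b c d e f) p := by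
  simp [coef_eq_extend, coefMono_treeN, pair_swap u.swap (coefMono (var a)) (coefMono (var b))]

theorem coef_treeS_reverse_left :
    coef (treeS u c b a d e f) p = coef (treeS u a b c d e f) p := by
  simp only [coef_eq_extend, coefMono_treeS, triple_reverse u (coefMono (var a))]

theorem coef_treeU_swap_right :
    coef (treeU u a b c d f e) p = -coef (treeU u a b c d e f) p := by
  simp [coef_eq_extend, coefMono_treeU, pair_swap u (coefMono (var e)) (coefMono (var f))]

theorem coef_treeY_swap_left :
    coef (treeY u b a c d e f) p = -coef (treeY u a b c d e f) p := by
  simp [coef_eq_extend, coefMono_treeY, pair_swap u.swap (coefMono (var a)) (coefMono (var b))]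

theorem coef_treeY_reverse_right :
    coef (treeY u a b c f e d) p = coef (treeY u a b c d e f) p := by
  simp only [coef_eq_extend, coefMono_treeY, triple_reverse u (coefMono (var d))]

theorem coef_treeY_shuffle :
    coef (treeY u a b c d e f) p + coef (treeY u a b c e d f) p + coef (treeY u a b c e f d) p =
      0 := by
  simp only [coef_eq_extend, coefMono_treeY, ← LinearMap.add_apply, ← map_add, ← pair_add_right,
    triple_shuffle, pair_zero_right, map_zero, LinearMap.zero_apply]

theorem coef_treeW_swap_left :
    coef (treeW u b a c d e f) p = -coef (treeW u a b c d e f) p := by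
  simp [coef_eq_extend, coefMono_treeW, pair_swap u (coefMono (var a)) (coefMono (var b))]

theorem coef_treeW_swap_mid :
    coef (treeW u a b d c e f) p = -coef (treeW u a b c d e f) p := by
  simp [coef_eq_extend, coefMono_treeW, pair_swap u (coefMono (var c)) (coefMono (var d))]

theorem coef_treeW_swap_right :
    coef (treeW u a b c d f e) p = -coef (treeW u a b c d e f) p := by
  simp [coef_eq_extend, coefMono_treeW, pair_swap u.swap (coefMono (var e)) (coefMono (var f))]

theorem coef_treeW_swap_factors :
    coef (treeW u c d a b e f) p = -coef (treeW u a b c d e f) p := by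
  simp [coef_eq_extend, coefMono_treeW,
    pair_swap u.swap (pair u (coefMono (var a)) (coefMono (var b)))]

theorem coef_treeD_swap_left :
    coef (treeD u b a c d e f) p = -coef (treeD u a b c d e f) p := by
  simp [coef_eq_extend, coefMono_treeD, pair_swap u (coefMono (var a)) (coefMono (var b))]

theorem coef_treeD_swap_right :
    coef (treeD u a b c d f e) p = -coef (treeD u a b c d e f) p := by
  simp [coef_eq_extend, coefMono_treeD, pair_swap u (coefMono (var e)) (coefMono (var f))]

theorem coef_treeB_swap_left :
    coef (treeB u a c b d e f) p = -coef (treeB u a b c d e f) p := by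
  simp [coef_eq_extend, coefMono_treeB, pair_swap u.swap (coefMono (var b)) (coefMono (var c))]

theorem coef_treeB_reverse_right :
    coef (treeB u a b c f e d) p = coef (treeB u a b c d e f) p := by
  simp only [coef_eq_extend, coefMono_treeB, triple_reverse u (coefMono (var d))]

theorem coef_treeB_shuffle :
    coef (treeB u a b c d e f) p + coef (treeB u a b c e d f) p + coef (treeB u a b c e f d) p =
      0 := by
  simp only [coef_eq_extend, coefMono_treeB, ← LinearMap.add_apply, ← map_add, ← pair_add_right,
    triple_shuffle, pair_zero_right, map_zero, LinearMap.zero_apply]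

end TreeSymmetries

/-! ### Relations between the coefficients of identities -/

theorem eq_zero_of_eq_neg [NeZero (2 : F)] {x : F} (h : x = -x) : x = 0 := by
  have : 2 * x = 0 := by linear_combination h
  exact (mul_eq_zero.mp this).resolve_left (NeZero.ne 2)

theorem eq_zero_of_swap_neg_of_swap_pos [NeZero (2 : F)] {ι : Type*} {f : ι → ι → ι → F}
    (hneg : ∀ x y z, f y x z = -f x y z) (hpos : ∀ x y z, f z y x = f x y z) (x y z : ι) :
    f x y z = 0 :=
  eq_zero_of_eq_neg <| calc
    f x y z = f z y x := (hpos x y z).symm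
    _ = -f y z x := hneg y z x
    _ = -f x z y := by rw [hpos x z y]
    _ = f z x y := by rw [hneg x z y]
    _ = f y x z := (hpos z x y).symm
    _ = -f x y z := hneg x y z

theorem coef_op_swap {w : Op} {s t : Mono α} (hs : s.rooted w = false) (ht : t.rooted w = false)
    (p : FreeAlg F α) : coef (op w t s) p = -coef (op w s t) p := by
  rw [coef_eq_extend, coef_eq_extend, coefMono_op ht hs, coefMono_op hs ht,
    pair_swap w (coefMono s), map_neg, LinearMap.neg_apply]

section Relations

variable [NeZero (2 : F)] (u : Op) {p : FreeAlg F (Fin 6)} (hp : p ∈ allIds F 6)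
  (a b c d e f : Fin 6)
include hp

theorem coef_treeR_cycle : coef (treeR u a e d f b c) p = coef (treeR u a b c d e f) p := by
  have h := sum_coef_rename_eq_zero_of_isParityClass (K := [treeR u 0 1 2 3 4 5,
    op u (var 0) (op u.swap (op u (var 1) (var 2)) (op u (var 4) (op u.swap (var 3) (var 5))))])
    (by cases u <;> decide +kernel) hp ![a, b, c, d, e, f]
  have hswap : coef (op u (var a) (op u.swap (op u (var b) (var c))
      (op u (var e) (op u.swap (var d) (var f))))) p = -coef (treeR u a e d f b c) p := by
    simp [coef_eq_extend, treeR, coefMono_op, pair_swap u.swap _ (pair u (coefMono (var b)) _)]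
  simp only [treeR, Mono.rename, List.map_cons, List.map_nil, List.sum_cons, List.sum_nil,
    Matrix.cons_val] at h hswap ⊢
  linear_combination hswap - h

theorem coef_treeR_eq_zero : coef (treeR u a b c d e f) p = 0 :=
  eq_zero_of_swap_neg_of_swap_pos (f := fun x y z => coef (treeR u a z c d x y) p)
    (fun x y z => coef_treeR_swap_right u p a z c d x y)
    (fun x y z => by
      rw [← coef_treeR_cycle u hp a x c d z y, ← coef_treeR_cycle u hp a z d y x c,
        ← coef_treeR_cycle u hp a x y c z d])
    e f b

theorem coef_treeQ_add_treeQ' :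
    coef (treeQ u a b d c e f) p + coef (treeQ' u a b c d e f) p = 0 := by
  have h := sum_coef_rename_eq_zero_of_isParityClass
    (K := [treeQ u 0 1 3 2 4 5, treeQ' u 0 1 2 3 4 5]) (by cases u <;> decide +kernel) hp
    ![a, b, c, d, e, f]
  simpa [treeQ, treeQ', Mono.rename] using h

theorem coef_treeQ_add_treeQ'_comm :
    coef (treeQ u c d e a b f) p + coef (treeQ' u a b c d e f) p = 0 := by
  have h := sum_coef_rename_eq_zero_of_isParityClass
    (K := [op u (op u.swap (var 2) (op u (var 3) (var 4)))
      (op u (var 5) (op u.swap (var 0) (var 1)))])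
    (by cases u <;> decide +kernel) hp ![a, b, c, d, e, f]
  simpa [coef_eq_extend, Mono.rename, coefMono_treeQ, coefMono_treeQ', coefMono_op,
    coefMono_op_op, ← LinearMap.add_apply, ← map_add, triple_add_of_mid] using h

theorem coef_treeQ_cycle : coef (treeQ u d c e a b f) p = coef (treeQ u a b c d e f) p := by
  linear_combination coef_treeQ_add_treeQ'_comm u hp a b d c e f -
    coef_treeQ_add_treeQ' u hp a b d c e f

theorem coef_treeQ_eq_zero : coef (treeQ u a b c d e f) p = 0 :=
  eq_zero_of_swap_neg_of_swap_pos (f := fun x y z => coef (treeQ u z b c x y f) p)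
    (fun x y z => coef_treeQ_swap_right u p z b c x y f)
    (fun x y z => by
      rw [← coef_treeQ_cycle u hp x b c z y f, ← coef_treeQ_cycle u hp z c y x b f,
        ← coef_treeQ_cycle u hp x y b z c f])
    d e a

theorem coef_treeQ'_eq_zero : coef (treeQ' u a b c d e f) p = 0 := by
  simpa [coef_treeQ_eq_zero u hp] using coef_treeQ_add_treeQ' u hp a b c d e f

theorem coef_treeN_add_treeS :
    coef (treeN u a b c d e f) p + coef (treeS u a c e b d f) p = 0 := by
  have h := sum_coef_rename_eq_zero_of_isParityClass
    (K := [treeN u 0 1 2 3 4 5, treeS u 0 2 4 1 3 5]) (by cases u <;> decide +kernel) hp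
    ![a, b, c, d, e, f]
  simpa [treeN, treeS, Mono.rename] using h

theorem coef_treeS_eq_zero : coef (treeS u a b c d e f) p = 0 :=
  eq_zero_of_swap_neg_of_swap_pos (f := fun x y z => coef (treeS u x b z y e f) p)
    (fun x y z => by
      linear_combination coef_treeN_add_treeS u hp y x b e z f +
        coef_treeN_add_treeS u hp x y b e z f - coef_treeN_swap_left u p x y b e z f)
    (fun x y z => coef_treeS_reverse_left u p x b z y e f)
    a d c

theorem coef_treeN_eq_zero : coef (treeN u a b c d e f) p = 0 := by
  simpa [coef_treeS_eq_zero u hp] using coef_treeN_add_treeS u hp a b c d e f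

theorem coef_treeU_add_treeY : coef (treeU u a b d c e f) p + coef (treeY u a b c d e f) p =
    coef (treeY u c f a b d e) p := by
  have h := sum_coef_rename_eq_zero_of_isParityClass
    (K := [treeU u 0 1 3 2 4 5, treeY u 0 1 2 3 4 5, op u
      (op u.swap (var 0) (op u (var 1) (op u (var 3) (var 4)))) (op u.swap (var 2) (var 5))])
    (by cases u <;> decide +kernel) hp ![a, b, c, d, e, f]
  have hswap := coef_op_swap (w := u) (s := op u.swap (var c) (var f))
    (t := op u.swap (var a) (op u (var b) (op u (var d) (var e)))) (by simp) (by simp) p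
  simp only [treeU, treeY, Mono.rename, List.map_cons, List.map_nil, List.sum_cons,
    List.sum_nil, Matrix.cons_val] at h ⊢
  linear_combination h - hswap

theorem coef_treeY_cyclic :
    coef (treeY u a b c e d f) p + coef (treeY u c f a b d e) p + coef (treeY u c e a b d f) p =
      0 := by
  linear_combination coef_treeY_shuffle u p a b c d e f - coef_treeU_add_treeY u hp a b c d e f -
    coef_treeU_add_treeY u hp a b c d f e + coef_treeU_swap_right u p a b d c e f -
    coef_treeY_reverse_right u p a b c d f e

theorem coef_treeY_eq_zero : coef (treeY u a b c d e f) p = 0 :=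
  eq_zero_of_swap_neg_of_swap_pos (f := fun x y z => coef (treeY u x y z d e f) p)
    (fun x y z => coef_treeY_swap_left u p x y z d e f)
    (fun x y z => by
      linear_combination coef_treeY_cyclic u hp x d z e f y -
        coef_treeY_cyclic u hp z f x e d y + coef_treeY_reverse_right u p x y z d e f)
    a b c

theorem coef_treeU_eq_zero : coef (treeU u a b c d e f) p = 0 := by
  simpa [coef_treeY_eq_zero u hp] using coef_treeU_add_treeY u hp a b d c e f

theorem coef_treeW_cycle : coef (treeW u b e d f a c) p = coef (treeW u a b c d e f) p := by
  have h := sum_coef_rename_eq_zero_of_isParityClass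
    (K := [treeW u 0 1 2 3 4 5,
      op u (op u.swap (op u (var 0) (var 1)) (var 2)) (op u.swap (var 4) (op u (var 3) (var 5))),
      op u (op u.swap (var 0) (op u (var 2) (var 3))) (op u.swap (op u (var 1) (var 4)) (var 5)),
      op u (op u.swap (var 0) (var 2)) (op u.swap (op u (var 1) (var 4)) (op u (var 3) (var 5)))])
    (by cases u <;> decide +kernel) hp ![a, b, c, d, e, f]
  have hU₁ : coef (op u (op u.swap (op u (var a) (var b)) (var c))
      (op u.swap (var e) (op u (var d) (var f)))) p = -coef (treeU u c a b e d f) p := by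
    simp [coef_eq_extend, treeU, coefMono_op, pair_swap u.swap (coefMono (var c))]
  have hU₂ : coef (op u (op u.swap (var a) (op u (var c) (var d)))
      (op u.swap (op u (var b) (var e)) (var f))) p = -coef (treeU u a c d f b e) p := by
    simp [coef_eq_extend, treeU, coefMono_op, pair_swap u.swap (coefMono (var f))]
  have hW : coef (op u (op u.swap (var a) (var c))
      (op u.swap (op u (var b) (var e)) (op u (var d) (var f)))) p =
      -coef (treeW u b e d f a c) p :=
    coef_op_swap (by simp) (by simp) p
  rw [coef_treeU_eq_zero u hp] at hU₁ hU₂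
  simp only [treeW, Mono.rename, List.map_cons, List.map_nil, List.sum_cons, List.sum_nil,
    Matrix.cons_val] at h hW ⊢
  linear_combination hW + hU₁ + hU₂ - h

theorem coef_treeW_eq_zero : coef (treeW u a b c d e f) p = 0 := by
  have swap_one_three (a b c d e f) :
      coef (treeW u c b a d e f) p = -coef (treeW u a b c d e f) p := by
    rw [← coef_treeW_cycle u hp a, ← coef_treeW_cycle u hp c, coef_treeW_swap_right]
  have swap_two_five (a b c d e f) :
      coef (treeW u a e c d b f) p = -coef (treeW u a b c d e f) p := by
    rw [← coef_treeW_cycle u hp a b, ← coef_treeW_cycle u hp a e, coef_treeW_swap_left]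
  have swap_four_six (a b c d e f) :
      coef (treeW u a b c f e d) p = -coef (treeW u a b c d e f) p := by
    rw [← coef_treeW_cycle u hp a b c d, ← coef_treeW_cycle u hp a b c f, coef_treeW_swap_mid]
  refine eq_zero_of_eq_neg ?_
  calc coef (treeW u a b c d e f) p
    _ = -coef (treeW u c d a b e f) p := coef_treeW_swap_factors u p c d a b e f
    _ = coef (treeW u a d c b e f) p := by rw [swap_one_three, neg_neg]
    _ = -coef (treeW u a e c b d f) p := swap_two_five a e c b d f
    _ = coef (treeW u a e c b f d) p := by rw [coef_treeW_swap_right, neg_neg]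
    _ = -coef (treeW u a e c d f b) p := swap_four_six a e c d f b
    _ = coef (treeW u a e c d b f) p := by rw [coef_treeW_swap_right, neg_neg]
    _ = -coef (treeW u a b c d e f) p := swap_two_five a b c d e f

theorem coef_treeA_swap_mid :
    coef (treeA u a b d c e f) p = -coef (treeA u a b c d e f) p := by
  have h := sum_coef_rename_eq_zero_of_isParityClass
    (K := [op u.swap (op u (var 0) (var 1))
      (op u (var 2) (op u (op u.swap (var 4) (var 5)) (var 3)))])
    (by cases u <;> decide +kernel) hp ![a, b, c, d, e, f]
  have hsum := triple_add_of_mid (F := F) u (coefMono (var c))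
    (pair u.swap (coefMono (var e)) (coefMono (var f))) (coefMono (var d))
  rw [eq_neg_iff_add_eq_zero]
  simpa [coef_eq_extend, Mono.rename, coefMono_treeA, coefMono_op, coefMono_op_op,
    ← LinearMap.add_apply, ← map_add, ← pair_add_right, add_comm, hsum] using h

theorem coef_treeD_add_treeA_add_treeB : coef (treeD u a b c d e f) p +
    coef (treeA u a b c e d f) p + coef (treeB u a b d c e f) p = 0 := by
  have h := sum_coef_rename_eq_zero_of_isParityClass
    (K := [treeD u 0 1 2 3 4 5, treeA u 0 1 2 4 3 5, treeB u 0 1 3 2 4 5])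
    (by cases u <;> decide +kernel) hp ![a, b, c, d, e, f]
  simpa [treeD, treeA, treeB, Mono.rename, add_assoc] using h

theorem coef_treeD_comm : coef (treeD u c d a b e f) p = -coef (treeD u a b c d e f) p := by
  have h := sum_coef_rename_eq_zero_of_isParityClass
    (K := [op u.swap (op u (var 0) (var 1)) (op u (var 2) (op u.swap (op u (var 4) (var 5))
        (var 3))),
      op u.swap (op u (var 0) (op u.swap (var 1) (op u (var 4) (var 5)))) (op u (var 2) (var 3))])
    (by cases u <;> decide +kernel) hp ![a, b, c, d, e, f]
  have hinner : coef (op u.swap (op u (var a) (var b))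
      (op u (var c) (op u.swap (op u (var e) (var f)) (var d)))) p =
      -coef (treeD u a b c d e f) p := by
    simp [coef_eq_extend, treeD, coefMono_op, pair_swap u.swap (coefMono (var d))]
  have houter : coef (op u.swap (op u (var a) (op u.swap (var b) (op u (var e) (var f))))
      (op u (var c) (var d))) p = -coef (treeD u c d a b e f) p :=
    coef_op_swap (by simp) (by simp) p
  simp only [Mono.rename, List.map_cons, List.map_nil, List.sum_cons, List.sum_nil,
    Matrix.cons_val] at h
  linear_combination hinner + houter - h

theorem coef_treeD_swap_mid :
    coef (treeD u a b d c e f) p = -coef (treeD u a b c d e f) p := by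
  rw [coef_treeD_comm u hp d c, coef_treeD_swap_left, coef_treeD_comm u hp a b, neg_neg]

theorem coef_treeB_eq_add : coef (treeB u a b c d e f) p =
    coef (treeD u a b d c f e) p + coef (treeD u a b f c d e) p := by
  linear_combination -coef_treeD_add_treeA_add_treeB u hp a b d c f e -
    coef_treeD_add_treeA_add_treeB u hp a b f c d e + coef_treeA_swap_mid u hp a b d f c e +
    coef_treeB_shuffle u p a b c d f e - coef_treeB_reverse_right u p a b c d e f

theorem coef_treeB_swap_first :
    coef (treeB u b a c d e f) p = -coef (treeB u a b c d e f) p := by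
  linear_combination coef_treeB_eq_add u hp b a c d e f + coef_treeB_eq_add u hp a b c d e f +
    coef_treeD_swap_left u p a b d c f e + coef_treeD_swap_left u p a b f c d e

theorem coef_treeB_swap_mid :
    coef (treeB u a b e d c f) p = -coef (treeB u a b c d e f) p := by
  -- Rewrite the antisymmetry of `treeB` in `b` and `c` in terms of `treeD`; in a suitable sum of
  -- four instances everything but twice the claim cancels.
  have exchange (a b c d e f) : coef (treeD u a b d c f e) p + coef (treeD u a b f c d e) p +
      (coef (treeD u a c d b f e) p + coef (treeD u a c f b d e) p) = 0 := by
    rw [← coef_treeB_eq_add u hp, ← coef_treeB_eq_add u hp, coef_treeB_swap_left, neg_add_cancel]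
  have flip (a b c d e f) : coef (treeD u b a d c f e) p = -coef (treeD u a b c d e f) p := by
    rw [coef_treeD_swap_left, coef_treeD_swap_mid u hp, coef_treeD_swap_right, neg_neg]
  have flip_comm (a b c d e f) : coef (treeD u d c b a f e) p = coef (treeD u a b c d e f) p := by
    rw [flip, coef_treeD_comm u hp, neg_neg]
  refine mul_left_cancel₀ (NeZero.ne (2 : F)) ?_
  linear_combination 2 * coef_treeB_eq_add u hp a b e d c f +
    2 * coef_treeB_eq_add u hp a b c d e f +
    exchange a b c d e f + exchange a b e d c f - exchange b a d c f e - exchange b a f c d e +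
    flip a b d c f e + flip a b d e f c + flip a b f c d e + flip a b f e d c +
    flip_comm a c d b f e + flip_comm a e d b f c + flip_comm a c f b d e + flip_comm a e f b d c

theorem coef_treeD_eq_zero_of_treeB
    (hB : ∀ a b c d e f : Fin 6, coef (treeB u a b c d e f) p = 0) :
    coef (treeD u a b c d e f) p = 0 := by
  have swap_three_five (a b c d e f) :
      coef (treeD u a b e d c f) p = -coef (treeD u a b c d e f) p := by
    linear_combination hB a b d c f e - coef_treeB_eq_add u hp a b d c f e
  have comm_right (a b c d e f) : coef (treeD u a b e f c d) p = coef (treeD u a b c d e f) p := by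
    rw [swap_three_five, coef_treeD_swap_mid u hp, coef_treeD_swap_right, swap_three_five,
      coef_treeD_swap_mid u hp, coef_treeD_swap_right]
    simp
  exact eq_zero_of_swap_neg_of_swap_pos
    (f := fun x y z : Fin 6 × Fin 6 => coef (treeD u y.1 y.2 x.1 x.2 z.1 z.2) p)
    (fun x y z => coef_treeD_comm u hp y.1 y.2 x.1 x.2 z.1 z.2)
    (fun x y z => comm_right y.1 y.2 x.1 x.2 z.1 z.2) (c, d) (a, b) (e, f)

theorem coef_treeA_eq_zero_of_treeB
    (hB : ∀ a b c d e f : Fin 6, coef (treeB u a b c d e f) p = 0) :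
    coef (treeA u a b c d e f) p = 0 := by
  simpa [hB, coef_treeD_eq_zero_of_treeB u hp _ _ _ _ _ _ hB] using
    coef_treeD_add_treeA_add_treeB u hp a b c e d f

omit u a b c d e f in
theorem expand_eq_zero_of_treeB
    (hB : ∀ u, ∀ a b c d e f : Fin 6, coef (treeB u a b c d e f) p = 0) : expand p = 0 := by
  refine expand_eq_zero_of_representatives hp fun u r hr g => ?_
  simp only [representatives, List.map_cons, List.map_nil, List.mem_cons, List.not_mem_nil,
    or_false] at hr
  rcases hr with rfl | rfl | rfl | rfl | rfl | rfl | rfl | rfl | rfl | rfl | rfl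
  · exact coef_treeR_eq_zero u hp ..
  · exact coef_treeQ_eq_zero u hp ..
  · exact coef_treeQ'_eq_zero u hp ..
  · exact coef_treeN_eq_zero u hp ..
  · exact coef_treeS_eq_zero u hp ..
  · exact coef_treeU_eq_zero u hp ..
  · exact coef_treeW_eq_zero u hp ..
  · exact coef_treeY_eq_zero u hp ..
  · exact coef_treeA_eq_zero_of_treeB u hp _ _ _ _ _ _ (hB u)
  · exact hB u ..
  · exact coef_treeD_eq_zero_of_treeB u hp _ _ _ _ _ _ (hB u)

end Relations

/-! ### Identities of lower degree -/

theorem mono_mem_multilinear {n : ℕ} {t : Mono (Fin n)}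
    (h : t.vars = (Finset.univ : Finset (Fin n)).val) : monoBasis F (Fin n) t ∈ multilinear F n :=
  Submodule.subset_span ⟨t, h, rfl⟩

/-- The product of a polynomial with a new indeterminate. It turns identities of degree `n` into
identities of degree `n + 1`. -/
def mulLast (u : Op) {n : ℕ} (f : FreeAlg F (Fin n)) : FreeAlg F (Fin (n + 1)) :=
  freeMul u (rename Fin.castSucc f) (X (Fin.last n))

theorem mulLast_mem_multilinear (u : Op) {n : ℕ} {f : FreeAlg F (Fin n)}
    (hf : f ∈ multilinear F n) : mulLast u f ∈ multilinear F (n + 1) := by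
  have hle : multilinear F n ≤ (multilinear F (n + 1)).comap
      ((freeMul u).flip (X (Fin.last n)) ∘ₗ rename Fin.castSucc) := by
    rw [multilinear, Submodule.span_le]
    rintro _ ⟨t, ht, rfl⟩
    simp only [SetLike.mem_coe, Submodule.mem_comap, LinearMap.comp_apply, rename_mono, X,
      LinearMap.flip_apply, freeMul_mono]
    refine mono_mem_multilinear ?_
    rw [Set.mem_ofPred_eq] at ht
    rw [Mono.vars, vars_rename, ht, Mono.vars, Fin.univ_castSuccEmb, Finset.cons_val,
      Finset.map_val, ← Multiset.singleton_add]
    exact add_comm _ _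
  exact hle hf

theorem mulLast_mem_allIds (u : Op) {n : ℕ} {f : FreeAlg F (Fin n)} (hf : f ∈ allIds F n) :
    mulLast u f ∈ allIds F (n + 1) := by
  rw [mem_allIds_iff] at hf ⊢
  refine ⟨mulLast_mem_multilinear u hf.1, isBracketId_of_eval_eq_zero ?_⟩
  rw [mulLast, eval_freeMul, eval_rename, hf.2.eval_eq_zero (isAI_mulAI _), map_zero,
    LinearMap.zero_apply]

theorem coef_X_of_ne {T : Mono α} {x : α} (h : T.vars ≠ {x}) : coef T (X x : FreeAlg F α) = 0 :=
  coef_mono_eq_zero_of_vars_ne h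

theorem coef_X_self (x : α) : coef (var x) (X x : FreeAlg F α) = 1 := by
  rw [coef_apply, X, expand_var]
  simp

theorem expand_eq_zero_of_mulLast {n : ℕ} {f : FreeAlg F (Fin n)}
    (h : ∀ u, expand (mulLast u f) = 0) : expand f = 0 := by
  rw [expand_eq_zero_iff]
  intro T
  obtain ⟨u, hu⟩ : ∃ u, T.rooted u = false := by
    cases T with
    | var x => exact ⟨.circ, rfl⟩
    | op w s t => exact ⟨w.swap, by simp⟩
  have hrooted : (T.rename Fin.castSucc).rooted u = false := by cases T <;> exact hu
  have hvars : (T.rename Fin.castSucc).vars ≠ {Fin.last n} := by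
    rw [vars_rename]
    intro h
    have hlast : Fin.last n ∈ T.vars.map Fin.castSucc := by simp [h]
    obtain ⟨i, -, hi⟩ := Multiset.mem_map.mp hlast
    exact Fin.castSucc_ne_last i hi
  have hcoef := (expand_eq_zero_iff _).mp (h u) (op u (T.rename Fin.castSucc) (var (Fin.last n)))
  rwa [mulLast, coef_op_freeMul hrooted rfl, coef_X_self, coef_X_of_ne hvars, zero_mul, sub_zero,
    mul_one, coef_rename (Fin.castSucc_injective n)] at hcoef

theorem op_vars_ne_singleton (w : Op) (s t : Mono α) (x : α) : (op w s t).vars ≠ {x} := by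
  intro h
  have hcard := congrArg Multiset.card h
  have hs := s.size_pos
  have ht := t.size_pos
  rw [card_vars, Multiset.card_singleton, size] at hcard
  omega

theorem coef_treeB_mulLast {n : ℕ} (u w : Op) (f : FreeAlg F (Fin n)) (a b c d e g : Fin (n + 1)) :
    coef (treeB w a b c d e g) (mulLast u f) = 0 := by
  by_cases h : w.swap = u
  · subst h
    rw [treeB, mulLast, coef_op_freeMul (by simp) (by simp),
      coef_X_of_ne (op_vars_ne_singleton _ _ _ _), coef_X_of_ne (op_vars_ne_singleton _ _ _ _),
      mul_zero, zero_mul, sub_zero]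
  · exact coef_freeMul_of_not_rooted (by simp [treeB, h]) _ _

theorem expand_eq_zero_of_mem_allIds_of_le_five [NeZero (2 : F)] {k : ℕ} (hk : k ≤ 5)
    {f : FreeAlg F (Fin k)} (hf : f ∈ allIds F k) : expand f = 0 := by
  induction hk using Nat.decreasingInduction with
  | self =>
    exact expand_eq_zero_of_mulLast fun u => expand_eq_zero_of_treeB (mulLast_mem_allIds u hf)
      fun w a b c d e g => coef_treeB_mulLast u w f a b c d e g
  | of_succ k _ ih => exact expand_eq_zero_of_mulLast fun u => ih (mulLast_mem_allIds u hf)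

theorem mem_allIds_of_expand_eq_zero {n : ℕ} {f : FreeAlg F (Fin n)} (hf : f ∈ multilinear F n)
    (h : expand f = 0) : f ∈ allIds F n :=
  (mem_allIds_iff f).mpr ⟨hf, by rw [IsBracketId, h]; exact Submodule.zero_mem _⟩

theorem anticomm_mem_lowerIds {n : ℕ} (hn : 2 < n) (w : Op) : anticomm F w ∈ lowerIds F n := by
  have hmono {a b : Fin 2} (h : ({a} + {b} : Multiset (Fin 2)) = Finset.univ.val) :
      (freeMul w (X a) (X b) : FreeAlg F (Fin 2)) ∈ multilinear F 2 := by
    simp only [X, freeMul_mono]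
    exact mono_mem_multilinear h
  refine ⟨2, hn, freeMul w (X 0) (X 1) + freeMul w (X 1) (X 0),
    mem_allIds_of_expand_eq_zero (add_mem (hmono (by decide)) (hmono (by decide))) ?_, ?_⟩
  · simpa only [expand, map_add, eval_freeMul] using
      (isLie_brackets_of_assoc assocMul_assoc).anticomm w _ _
  · simp only [map_add, rename_freeMul, X, rename_mono, Mono.rename, anticomm]
    rfl

theorem jacobi_mem_lowerIds {n : ℕ} (hn : 3 < n) (w : Op) : jacobi F w ∈ lowerIds F n := by
  have hmono {a b c : Fin 3} (h : ({a} + ({b} + {c}) : Multiset (Fin 3)) = Finset.univ.val) :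
      (freeMul w (X a) (freeMul w (X b) (X c)) : FreeAlg F (Fin 3)) ∈ multilinear F 3 := by
    simp only [X, freeMul_mono]
    exact mono_mem_multilinear h
  refine ⟨3, hn, freeMul w (X 0) (freeMul w (X 1) (X 2)) + freeMul w (X 1) (freeMul w (X 2) (X 0)) +
    freeMul w (X 2) (freeMul w (X 0) (X 1)),
    mem_allIds_of_expand_eq_zero (add_mem (add_mem (hmono (by decide)) (hmono (by decide)))
      (hmono (by decide))) ?_, ?_⟩
  · simpa only [expand, map_add, eval_freeMul] using
      (isLie_brackets_of_assoc assocMul_assoc).jacobi w _ _ _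
  · simp only [map_add, rename_freeMul, X, rename_mono, Mono.rename, jacobi]
    rfl

theorem lieIds_subset_lowerIds {n : ℕ} (hn : 3 < n) : lieIds F ⊆ lowerIds F n := by
  intro g hg
  simp only [lieIds, Set.mem_insert_iff, Set.mem_singleton_iff] at hg
  rcases hg with rfl | rfl | rfl | rfl
  · exact anticomm_mem_lowerIds (by omega) _
  · exact anticomm_mem_lowerIds (by omega) _
  · exact jacobi_mem_lowerIds hn _
  · exact jacobi_mem_lowerIds hn _

theorem mem_oldIds_iff [CharZero F] (f : FreeAlg F (Fin 6)) :
    f ∈ oldIds F 6 ↔ f ∈ multilinear F 6 ∧ expand f = 0 := by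
  have h : consequences (lowerIds F 6) (Fin 6) = consequences (lieIds F) (Fin 6) := by
    refine le_antisymm (consequences_le ?_) (consequences_le fun g hg => ?_)
    · rintro _ ⟨k, hk, f, hf, rfl⟩
      rw [mem_consequences_lieIds_iff, expand_rename,
        expand_eq_zero_of_mem_allIds_of_le_five (by omega) hf, map_zero]
    · rw [← subst_X g]
      exact subst_mem_consequences (lieIds_subset_lowerIds (by norm_num) hg) _
  rw [oldIds, Submodule.mem_inf, ← mem_consequences_lieIds_iff, h]

/-! ### Polynomials with integer coefficients as lists -/

/-- The polynomial with the given list of coefficients and monomials. -/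
def toPoly (L : List (ℤ × Mono α)) : FreeAlg F α :=
  (L.map fun p => (p.1 : F) • monoBasis F α p.2).sum

@[simp] theorem toPoly_nil : toPoly ([] : List (ℤ × Mono α)) = (0 : FreeAlg F α) := rfl

@[simp] theorem toPoly_cons (c : ℤ) (t : Mono α) (L : List (ℤ × Mono α)) :
    toPoly ((c, t) :: L) = (c : F) • monoBasis F α t + toPoly L := by simp [toPoly]

@[simp] theorem toPoly_append (L L' : List (ℤ × Mono α)) :
    toPoly (L ++ L') = (toPoly L + toPoly L' : FreeAlg F α) := by simp [toPoly]

/-- The multiples of a polynomial. -/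
def scaleList (c : ℤ) (L : List (ℤ × Mono α)) : List (ℤ × Mono α) :=
  L.map fun p => (c * p.1, p.2)

theorem toPoly_scaleList (c : ℤ) (L : List (ℤ × Mono α)) :
    toPoly (scaleList c L) = ((c : F) • toPoly L : FreeAlg F α) := by
  induction L with
  | nil => simp [scaleList]
  | cons p L ih =>
    rw [scaleList, List.map_cons, toPoly_cons, ← scaleList, ih, toPoly_cons, smul_add, smul_smul,
      Int.cast_mul]

/-- The associative product of polynomials. -/
def mulList (w : Op) (L L' : List (ℤ × Mono α)) : List (ℤ × Mono α) :=
  L.flatMap fun p => L'.map fun q => (p.1 * q.1, app w p.2 q.2)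

theorem toPoly_mulList (w : Op) (L L' : List (ℤ × Mono α)) :
    (toPoly (mulList w L L') : FreeAlg F α) = assocMul w (toPoly L) (toPoly L') := by
  induction L with
  | nil => simp [mulList]
  | cons p L ih =>
    have h : (toPoly (L'.map fun q => (p.1 * q.1, app w p.2 q.2)) : FreeAlg F α) =
        (p.1 : F) • assocMul w (monoBasis F α p.2) (toPoly L') := by
      clear ih
      induction L' with
      | nil => simp
      | cons q L' ih =>
        rw [List.map_cons, toPoly_cons, ih, toPoly_cons, map_add, map_smul, assocMul_mono, smul_add,
          smul_smul, Int.cast_mul]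
    rw [mulList, List.flatMap_cons, toPoly_append, h, ← mulList, ih, toPoly_cons, map_add,
      map_smul, LinearMap.add_apply, LinearMap.smul_apply]

/-- The expansion of a monomial in the brackets. -/
def expandMono : Mono α → List (ℤ × Mono α)
  | .var x => [(1, .var x)]
  | .op w s t => mulList w (expandMono s) (expandMono t) ++
      scaleList (-1) (mulList w (expandMono t) (expandMono s))

theorem expand_mono (t : Mono α) : expand (monoBasis F α t) = toPoly (expandMono t) := by
  induction t with
  | var x => simp [expand_var, expandMono]
  | op w s t hs ht =>
    rw [expand_op, expandMono, toPoly_append, toPoly_scaleList, toPoly_mulList, toPoly_mulList, hs,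
      ht]
    simp [sub_eq_add_neg]

/-- The expansion of a polynomial in the brackets. -/
def expandList (L : List (ℤ × Mono α)) : List (ℤ × Mono α) :=
  L.flatMap fun p => scaleList p.1 (expandMono p.2)

theorem expand_toPoly (L : List (ℤ × Mono α)) :
    expand (toPoly L : FreeAlg F α) = toPoly (expandList L) := by
  induction L with
  | nil => simp [expandList]
  | cons p L ih =>
    rw [toPoly_cons, map_add, map_smul, expand_mono, ih, expandList, expandList, List.flatMap_cons,
      toPoly_append, toPoly_scaleList]

/-! ### Equivalent monomials have equal values -/

section Values

variable {m : Ops F A}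

theorem evalMono_of_mem_splits (hm : IsAI m) (v : α → A) {w : Op} {t : Mono α}
    {p : Mono α × Mono α} (h : p ∈ splits w t) :
    evalMono m v t = m w (evalMono m v p.1) (evalMono m v p.2) := by
  induction t generalizing p with
  | var x => simp [splits] at h
  | op w' a b _ hb =>
    rw [splits] at h
    split at h
    next hw =>
      subst hw
      rcases List.mem_cons.mp h with rfl | h
      · rfl
      · obtain ⟨q, hq, rfl⟩ := List.mem_map.mp h
        rw [evalMono, hb hq, evalMono, hm.assoc]
    · simp at h

theorem evalMono_of_mem_nbrs (hm : IsAI m) (v : α → A) {n : ℕ} {s t : Mono α}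
    (h : s ∈ nbrs n t) : evalMono m v s = evalMono m v t := by
  induction n generalizing s t with
  | zero => simp [nbrs] at h
  | succ n ih =>
    cases t with
    | var x => simp [nbrs] at h
    | op w a b =>
      simp only [nbrs, List.mem_flatMap, List.mem_append, List.mem_map] at h
      obtain ⟨p, hp, ⟨r, hr, rfl⟩ | ⟨r, hr, rfl⟩ | ⟨x, hx, y, hy, rfl⟩⟩ := h <;>
        rw [evalMono_of_mem_splits hm v hp, hm.evalMono_app]
      · rw [ih hr]
      · rw [ih hr]
      · rw [hm.evalMono_app, hm.evalMono_app, evalMono_of_mem_splits hm v hx,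
          evalMono_of_mem_splits hm v hy, hm.interchange]

theorem evalMono_of_mem_close [DecidableEq α] (hm : IsAI m) (v : α → A) (x : A) (d n : ℕ)
    (L new : List (Mono α)) (hL : ∀ s ∈ L, evalMono m v s = x)
    (hnew : ∀ s ∈ new, evalMono m v s = x) : ∀ s ∈ close d n L new, evalMono m v s = x := by
  induction n generalizing L new with
  | zero => exact hL
  | succ n ih =>
    rw [close]
    split
    · exact hL
    next T new' hT =>
      have h : ∀ s ∈ T :: new', evalMono m v s = x := by
        intro s hs
        rw [← hT, List.mem_dedup, List.mem_filter, List.mem_flatMap] at hs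
        obtain ⟨⟨r, hr, hs⟩, -⟩ := hs
        rw [evalMono_of_mem_nbrs hm v hs, hnew r hr]
      refine ih _ _ (fun s hs => ?_) h
      rcases List.mem_append.mp hs with hs | hs
      exacts [hL s hs, h s hs]

end Values

/-! ### Alternating sums -/

/-- Application of `k` to `t`, in a form that makes the kernel evaluate all indeterminates and
operations of `t` first. Without it, terms grow in the computation of `collect`. -/
def force {β : Type} : Mono ℕ → (Mono ℕ → β) → β
  | .var n, k => match n with
    | 0 => k (.var 0)
    | 1 => k (.var 1)
    | 2 => k (.var 2)
    | 3 => k (.var 3)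
    | 4 => k (.var 4)
    | n => k (.var n)
  | .op .circ s t, k => force s fun s => force t fun t => k (.op .circ s t)
  | .op .bullet s t, k => force s fun s => force t fun t => k (.op .bullet s t)

theorem force_eq {β : Type} (t : Mono ℕ) (k : Mono ℕ → β) : force t k = k t := by
  induction t generalizing k with
  | var n => unfold force; split <;> rfl
  | op w s t hs ht => cases w <;> simp only [force, hs, ht]

/-- Pairs of monomials that have equal values in all associative interchange algebras, which is
proved by a search in `rules_mem_close`. The second one serves as the canonical form. -/
def rules : List (Mono ℕ × Mono ℕ) :=
  let c := op .circ
  let b := op .bullet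
  let x := var
  [(b (c (x 0) (x 1)) (c (x 2) (c (x 3) (b (x 4) (x 5)))),
    b (c (x 0) (x 1)) (c (x 2) (b (x 4) (c (x 3) (x 5))))),
   (b (c (x 0) (b (x 1) (x 2))) (c (x 3) (c (x 4) (x 5))),
    b (c (x 0) (x 1)) (c (x 3) (b (x 2) (c (x 4) (x 5))))),
   (b (c (x 0) (c (x 1) (b (x 2) (x 3)))) (c (x 4) (x 5)),
    b (c (x 0) (c (x 1) (x 2))) (c (x 4) (b (x 3) (x 5)))),
   (b (c (x 0) (b (c (x 1) (x 2)) (x 3))) (c (x 4) (x 5)),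
    b (c (x 0) (c (x 1) (x 2))) (c (x 4) (b (x 3) (x 5)))),
   (b (c (x 0) (x 1)) (c (b (x 2) (x 3)) (c (x 4) (x 5))),
    b (c (b (x 0) (x 2)) (x 1)) (c (x 3) (c (x 4) (x 5)))),
   (b (c (x 0) (x 1)) (c (b (x 2) (c (x 3) (x 4))) (x 5)),
    b (c (b (x 0) (x 2)) (x 1)) (c (x 3) (c (x 4) (x 5)))),
   (b (c (b (c (x 0) (x 1)) (x 2)) (x 3)) (c (x 4) (x 5)),
    b (c (b (x 0) (x 2)) (c (x 1) (x 3))) (c (x 4) (x 5))),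
   (b (c (x 0) (c (x 1) (x 2))) (c (b (x 3) (x 4)) (x 5)),
    b (c (b (x 0) (x 3)) (c (x 1) (x 2))) (c (x 4) (x 5))),
   (b (c (x 0) (b (x 1) (c (x 2) (x 3)))) (c (x 4) (x 5)),
    b (c (x 0) (x 1)) (c (x 4) (b (c (x 2) (x 3)) (x 5)))),
   (b (c (b (x 0) (c (x 1) (x 2))) (x 3)) (c (x 4) (x 5)),
    b (c (x 0) (x 3)) (c (b (c (x 1) (x 2)) (x 4)) (x 5)))]

/-- The canonical form of a monomial with the shape of a left hand side of `rules`. -/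
def reduce (t : Mono ℕ) : Mono ℕ :=
  match rules.find? fun r => beq (r.1.rename fun i => t.leaves.getD i 0) t with
  | some r => r.2.rename fun i => t.leaves.getD i 0
  | none => t

theorem rules_mem_close : ∀ r ∈ rules, r.2 ∈ close 6 5 [r.1] [r.1] := by decide +kernel

/-- Exchange of the indeterminate at the `k`-th place among those different from `0` with `y`. The
sign makes it harmless in alternating sums. -/
def sortStep (k y : ℕ) (p : ℤ × Mono ℕ) : ℤ × Mono ℕ :=
  let x := (p.2.leaves.filter fun i => !(i == 0)).getD k 0
  if x ≠ y ∧ 1 ≤ x ∧ x ≤ 4 then (-p.1, p.2.rename (Equiv.swap x y)) else p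

/-- The canonical form of a monomial in an alternating sum, in which the indeterminates different
from `0` are sorted. -/
def canonical (p : ℤ × Mono ℕ) : ℤ × Mono ℕ :=
  force p.2 fun t => force (reduce t) fun t => sortStep 2 3 (sortStep 1 2 (sortStep 0 1 (p.1, t)))

/-- The sum of a multiple of a monomial and a polynomial in which this monomial is collected. -/
def insertTerm (p : ℤ × Mono ℕ) : List (ℤ × Mono ℕ) → List (ℤ × Mono ℕ)
  | [] => [p]
  | q :: L => if beq q.2 p.2 then (q.1 + p.1, q.2) :: L else q :: insertTerm p L

/-- The sum of the canonical forms of the terms of a polynomial. -/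
def collect (L : List (ℤ × Mono ℕ)) : List (ℤ × Mono ℕ) :=
  L.foldr (fun p L => let q := canonical p; force q.2 fun t => insertTerm (q.1, t) L) []

theorem toPoly_insertTerm (p : ℤ × Mono ℕ) (L : List (ℤ × Mono ℕ)) :
    (toPoly (insertTerm p L) : FreeAlg F ℕ) = (p.1 : F) • monoBasis F _ p.2 + toPoly L := by
  induction L with
  | nil => exact toPoly_cons p.1 p.2 []
  | cons q L ih =>
    rw [insertTerm]
    split
    next h =>
      rw [beq_iff] at h
      rw [toPoly_cons, toPoly_cons, h, Int.cast_add, add_smul]; abel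
    · rw [toPoly_cons, ih, toPoly_cons]; abel

theorem toPoly_eq_zero {L : List (ℤ × Mono α)} (h : ∀ p ∈ L, p.1 = 0) :
    (toPoly L : FreeAlg F α) = 0 := by
  refine List.sum_eq_zero fun x hx => ?_
  obtain ⟨p, hp, rfl⟩ := List.mem_map.mp hx
  rw [h p hp, Int.cast_zero, zero_smul]

section Alternating

variable (m : Ops F A) (v : ℕ → A)

/-- The action of a permutation on the indeterminates `1, 2, 3, 4`. -/
def permute (s : Equiv.Perm (Fin 4)) (i : ℕ) : ℕ :=
  if h : i ≠ 0 ∧ i - 1 < 4 then s ⟨i - 1, h.2⟩ + 1 else i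

@[simp] theorem permute_zero (s : Equiv.Perm (Fin 4)) : permute s 0 = 0 := rfl

@[simp] theorem permute_succ (s : Equiv.Perm (Fin 4)) (i : Fin 4) :
    permute s (i + 1) = s i + 1 := by
  rw [permute, dif_pos ⟨Nat.succ_ne_zero _, by simp⟩]
  rfl

theorem permute_comp_swap (s : Equiv.Perm (Fin 4)) (i j : Fin 4) :
    permute s ∘ Equiv.swap ((i : ℕ) + 1) (j + 1) = permute (s * Equiv.swap i j) := by
  funext k
  rw [Function.comp_apply]
  by_cases hk : k ≠ 0 ∧ k - 1 < 4
  · obtain ⟨l, rfl⟩ : ∃ l : Fin 4, k = l + 1 := ⟨⟨k - 1, hk.2⟩, by simp only; omega⟩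
    rw [permute_succ, Equiv.swap_apply_def, Equiv.Perm.mul_apply, Equiv.swap_apply_def]
    simp only [Nat.add_right_cancel_iff, Fin.val_inj]
    split
    · rw [permute_succ]
    · split <;> rw [permute_succ]
  · have h1 : k ≠ i + 1 := fun h => hk (by omega)
    have h2 : k ≠ j + 1 := fun h => hk (by omega)
    rw [Equiv.swap_apply_of_ne_of_ne h1 h2, permute, permute, dif_neg hk, dif_neg hk]

/-- The alternating sum of the values of a polynomial over the permutations of the
indeterminates `1, 2, 3, 4`. -/
def alternate : FreeAlg F ℕ →ₗ[F] A :=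
  ∑ s : Equiv.Perm (Fin 4), ((Equiv.Perm.sign s : ℤ) : F) • eval m (v ∘ permute s)

theorem alternate_mono (t : Mono ℕ) : alternate m v (monoBasis F ℕ t) =
    ∑ s : Equiv.Perm (Fin 4), ((Equiv.Perm.sign s : ℤ) : F) • evalMono m (v ∘ permute s) t := by
  simp [alternate, eval_mono]

theorem alternate_rename_swap {i j : Fin 4} (hij : i ≠ j) (t : Mono ℕ) :
    alternate m v (monoBasis F _ (t.rename (Equiv.swap ((i : ℕ) + 1) (j + 1)))) =
      -alternate m v (monoBasis F _ t) := by
  simp only [alternate_mono, evalMono_rename]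
  rw [← Finset.sum_neg_distrib]
  refine Fintype.sum_equiv (Equiv.mulRight (Equiv.swap i j)) _ _ fun s => ?_
  rw [Function.comp_assoc, permute_comp_swap, Equiv.coe_mulRight, Equiv.Perm.sign_mul,
    Equiv.Perm.sign_swap hij]
  simp

theorem alternate_sortStep (k : ℕ) (y : Fin 4) (p : ℤ × Mono ℕ) :
    ((sortStep k (y + 1) p).1 : F) • alternate m v (monoBasis F _ (sortStep k (y + 1) p).2) =
      (p.1 : F) • alternate m v (monoBasis F _ p.2) := by
  have key (i : Fin 4) (hi : (i : ℕ) + 1 ≠ y + 1) : ((-p.1 : ℤ) : F) •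
      alternate m v (monoBasis F _ (p.2.rename (Equiv.swap ((i : ℕ) + 1) (y + 1)))) =
        (p.1 : F) • alternate m v (monoBasis F _ p.2) := by
    rw [alternate_rename_swap m v (fun h => hi (by rw [h]))]
    simp
  simp only [sortStep]
  split
  next h =>
    obtain ⟨i, hi⟩ : ∃ i : Fin 4, (p.2.leaves.filter fun i => !(i == 0)).getD k 0 = i + 1 :=
      ⟨⟨(p.2.leaves.filter fun i => !(i == 0)).getD k 0 - 1, by omega⟩, by simp only; omega⟩
    rw [hi] at h ⊢
    exact key i h.1
  · rfl

variable {m}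

theorem evalMono_reduce (hm : IsAI m) (t : Mono ℕ) :
    evalMono m v (reduce t) = evalMono m v t := by
  rw [reduce]
  split
  next r hr =>
    have h1 := List.find?_some hr
    have h2 := rules_mem_close r (List.mem_of_find?_eq_some hr)
    rw [beq_iff] at h1
    conv_rhs => rw [← h1]
    rw [evalMono_rename, evalMono_rename]
    exact evalMono_of_mem_close hm _ _ 6 5 [r.1] [r.1] (by simp) (by simp) _ h2
  · rfl

theorem alternate_canonical (hm : IsAI m) (p : ℤ × Mono ℕ) :
    ((canonical p).1 : F) • alternate m v (monoBasis F _ (canonical p).2) =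
      (p.1 : F) • alternate m v (monoBasis F _ p.2) := by
  rw [canonical, force_eq, force_eq]
  have h0 := alternate_sortStep m v 0 0
  have h1 := alternate_sortStep m v 1 1
  have h2 := alternate_sortStep m v 2 2
  refine (h2 _).trans ((h1 _).trans ((h0 _).trans ?_))
  simp only [alternate_mono, evalMono_reduce _ hm]

theorem alternate_collect (hm : IsAI m) (L : List (ℤ × Mono ℕ)) :
    alternate m v (toPoly (collect L) : FreeAlg F ℕ) = alternate m v (toPoly L) := by
  induction L with
  | nil => rfl
  | cons p L ih =>
    rw [collect, List.foldr_cons, ← collect]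
    simp only [force_eq]
    rw [toPoly_insertTerm, map_add, ih, map_smul, alternate_canonical v hm, toPoly_cons, map_add,
      map_smul]

end Alternating

/-! ### The new identity -/

/-- The terms of the new identity, with `a, b, c, d, e` the indeterminates `0, 1, 2, 3, 4`. -/
def newMonos (u w : Op) : List (ℤ × Mono ℕ) :=
  let a := var 0
  let b := var 1
  let c := var 2
  let d := var 3
  let e := var 4
  [(2, op w (op u a b) (op u a (op w c (op u d e)))),
   (-2, op w (op u a b) (op u c (op w a (op u d e)))),
   (2, op w (op u a b) (op u c (op w d (op u a e)))),
   (-1, op w (op u b c) (op u a (op w d (op u a e)))),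
   (1, op w (op u b c) (op u d (op w a (op u a e)))),
   (1, op w (op u a b) (op u (op u a c) (op w d e))),
   (2, op w (op u a b) (op u (op u c d) (op w a e))),
   (1, op w (op u b c) (op u (op u a d) (op w a e))),
   (1, op w (op u a (op u a b)) (op u c (op w d e))),
   (-1, op w (op u a (op u b c)) (op u d (op w a e))),
   (1, op w (op u b (op u a c)) (op u a (op w d e)))]

theorem collect_newMonos :
    ((collect (expandList (newMonos .circ .bullet))).all fun p => decide (p.1 = 0)) = true := by
  decide +kernel

theorem alternate_expand_newMonos {m : Ops F A} (hm : IsAI m) (v : ℕ → A) :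
    alternate m v (expand (toPoly (newMonos .circ .bullet) : FreeAlg F ℕ)) = 0 := by
  rw [expand_toPoly, ← alternate_collect v hm, toPoly_eq_zero, map_zero]
  simpa using collect_newMonos

theorem newLL6_eq (u w : Op) : newLL6 F u w = ∑ s : Equiv.Perm (Fin 4),
    ((Equiv.Perm.sign s : ℤ) : F) • rename (permute s) (toPoly (newMonos u w)) := by
  refine Finset.sum_congr rfl fun s _ => ?_
  have h0 := permute_succ s 0
  have h1 := permute_succ s 1
  have h2 := permute_succ s 2
  have h3 := permute_succ s 3
  simp only [Fin.val_zero, Fin.val_one, Fin.val_two, zero_add, show ((3 : Fin 4) : ℕ) = 3 from rfl]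
    at h0 h1 h2 h3
  simp only [newMonos, newTerm, toPoly_cons, toPoly_nil, map_add, map_smul, rename_mono,
    Mono.rename, permute_zero, h0, h1, h2, h3, X, freeMul_mono, add_zero]
  simp only [Int.cast_neg, Int.cast_ofNat, Int.cast_one, neg_smul, one_smul,
    Nat.reduceAdd] at h1 h2 h3 ⊢
  abel_nf

theorem eval_newLL6_circ {m : Ops F A} (hm : IsAI m) (v : ℕ → A) :
    eval (brackets m) v (newLL6 F .circ .bullet) = 0 := by
  rw [newLL6_eq, map_sum, ← alternate_expand_newMonos hm v, alternate, LinearMap.sum_apply]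
  refine Finset.sum_congr rfl fun s _ => ?_
  rw [map_smul, eval_rename, LinearMap.smul_apply, hm.eval_expand]

theorem eval_newTerm (m : Ops F A) (v : α → A) (u w : Op) (a b c d e : FreeAlg F α) :
    eval m v (newTerm F (freeMul u) (freeMul w) a b c d e) =
      newTerm F (m u) (m w) (eval m v a) (eval m v b) (eval m v c) (eval m v d) (eval m v e) := by
  simp [newTerm, eval_freeMul]

theorem eval_newLL6 {m : Ops F A} (hm : IsAI m) (v : ℕ → A) (u : Op) :
    eval (brackets m) v (newLL6 F u u.swap) = 0 := by
  cases u with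
  | circ => exact eval_newLL6_circ hm v
  | bullet =>
    have hm' : IsAI fun w => m w.swap :=
      ⟨fun w => hm.assoc w.swap, fun w a b c d => hm.interchange w.swap a b c d⟩
    have h := eval_newLL6_circ hm' v
    simp only [newLL6, map_sum, map_smul, eval_newTerm, eval_X] at h ⊢
    exact h

/-! ### The linearization of the new identity -/

theorem isBracketId_linearize_newLL6 (u : Op) : IsBracketId (linearize (newLL6 F u u.swap)) := by
  refine isBracketId_of_eval_eq_zero ?_
  simp only [linearize, map_sub, eval_subst, eval_newLL6 (isAI_mulAI _), sub_zero]

/-- The terms of the linearization, with `a` replaced by the indeterminates `0, 1` and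
`b, c, d, e` by `2, 3, 4, 5`. -/
def polarMonos (u w : Op) : List (ℤ × Mono (Fin 6)) :=
  let x := var 0
  let y := var 1
  let b := var 2
  let c := var 3
  let d := var 4
  let e := var 5
  [(2, op w (op u x b) (op u y (op w c (op u d e)))),
   (2, op w (op u y b) (op u x (op w c (op u d e)))),
   (-2, op w (op u x b) (op u c (op w y (op u d e)))),
   (-2, op w (op u y b) (op u c (op w x (op u d e)))),
   (2, op w (op u x b) (op u c (op w d (op u y e)))),
   (2, op w (op u y b) (op u c (op w d (op u x e)))),
   (-1, op w (op u b c) (op u x (op w d (op u y e)))),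
   (-1, op w (op u b c) (op u y (op w d (op u x e)))),
   (1, op w (op u b c) (op u d (op w x (op u y e)))),
   (1, op w (op u b c) (op u d (op w y (op u x e)))),
   (1, op w (op u x b) (op u (op u y c) (op w d e))),
   (1, op w (op u y b) (op u (op u x c) (op w d e))),
   (2, op w (op u x b) (op u (op u c d) (op w y e))),
   (2, op w (op u y b) (op u (op u c d) (op w x e))),
   (1, op w (op u b c) (op u (op u x d) (op w y e))),
   (1, op w (op u b c) (op u (op u y d) (op w x e))),
   (1, op w (op u x (op u y b)) (op u c (op w d e))),
   (1, op w (op u y (op u x b)) (op u c (op w d e))),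
   (-1, op w (op u x (op u b c)) (op u d (op w y e))),
   (-1, op w (op u y (op u b c)) (op u d (op w x e))),
   (1, op w (op u b (op u x c)) (op u y (op w d e))),
   (1, op w (op u b (op u y c)) (op u x (op w d e)))]

/-- The action of a permutation on the indeterminates `2, 3, 4, 5`. -/
def shift (s : Equiv.Perm (Fin 4)) : Equiv.Perm (Fin 6) :=
  finSumFinEquiv.permCongr (Equiv.sumCongr (1 : Equiv.Perm (Fin 2)) s)

theorem polarization_newTerm (u w : Op) (r : Fin 6 → α) :
    newTerm F (freeMul u) (freeMul w) (X (r 0) + X (r 1)) (X (r 2)) (X (r 3)) (X (r 4)) (X (r 5)) -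
      newTerm F (freeMul u) (freeMul w) (X (r 0)) (X (r 2)) (X (r 3)) (X (r 4)) (X (r 5)) -
      newTerm F (freeMul u) (freeMul w) (X (r 1)) (X (r 2)) (X (r 3)) (X (r 4)) (X (r 5)) =
    rename r (toPoly (polarMonos u w)) := by
  simp only [polarMonos, newTerm, toPoly_cons, toPoly_nil, map_add, map_smul, rename_mono,
    Mono.rename, X, freeMul_mono, add_zero, LinearMap.add_apply, smul_add]
  simp only [Int.cast_neg, Int.cast_ofNat, Int.cast_one, neg_smul, one_smul]
  abel_nf

theorem linearize_newLL6 (u w : Op) : linearize (newLL6 F u w) =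
    ∑ s : Equiv.Perm (Fin 4), ((Equiv.Perm.sign s : ℤ) : F) •
      rename (shift s) (toPoly (polarMonos u w)) := by
  simp only [linearize, newLL6, map_sum, map_smul, eval_newTerm, eval_X, ← Finset.sum_sub_distrib,
    ← smul_sub]
  refine Finset.sum_congr rfl fun s _ => ?_
  rw [← polarization_newTerm]
  have h (i : Fin 4) : (X (Fin.ofNat 6 ((s i : ℕ) + 1 + 1)) : FreeAlg F (Fin 6)) =
      X (shift s (Fin.natAdd 2 i)) := by
    congr 1
    simp only [shift, Equiv.permCongr_apply, Equiv.sumCongr_apply]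
    rw [show (Fin.natAdd 2 i : Fin 6) = finSumFinEquiv (Sum.inr i) from rfl,
      Equiv.symm_apply_apply, Sum.map_inr, finSumFinEquiv_apply_right]
    ext
    simp only [Fin.val_ofNat, Fin.val_natAdd]
    omega
  have h0 := h 0
  have h1 := h 1
  have h2 := h 2
  have h3 := h 3
  simp only [Nat.add_eq_zero_iff, one_ne_zero, and_false, if_false, if_true]
  rw [h0, h1, h2, h3]
  rfl

theorem toPoly_mem_of_mono_mem {L : List (ℤ × Mono α)} {I : Submodule F (FreeAlg F α)}
    (h : ∀ p ∈ L, monoBasis F α p.2 ∈ I) : toPoly L ∈ I := by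
  refine list_sum_mem fun x hx => ?_
  obtain ⟨p, hp, rfl⟩ := List.mem_map.mp hx
  exact I.smul_mem _ (h p hp)

theorem linearize_newLL6_mem_allIds (u : Op) : linearize (newLL6 F u u.swap) ∈ allIds F 6 := by
  rw [mem_allIds_iff]
  refine ⟨?_, isBracketId_linearize_newLL6 u⟩
  rw [linearize_newLL6]
  refine Submodule.sum_mem _ fun s _ => Submodule.smul_mem _ _ (rename_mem_multilinear _ ?_)
  refine toPoly_mem_of_mono_mem fun p hp => mono_mem_multilinear ?_
  revert p
  cases u <;> decide +kernel

/-- The coefficient of `T` in the expansion of `t`, in computable form. The comparison of the sizes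
only saves time. -/
def count [DecidableEq α] (T t : Mono α) : ℤ :=
  if T.size == t.size then ((expandMono t).map fun p => if beq p.2 T then p.1 else 0).sum else 0

theorem coef_mono [DecidableEq α] (T t : Mono α) : coef T (monoBasis F _ t) = (count T t : F) := by
  rw [count]
  split
  · rw [coef_apply, expand_mono]
    generalize expandMono t = L
    induction L with
    | nil => simp
    | cons p L ih =>
      rw [toPoly_cons, map_add, Finsupp.add_apply, ih, List.map_cons, List.sum_cons, Int.cast_add,
        map_smul, Module.Basis.repr_self, Finsupp.smul_apply, Finsupp.single_apply]
      by_cases h : p.2 = T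
      · rw [if_pos h, if_pos ((beq_iff _ _).mpr h), smul_eq_mul, mul_one]
      · rw [if_neg h, if_neg (fun h' => h ((beq_iff _ _).mp h')), smul_zero, Int.cast_zero]
  next h =>
    rw [Int.cast_zero]
    refine coef_mono_eq_zero_of_vars_ne fun hv => h ?_
    rw [beq_iff_eq, ← card_vars, ← card_vars, hv]

/-- The coefficient of `S w T` in an expansion, in computable form. -/
def countPair [DecidableEq α] (w : Op) (S T : Mono α) : Mono α → ℤ
  | .var _ => 0
  | .op w' s t => if w' = w then count S s * count T t - count S t * count T s else 0

theorem coef_op_mono [DecidableEq α] {w : Op} {S T : Mono α} (hS : S.rooted w = false)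
    (hT : T.rooted w = false) (t : Mono α) :
    coef (op w S T) (monoBasis F _ t) = (countPair w S T t : F) := by
  have h := congrFun (coefMono_op (F := F) hS hT) t
  rw [coefMono] at h
  rw [h]
  cases t with
  | var x => simp [pair, countPair]
  | op w' s t =>
    rw [pair, countPair]
    split
    · simp [coefMono, coef_mono]
    · simp

/-- The coefficient of `S w T` in the expansion of the linearized new identity, in computable
form. -/
def countAll (u w : Op) (S T : Mono (Fin 6)) : ℤ :=
  ∑ s : Equiv.Perm (Fin 4), (Equiv.Perm.sign s : ℤ) *
    ((polarMonos u w).map fun p => p.1 * countPair w S T (p.2.rename (shift s))).sum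

theorem coef_linearize_newLL6 (u w : Op) {S T : Mono (Fin 6)} (hS : S.rooted w = false)
    (hT : T.rooted w = false) :
    coef (op w S T) (linearize (newLL6 F u w)) = (countAll u w S T : F) := by
  rw [linearize_newLL6, map_sum, countAll, Int.cast_sum]
  refine Finset.sum_congr rfl fun s _ => ?_
  rw [map_smul, smul_eq_mul, Int.cast_mul]
  congr 1
  generalize polarMonos u w = L
  induction L with
  | nil => simp
  | cons p L ih =>
    rw [toPoly_cons, map_add, map_add, ih, map_smul, map_smul, rename_mono,
      coef_op_mono hS hT, List.map_cons, List.sum_cons, Int.cast_add, Int.cast_mul, smul_eq_mul]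

open Equiv (Perm swap)

/-! ### Potentials -/

section Potential

variable {ι : Type*} [DecidableEq ι] [Finite ι]

theorem eq_of_forall_mul_swap_eq {γ : Type*} {φ : Perm ι → γ} {P : ι → Prop}
    (hφ : ∀ i j, P i → P j → ∀ π, φ (π * swap i j) = φ π) {π ρ : Perm ι}
    (h : ∀ i, ¬ P i → π i = ρ i) : φ π = φ ρ := by
  classical
  have hswaps (τ : Perm {x // P x}) : ∀ π, φ (π * Perm.ofSubtype τ) = φ π := by
    induction τ using Perm.swap_induction_on with
    | one => simp
    | swap_mul τ x y _ ih =>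
      intro π
      rw [map_mul, Perm.ofSubtype_swap_eq, ← mul_assoc, ih, hφ x y x.2 y.2]
  have hfix (x : ι) (hx : ¬ P x) : (π⁻¹ * ρ) x = x := by
    rw [Perm.mul_apply, ← h x hx, ← Perm.mul_apply, inv_mul_cancel, Perm.one_apply]
  have hP (x : ι) : P ((π⁻¹ * ρ) x) ↔ P x := by
    by_cases hx : P x
    · refine iff_of_true (by_contra fun hσ => hσ ?_) hx
      rwa [(π⁻¹ * ρ).injective (hfix _ hσ)]
    · rw [hfix x hx]
  rw [← hswaps ((π⁻¹ * ρ).subtypePerm hP) π, Perm.ofSubtype_subtypePerm hP,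
    mul_inv_cancel_left]
  exact fun x hσ => by_contra fun hx => hσ (hfix x hx)

/-- `hadd` is a cocycle condition at the places `p`, `q`, and the value at a permutation that maps
`p` to the base point `r` serves as the potential. -/
theorem exists_potential {M : Type*} [AddCommGroup M] {φ : Perm ι → M} {p q r : ι}
    (hpq : p ≠ q) (hpr : p ≠ r) (hqr : q ≠ r)
    (hswap : ∀ i j, i ≠ p ∧ i ≠ q → j ≠ p ∧ j ≠ q → ∀ π, φ (π * swap i j) = φ π)
    (hneg : ∀ π, φ (π * swap p q) = -φ π)
    (hadd : ∀ π, φ π - φ (π * swap p r) + φ (π * (swap p r * swap r q)) = 0) :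
    ∃ h : ι → M, ∀ π, φ π = h (π q) - h (π p) := by
  have hφ {π ρ : Perm ι} (hp : π p = ρ p) (hq : π q = ρ q) : φ π = φ ρ := by
    refine eq_of_forall_mul_swap_eq hswap fun i hi => ?_
    obtain rfl | rfl : i = p ∨ i = q := by tauto
    exacts [hp, hq]
  have hbase {x : ι} {π : Perm ι} (hx : x ≠ r) (hp : π p = r) (hq : π q = x) :
      φ π = φ (swap q x * swap p r) := by
    refine hφ ?_ ?_
    · rw [hp, Perm.mul_apply, Equiv.swap_apply_left, Equiv.swap_apply_of_ne_of_ne hqr.symm hx.symm]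
    · rw [hq, Perm.mul_apply, Equiv.swap_apply_of_ne_of_ne hpq.symm hqr, Equiv.swap_apply_left]
  refine ⟨fun x => if x = r then 0 else φ (swap q x * swap p r), fun π => ?_⟩
  have hne : π p ≠ π q := π.injective.ne hpq
  by_cases hp : π p = r
  · have hq : π q ≠ r := hp ▸ hne.symm
    simp only [hp, hq, if_true, if_false, sub_zero, hbase hq hp rfl]
  by_cases hq : π q = r
  · simp only [hp, hq, if_true, if_false, zero_sub]
    rw [← hbase hp (π := π * swap p q) (by simpa using hq) (by simp), hneg, neg_neg]
  obtain ⟨k, hkr⟩ := π.surjective r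
  have hkp : k ≠ p := fun h => hp (h ▸ hkr)
  have hkq : k ≠ q := fun h => hq (h ▸ hkr)
  set ρ := π * swap r k with hρ
  have hρp : ρ p = π p := by
    rw [hρ, Perm.mul_apply, Equiv.swap_apply_of_ne_of_ne hpr hkp.symm]
  have hρq : ρ q = π q := by
    rw [hρ, Perm.mul_apply, Equiv.swap_apply_of_ne_of_ne hqr hkq.symm]
  have hρr : ρ r = r := by rw [hρ, Perm.mul_apply, Equiv.swap_apply_left, hkr]
  have hρ₁ : φ (ρ * swap p r) = φ (swap q (π q) * swap p r) :=
    hbase hq (by simpa using hρr)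
      (by rw [Perm.mul_apply, Equiv.swap_apply_of_ne_of_ne hpq.symm hqr, hρq])
  have hρ₂ : φ (ρ * (swap p r * swap r q)) = φ (swap q (π p) * swap p r) := by
    refine hbase hp ?_ ?_
    · rw [← mul_assoc, Perm.mul_apply, Perm.mul_apply, Equiv.swap_apply_of_ne_of_ne hpr hpq,
        Equiv.swap_apply_left, hρr]
    · rw [← mul_assoc, Perm.mul_apply, Perm.mul_apply, Equiv.swap_apply_right,
        Equiv.swap_apply_right, hρp]
  simp only [hp, hq, if_false]
  rw [hφ hρp.symm hρq.symm, ← hρ₁, ← hρ₂, ← sub_eq_zero, ← hadd ρ]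
  abel

end Potential

/-- The coefficients at `(a ∘ (b • c)) • (d ∘ e ∘ f)`, `∘` being `u`, as a function of the
permutation of the indeterminates. -/
def coefB (u : Op) (f : FreeAlg F (Fin 6)) (π : Perm (Fin 6)) : F :=
  coef (treeB u (π 0) (π 1) (π 2) (π 3) (π 4) (π 5)) f

/-- The function `h` is a potential of `f` for the operation `u` if the coefficients `coefB u f`
are, up to sign, the differences of its values at the letters in the places `3` and `5`. -/
def HasPotential (u : Op) (f : FreeAlg F (Fin 6)) (h : Fin 6 → F) : Prop :=
  ∀ π, ((Perm.sign π : ℤ) : F) * coefB u f π = h (π 5) - h (π 3)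

theorem coefB_mul_swap [NeZero (2 : F)] (u : Op) {f : FreeAlg F (Fin 6)} (hf : f ∈ allIds F 6)
    {i j : Fin 6} (hi : i ≠ 3 ∧ i ≠ 5) (hj : j ≠ 3 ∧ j ≠ 5) (hij : i ≠ j) (π : Perm (Fin 6)) :
    coefB u f (π * swap i j) = -coefB u f π := by
  have trans {i j k : Fin 6} (hij : i ≠ j) (hik : i ≠ k)
      (h : ∀ π, coefB u f (π * swap i j) = -coefB u f π)
      (h' : ∀ π, coefB u f (π * swap j k) = -coefB u f π) (π) :
      coefB u f (π * swap i k) = -coefB u f π := by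
    rw [Equiv.swap_comm i k, ← Equiv.swap_mul_swap_mul_swap hij hik, ← mul_assoc, ← mul_assoc, h',
      h, h', neg_neg]
  have h01 (π) : coefB u f (π * swap 0 1) = -coefB u f π := coef_treeB_swap_first u hf _ _ _ _ _ _
  have h12 (π) : coefB u f (π * swap 1 2) = -coefB u f π := coef_treeB_swap_left u f _ _ _ _ _ _
  have h24 (π) : coefB u f (π * swap 2 4) = -coefB u f π := coef_treeB_swap_mid u hf _ _ _ _ _ _
  have h02 := trans (by decide) (by decide) h01 h12
  have h14 := trans (by decide) (by decide) h12 h24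
  have h04 := trans (by decide) (by decide) h01 h14
  wlog hlt : i < j generalizing i j
  · rw [Equiv.swap_comm]
    exact this hj hi hij.symm (hij.lt_or_gt.resolve_left hlt)
  fin_cases i <;> fin_cases j <;> first
    | exact absurd hlt (by decide)
    | exact absurd rfl hi.1
    | exact absurd rfl hi.2
    | exact absurd rfl hj.1
    | exact absurd rfl hj.2
    | exact h01 π
    | exact h02 π
    | exact h04 π
    | exact h12 π
    | exact h14 π
    | exact h24 π

theorem exists_hasPotential [NeZero (2 : F)] (u : Op) {f : FreeAlg F (Fin 6)}
    (hf : f ∈ allIds F 6) : ∃ h, HasPotential u f h := by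
  refine exists_potential (p := 3) (q := 5) (r := 4) (by decide) (by decide) (by decide) ?_ ?_ ?_
  · intro i j hi hj π
    obtain rfl | hij := eq_or_ne i j
    · rw [Equiv.swap_self, ← Perm.one_def, mul_one]
    · rw [coefB_mul_swap u hf hi hj hij, Perm.sign_mul, Perm.sign_swap hij]
      simp
  · intro π
    have h : coefB u f (π * swap 3 5) = coefB u f π := coef_treeB_reverse_right u f _ _ _ _ _ _
    rw [h, Perm.sign_mul, Perm.sign_swap (by decide)]
    simp
  · intro π
    have h : coefB u f π + coefB u f (π * swap 3 4) + coefB u f (π * (swap 3 4 * swap 4 5)) = 0 :=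
      coef_treeB_shuffle u f _ _ _ _ _ _
    rw [Perm.sign_mul, Perm.sign_mul, Perm.sign_mul, Perm.sign_swap (by decide),
      Perm.sign_swap (by decide)]
    push_cast
    linear_combination ((Perm.sign π : ℤ) : F) * h

/-! ### The signed permutation representation -/

section SignedRep

variable {ι : Type*}

theorem eq_zero_of_sum_eq_zero_of_const [Fintype ι] [CharZero F] {v : ι → F} (hv : ∑ x, v x = 0)
    (hc : ∀ x y, v x = v y) : v = 0 := by
  funext x
  rw [Finset.sum_congr rfl fun y _ => hc y x, Finset.sum_const, smul_eq_zero] at hv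
  have : Nonempty ι := ⟨x⟩
  exact hv.resolve_left Fintype.card_ne_zero

variable [DecidableEq ι]

variable (F) in
/-- The difference of the unit vectors at `a` and `b`; for `a ≠ b` it generates the vectors of
coordinate sum zero as a module. -/
def rootVector (a b : ι) : ι → F := Pi.single a 1 - Pi.single b 1

theorem rootVector_ne_zero {a b : ι} (hab : a ≠ b) : rootVector F a b ≠ 0 := fun h => by
  have ha := congrFun h a
  simp [rootVector, hab] at ha

variable [Fintype ι]

theorem sign_cast_mul_self (s : Perm ι) :
    ((Perm.sign s : ℤ) : F) * ((Perm.sign s : ℤ) : F) = 1 := by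
  rw [← Int.cast_mul, ← Units.val_mul, Int.units_mul_self, Units.val_one, Int.cast_one]

variable (F ι) in
/-- The permutation representation of the symmetric group on vectors, tensored with the sign
representation. Its vectors of coordinate sum zero form the module `[2 1^(n - 2)]`. -/
def signedRep : Representation F (Perm ι) (ι → F) where
  toFun s := ((Perm.sign s : ℤ) : F) • LinearMap.funLeft F F ⇑s⁻¹
  map_one' := by
    ext v x
    simp
  map_mul' s t := by
    ext v x
    simp [mul_assoc, mul_left_comm]

theorem signedRep_apply (s : Perm ι) (v : ι → F) (x : ι) :
    signedRep F ι s v x = ((Perm.sign s : ℤ) : F) * v (s⁻¹ x) := rfl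

/-- The action of the group algebra on vectors through `signedRep`. -/
abbrev actVec (r : F[Perm ι]) (v : ι → F) : ι → F := (signedRep F ι).asAlgebraHom r v

theorem sum_actVec (r : F[Perm ι]) {v : ι → F} (hv : ∑ x, v x = 0) : ∑ x, actVec r v x = 0 := by
  unfold actVec
  induction r using MonoidAlgebra.induction_linear with
  | zero => simp
  | add r s hr hs =>
    simp only [map_add, LinearMap.add_apply, Pi.add_apply, Finset.sum_add_distrib]
    rw [hr, hs, add_zero]
  | single s c =>
    simp only [Representation.asAlgebraHom_single, LinearMap.smul_apply, Pi.smul_apply,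
      signedRep_apply, smul_eq_mul, ← Finset.mul_sum]
    rw [Equiv.sum_comp s⁻¹ v, hv, mul_zero, mul_zero]

theorem sum_rootVector (a b : ι) : ∑ x, rootVector F a b x = 0 := by
  simp [rootVector]

theorem signedRep_rootVector (s : Perm ι) (a b : ι) :
    signedRep F ι s (rootVector F a b) =
      ((Perm.sign s : ℤ) : F) • rootVector F (s a) (s b) := by
  ext x
  simp only [signedRep_apply, rootVector, Pi.sub_apply, Pi.smul_apply, Pi.single_apply,
    Perm.inv_eq_iff_eq, smul_eq_mul]

theorem actVec_single_rootVector (s : Perm ι) (a b : ι) :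
    actVec (MonoidAlgebra.single s ((Perm.sign s : ℤ) : F)) (rootVector F a b) =
      rootVector F (s a) (s b) := by
  rw [actVec, Representation.asAlgebraHom_single, LinearMap.smul_apply, signedRep_rootVector,
    smul_smul, sign_cast_mul_self, one_smul]

theorem eq_sum_smul_rootVector {v : ι → F} (hv : ∑ x, v x = 0) (b : ι) :
    v = ∑ x, v x • rootVector F x b := by
  simp only [rootVector, smul_sub, Finset.sum_sub_distrib, ← Finset.sum_smul, hv, zero_smul,
    sub_zero]
  exact pi_eq_sum_univ' v

theorem exists_actVec_rootVector_eq {a b : ι} (hab : a ≠ b) {v : ι → F} (hv : ∑ x, v x = 0) :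
    ∃ r, actVec r (rootVector F a b) = v := by
  suffices v ∈ LinearMap.range
      (LinearMap.applyₗ (rootVector F a b) ∘ₗ (signedRep F ι).asAlgebraHom.toLinearMap) from this
  rw [eq_sum_smul_rootVector hv b]
  refine Submodule.sum_mem _ fun x _ => Submodule.smul_mem _ _ ?_
  obtain rfl | hxb := eq_or_ne x b
  · rw [show rootVector F x x = 0 from sub_self _]
    exact Submodule.zero_mem _
  · refine ⟨MonoidAlgebra.single (swap a x) ((Perm.sign (swap a x) : ℤ) : F),
      (actVec_single_rootVector _ a b).trans ?_⟩
    rw [Equiv.swap_apply_left, Equiv.swap_apply_of_ne_of_ne hab.symm hxb.symm]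

theorem actVec_one_add_swap {i j : ι} (hij : i ≠ j) (v : ι → F) :
    actVec (1 + MonoidAlgebra.single (swap i j) 1) v = (v i - v j) • rootVector F i j := by
  ext x
  simp only [actVec, rootVector, map_add, map_one, LinearMap.add_apply, Module.End.one_apply,
    Pi.add_apply, Representation.asAlgebraHom_single_one, signedRep_apply, Perm.sign_swap hij,
    Equiv.swap_inv, Pi.smul_apply, Pi.sub_apply, Pi.single_apply, smul_eq_mul]
  obtain rfl | hxi := eq_or_ne x i
  · simp [hij, ← sub_eq_add_neg]
  obtain rfl | hxj := eq_or_ne x j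
  · simp [hij.symm, ← sub_eq_add_neg]
  · simp [Equiv.swap_apply_of_ne_of_ne hxi hxj, hxi, hxj]

theorem exists_actVec_eq_of_ne {v w : ι → F} {i j : ι} (hij : v i ≠ v j) (hw : ∑ x, w x = 0) :
    ∃ r, actVec r v = w := by
  have hne : i ≠ j := fun h => hij (congrArg v h)
  obtain ⟨r, hr⟩ := exists_actVec_rootVector_eq hne hw
  refine ⟨(v i - v j)⁻¹ • (r * (1 + MonoidAlgebra.single (swap i j) 1)), ?_⟩
  rw [actVec, map_smul, map_mul, LinearMap.smul_apply, Module.End.mul_apply,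
    ← actVec, ← actVec, actVec_one_add_swap hne, actVec, map_smul, ← actVec, hr, smul_smul,
    inv_mul_cancel₀ (sub_ne_zero.mpr hij), one_smul]

end SignedRep

/-! ### The Specht module -/

theorem isSimpleModule_span_singleton {R M : Type*} [Ring R] [AddCommGroup M] [Module R M] {x : M}
    (hx : x ≠ 0) (h : ∀ r : R, r • x ≠ 0 → ∃ s : R, s • r • x = x) :
    IsSimpleModule R (Submodule.span R {x}) := by
  rw [isSimpleModule_iff_toSpanSingleton_surjective]
  refine ⟨⟨⟨⟨x, Submodule.mem_span_singleton_self x⟩, 0, fun h0 => hx (congrArg Subtype.val h0)⟩⟩,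
    ?_⟩
  rintro ⟨y, hy⟩ hne ⟨z, hz⟩
  obtain ⟨r, rfl⟩ := Submodule.mem_span_singleton.mp hy
  obtain ⟨t, rfl⟩ := Submodule.mem_span_singleton.mp hz
  obtain ⟨s, hs⟩ := h r fun h0 => hne (Subtype.ext h0)
  refine ⟨t * s, Subtype.ext ?_⟩
  change (t * s) • r • x = t • x
  rw [mul_smul, hs]

theorem nonempty_span_singleton_equiv {R M N : Type*} [Ring R] [AddCommGroup M] [Module R M]
    [AddCommGroup N] [Module R N] {x : M} {y : N} (h : ∀ r : R, r • x = 0 ↔ r • y = 0) :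
    Nonempty (Submodule.span R {x} ≃ₗ[R] Submodule.span R {y}) := by
  have hker : LinearMap.ker (LinearMap.toSpanSingleton R M x) =
      LinearMap.ker (LinearMap.toSpanSingleton R N y) := by
    ext r
    simp [h]
  exact ⟨(LinearEquiv.ofEq _ _ (LinearMap.range_toSpanSingleton x)).symm ≪≫ₗ
    (LinearMap.quotKerEquivRange _).symm ≪≫ₗ Submodule.quotEquivOfEq _ _ hker ≪≫ₗ
    LinearMap.quotKerEquivRange _ ≪≫ₗ LinearEquiv.ofEq _ _ (LinearMap.range_toSpanSingleton y)⟩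

theorem isSimpleModule_span_of_smul_eq_zero_iff [CharZero F] {ι M : Type*} [Fintype ι]
    [DecidableEq ι] [AddCommGroup M] [Module F[Perm ι] M] {x : M} {a b : ι} (hab : a ≠ b)
    (hx : ∀ r : F[Perm ι], r • x = 0 ↔ actVec r (rootVector F a b) = 0) :
    IsSimpleModule F[Perm ι] (Submodule.span F[Perm ι] {x}) := by
  refine isSimpleModule_span_singleton (fun h0 => ?_) fun r hr => ?_
  · refine rootVector_ne_zero (F := F) hab ?_
    simpa [actVec] using (hx 1).mp (by rw [h0, smul_zero])
  · obtain ⟨i, j, hij⟩ : ∃ i j, actVec r (rootVector F a b) i ≠ actVec r (rootVector F a b) j := by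
      by_contra! hc
      exact hr ((hx r).mpr
        (eq_zero_of_sum_eq_zero_of_const (sum_actVec r (sum_rootVector a b)) hc))
    obtain ⟨s, hs⟩ := exists_actVec_eq_of_ne hij (sum_rootVector a b)
    refine ⟨s, ?_⟩
    rw [← mul_smul, ← sub_eq_zero]
    nth_rewrite 2 [← one_smul F[Perm ι] x]
    rw [← sub_smul, hx, actVec, map_sub, map_mul, map_one, LinearMap.sub_apply,
      Module.End.mul_apply, Module.End.one_apply, sub_eq_zero]
    exact hs

variable (F) in
/-- The Young symmetrizer that generates `specht21111`. -/
abbrev youngElement : F[Perm (Fin 6)] :=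
  youngSymmetrizer F ![0, 0, 1, 2, 3, 4] ![0, 1, 0, 0, 0, 0]

theorem coeff_sum_smul_of {G : Type*} [Group G] [Fintype G] (P : G → Prop) [DecidablePred P]
    (c : G → F) (π : G) : (∑ g with P g, c g • MonoidAlgebra.of F G g).coeff π =
      if P π then c π else 0 := by
  rw [MonoidAlgebra.coeff_sum, Finsupp.finsetSum_apply, Finset.sum_filter,
    Finset.sum_eq_single π]
  · simp
  · intro g _ hg
    split <;> simp [hg]
  · simp

theorem youngElement_eq : youngElement F =
    (1 + MonoidAlgebra.single (swap 0 1) 1) * ∑ g : Perm (Fin 6) with g 1 = 1,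
      ((Perm.sign g : ℤ) : F) • MonoidAlgebra.of F _ g := by
  have hcol (g : Perm (Fin 6)) : (∀ i, ![0, 1, 0, 0, 0, 0] (g i) = (![0, 1, 0, 0, 0, 0] i : ℕ)) ↔
      g 1 = 1 := by
    revert g
    decide +kernel
  have hrow (g : Perm (Fin 6)) : (∀ i, ![0, 0, 1, 2, 3, 4] (g i) = (![0, 0, 1, 2, 3, 4] i : ℕ)) ↔
      g = 1 ∨ g = swap 0 1 := by
    revert g
    decide +kernel
  have hpair : (Finset.univ.filter fun g : Perm (Fin 6) => g = 1 ∨ g = swap 0 1) =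
      {1, swap 0 1} := by ext g; simp
  simp only [youngElement, youngSymmetrizer, hrow, hcol]
  rw [Finset.filter_congr_decidable, hpair, Finset.sum_pair (by decide), map_one]
  rfl

theorem coeff_youngElement (π : Perm (Fin 6)) :
    (youngElement F).coeff π = ((Perm.sign π : ℤ) : F) * rootVector F 1 0 (π 1) := by
  have hswap : swap 0 1 (π 1) = 1 ↔ π 1 = 0 := by
    rw [Equiv.swap_apply_eq_iff, Equiv.swap_apply_right]
  rw [youngElement_eq, add_mul, one_mul, MonoidAlgebra.coeff_add, Finsupp.add_apply,
    MonoidAlgebra.coeff_single_mul_apply, coeff_sum_smul_of, coeff_sum_smul_of, one_mul,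
    Perm.mul_apply, Equiv.swap_inv, Perm.sign_mul, Perm.sign_swap (by decide), rootVector,
    Pi.sub_apply, Pi.single_apply, Pi.single_apply]
  simp only [hswap]
  by_cases h1 : π 1 = 1
  · simp [h1]
  · by_cases h0 : π 1 = 0 <;> simp [h1, h0]

theorem coeff_mul_youngElement (r : F[Perm (Fin 6)]) (π : Perm (Fin 6)) :
    (r * youngElement F).coeff π =
      ((Perm.sign π : ℤ) : F) * actVec r (rootVector F 1 0) (π 1) := by
  unfold actVec
  induction r using MonoidAlgebra.induction_linear with
  | zero => simp
  | add r s hr hs =>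
    rw [add_mul, MonoidAlgebra.coeff_add, Finsupp.add_apply, hr, hs, map_add,
      LinearMap.add_apply, Pi.add_apply, mul_add]
  | single s c =>
    rw [MonoidAlgebra.coeff_single_mul_apply, coeff_youngElement,
      Representation.asAlgebraHom_single, LinearMap.smul_apply, Pi.smul_apply, signedRep_apply,
      Perm.sign_mul, Perm.sign_inv, Perm.mul_apply, smul_eq_mul]
    push_cast
    ring

theorem smul_youngElement_eq_zero_iff (r : F[Perm (Fin 6)]) :
    r • youngElement F = 0 ↔ actVec r (rootVector F 1 0) = 0 := by
  rw [smul_eq_mul]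
  constructor
  · intro h0
    funext x
    have h := coeff_mul_youngElement r (swap 1 x)
    rw [h0, Equiv.swap_apply_left, MonoidAlgebra.coeff_zero, Finsupp.zero_apply] at h
    rw [Pi.zero_apply]
    linear_combination -((Perm.sign (swap 1 x) : ℤ) : F) * h -
      actVec r (rootVector F 1 0) x * sign_cast_mul_self (F := F) (swap 1 x)
  · intro h0
    ext π
    rw [coeff_mul_youngElement, h0]
    simp

/-! ### The action of the group algebra on identities -/

section ActPoly

variable {n : ℕ}

/-- The action of the group algebra on polynomials through `permRep`. -/
abbrev actPoly (r : F[Perm (Fin n)]) (f : FreeAlg F (Fin n)) : FreeAlg F (Fin n) :=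
  (permRep F n).asAlgebraHom r f

theorem actPoly_mem_allIds (r : F[Perm (Fin n)]) {f : FreeAlg F (Fin n)} (hf : f ∈ allIds F n) :
    actPoly r f ∈ allIds F n :=
  (permRep F n).asAlgebraHom_mem_of_forall_mem _ (fun g _ hv => rename_mem_allIds g hv) f hf r

theorem actPoly_mem_consequences (S : Set (FreeAlg F ℕ)) (r : F[Perm (Fin n)])
    {f : FreeAlg F (Fin n)} (hf : f ∈ consequences S (Fin n)) :
    actPoly r f ∈ consequences S (Fin n) :=
  (permRep F n).asAlgebraHom_mem_of_forall_mem _ (fun g _ hv => rename_mem_consequences S g hv) f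
    hf r

theorem newClass_eq_zero_iff {f : FreeAlg F (Fin n)} (hf : f ∈ allIds F n) :
    newClass f hf = 0 ↔ f ∈ oldIds F n := by
  rw [newClass, LinearEquiv.map_eq_zero_iff, Submodule.Quotient.mk_eq_zero]
  rfl

theorem newClass_surjective (x : NewModule F n) :
    ∃ (f : FreeAlg F (Fin n)) (hf : f ∈ allIds F n), newClass f hf = x := by
  obtain ⟨⟨f, hf⟩, h⟩ := Submodule.Quotient.mk_surjective _ ((newRep F n).asModuleEquiv x)
  exact ⟨f, hf, by rw [newClass, h, LinearEquiv.symm_apply_apply]⟩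

theorem newClass_sub {f g : FreeAlg F (Fin n)} (hf : f ∈ allIds F n) (hg : g ∈ allIds F n) :
    newClass (f - g) (sub_mem hf hg) = newClass f hf - newClass g hg := rfl

theorem smul_newClass (r : F[Perm (Fin n)]) {f : FreeAlg F (Fin n)} (hf : f ∈ allIds F n) :
    r • newClass f hf = newClass (actPoly r f) (actPoly_mem_allIds r hf) := by
  suffices h : ∃ hr : actPoly r f ∈ allIds F n, r • newClass f hf = newClass (actPoly r f) hr from
    h.2
  induction r using MonoidAlgebra.induction_linear with
  | zero =>
    have h0 : actPoly (0 : F[Perm (Fin n)]) f = 0 := by simp [actPoly]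
    simp only [h0, zero_smul]
    exact ⟨zero_mem _, rfl⟩
  | add r s hr hs =>
    obtain ⟨hr, er⟩ := hr
    obtain ⟨hs, es⟩ := hs
    have hadd : actPoly (r + s) f = actPoly r f + actPoly s f := by simp [actPoly]
    simp only [hadd, add_smul, er, es]
    exact ⟨add_mem hr hs, rfl⟩
  | single s c =>
    have hsingle : actPoly (MonoidAlgebra.single s c) f = c • rename s f := by
      rw [actPoly, Representation.asAlgebraHom_single]
      rfl
    simp only [hsingle]
    refine ⟨Submodule.smul_mem _ c (rename_mem_allIds s hf), ?_⟩
    apply (newRep F n).asModuleEquiv.injective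
    rw [Representation.asModuleEquiv_map_smul, Representation.asAlgebraHom_single]
    rfl

end ActPoly

section HasPotential

variable {u : Op} {f g : FreeAlg F (Fin 6)} {h k : Fin 6 → F}

theorem HasPotential.add (hf : HasPotential u f h) (hg : HasPotential u g k) :
    HasPotential u (f + g) (h + k) := fun π => by
  have hfπ := hf π
  have hgπ := hg π
  rw [coefB] at hfπ hgπ ⊢
  rw [map_add, mul_add, hfπ, hgπ, Pi.add_apply, Pi.add_apply]
  ring

theorem HasPotential.smul (c : F) (hf : HasPotential u f h) : HasPotential u (c • f) (c • h) :=
  fun π => by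
    have hfπ := hf π
    rw [coefB] at hfπ ⊢
    rw [map_smul, smul_eq_mul, Pi.smul_apply, Pi.smul_apply, smul_eq_mul, smul_eq_mul]
    linear_combination c * hfπ

theorem HasPotential.sub (hf : HasPotential u f h) (hg : HasPotential u g k) :
    HasPotential u (f - g) (h - k) := by
  simpa only [neg_one_smul, ← sub_eq_add_neg] using hf.add (hg.smul (-1))

theorem coefB_rename (u : Op) (s : Perm (Fin 6)) (f : FreeAlg F (Fin 6)) (π : Perm (Fin 6)) :
    coefB u (rename s f) π = coefB u f (s⁻¹ * π) :=
  (coef_rename_perm s⁻¹ _ f).symm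

theorem HasPotential.rename (hf : HasPotential u f h) (s : Perm (Fin 6)) :
    HasPotential u (rename s f) (signedRep F _ s h) := fun π => by
  have hfπ := hf (s⁻¹ * π)
  rw [Perm.sign_mul, Perm.sign_inv, Perm.mul_apply, Perm.mul_apply] at hfπ
  push_cast at hfπ
  rw [signedRep_apply, signedRep_apply, coefB_rename]
  linear_combination ((Perm.sign s : ℤ) : F) * hfπ -
    ((Perm.sign π : ℤ) : F) * coefB u f (s⁻¹ * π) * sign_cast_mul_self (F := F) s

theorem HasPotential.actPoly (hf : HasPotential u f h) (r : F[Perm (Fin 6)]) :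
    HasPotential u (actPoly r f) (actVec r h) := by
  unfold Interchange.actPoly actVec
  induction r using MonoidAlgebra.induction_linear with
  | zero => intro π; simp [coefB]
  | add r s hr hs => simpa only [map_add, LinearMap.add_apply] using hr.add hs
  | single s c =>
    simp only [Representation.asAlgebraHom_single, LinearMap.smul_apply]
    exact (hf.rename s).smul c

theorem HasPotential.sub_eq_sub (hh : HasPotential u f h) (hk : HasPotential u f k) (x y : Fin 6) :
    h x - h y = k x - k y := by
  obtain rfl | hxy := eq_or_ne x y
  · rw [sub_self, sub_self]
  · set s := swap 5 x with hs
    have hy : s y ≠ 5 := fun h => by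
      rw [hs, Equiv.swap_apply_eq_iff, Equiv.swap_apply_left] at h
      exact hxy h.symm
    have hx5 : (s * swap 3 (s y)) 5 = x := by
      rw [Perm.mul_apply, Equiv.swap_apply_of_ne_of_ne (by decide) hy.symm, hs,
        Equiv.swap_apply_left]
    have hy3 : (s * swap 3 (s y)) 3 = y := by
      rw [Perm.mul_apply, Equiv.swap_apply_left, hs, Equiv.swap_apply_self]
    have hπ := (hh (s * swap 3 (s y))).symm.trans (hk (s * swap 3 (s y)))
    rwa [hx5, hy3] at hπ

theorem HasPotential.apply_eq_of_rename_swap [NeZero (2 : F)] (hf : HasPotential u f h)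
    {i j : Fin 6} (hij : i ≠ j) (hs : Interchange.rename (swap i j) f = -f) : h i = h j := by
  have hsmul : HasPotential u (Interchange.rename (swap i j) f) ((-1 : F) • h) := by
    rw [hs, ← neg_one_smul F f]
    exact hf.smul (-1)
  have hneg := (hf.rename (swap i j)).sub_eq_sub hsmul i j
  simp only [signedRep_apply, Perm.sign_swap hij, Equiv.swap_inv, Equiv.swap_apply_left,
    Equiv.swap_apply_right, Pi.smul_apply, smul_eq_mul] at hneg
  push_cast at hneg
  refine sub_eq_zero.mp ((mul_eq_zero.mp ?_).resolve_left (two_ne_zero (α := F)))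
  linear_combination hneg

theorem HasPotential.sub_apply_eq_of_rename_swap (hf : HasPotential u f h) {i j k : Fin 6}
    (hij : i ≠ j) (hik : i ≠ k) (hjk : j ≠ k) (hs : Interchange.rename (swap i j) f = f) :
    h i - h k = -(h j - h k) := by
  have hfix := (hf.rename (swap i j)).sub_eq_sub (hs.symm ▸ hf) i k
  simp only [signedRep_apply, Perm.sign_swap hij, Equiv.swap_inv, Equiv.swap_apply_left,
    Equiv.swap_apply_of_ne_of_ne hik.symm hjk.symm] at hfix
  push_cast at hfix
  linear_combination -hfix

theorem mem_oldIds_iff_of_hasPotential [CharZero F] (hf : f ∈ allIds F 6) {h : Op → Fin 6 → F}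
    (hh : ∀ u, HasPotential u f (h u)) : f ∈ oldIds F 6 ↔ ∀ u x y, h u x = h u y := by
  rw [mem_oldIds_iff]
  constructor
  · rintro ⟨-, hexpand⟩ u x y
    have hzero : HasPotential u f 0 := fun π => by
      rw [coefB, (expand_eq_zero_iff f).mp hexpand]
      simp
    simpa [sub_eq_zero] using (hh u).sub_eq_sub hzero x y
  · intro hconst
    refine ⟨hf.1, expand_eq_zero_of_treeB hf fun u a b c d e g => ?_⟩
    by_cases hb : Function.Bijective ![a, b, c, d, e, g]
    · have hπ := hh u (Equiv.ofBijective _ hb)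
      rw [hconst u _ ((Equiv.ofBijective _ hb) 3), sub_self] at hπ
      exact (mul_eq_zero.mp hπ).resolve_left
        (left_ne_zero_of_mul_eq_one (sign_cast_mul_self (F := F) _))
    · exact coef_rename_of_not_bijective hb (treeB u 0 1 2 3 4 5) hf.1

end HasPotential

/-! ### The potentials of the new identity -/

theorem shift_mul (s t : Perm (Fin 4)) : shift (s * t) = shift s * shift t := by
  ext x
  simp only [shift, Equiv.permCongr_apply, Perm.mul_apply, Equiv.symm_apply_apply]
  rcases (finSumFinEquiv (m := 2) (n := 4)).symm x with x | x <;> rfl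

theorem swap_mul_shift (s : Perm (Fin 4)) : swap 0 1 * shift s = shift s * swap 0 1 := by
  revert s
  decide +kernel

theorem rename_mul {n : ℕ} (s t : Perm (Fin n)) (f : FreeAlg F (Fin n)) :
    rename s (rename t f) = rename (s * t : Perm (Fin n)) f :=
  (LinearMap.congr_fun ((permRep F n).map_mul s t) f).symm

theorem rename_shift_linearize_newLL6 (u w : Op) (t : Perm (Fin 4)) :
    rename (shift t) (linearize (newLL6 F u w)) =
      ((Perm.sign t : ℤ) : F) • linearize (newLL6 F u w) := by
  simp only [linearize_newLL6, map_sum, map_smul, Finset.smul_sum, rename_mul, ← shift_mul,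
    smul_smul]
  refine Fintype.sum_equiv (Equiv.mulLeft t) _ _ fun s => ?_
  rw [Equiv.coe_mulLeft, Perm.sign_mul, Units.val_mul, Int.cast_mul, ← mul_assoc,
    sign_cast_mul_self, one_mul]

theorem rename_swap_linearize_newLL6 (u w : Op) :
    rename (swap 0 1 : Perm (Fin 6)) (linearize (newLL6 F u w)) = linearize (newLL6 F u w) := by
  have hpolar : rename (swap 0 1 : Perm (Fin 6)) (toPoly (polarMonos u w) : FreeAlg F (Fin 6)) =
      rename (1 : Perm (Fin 6)) (toPoly (polarMonos u w)) := by
    rw [← polarization_newTerm, ← polarization_newTerm, sub_right_comm,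
      add_comm (X (swap 0 1 0))]
    rfl
  simp only [linearize_newLL6, map_sum, map_smul, rename_mul, swap_mul_shift]
  refine Finset.sum_congr rfl fun s _ => ?_
  rw [← rename_mul, hpolar, rename_mul, mul_one]

variable (F) in
/-- The complete linearization of the new identity in which the bracket `u` plays the role of
`[-,-]_∘`. -/
abbrev newId (u : Op) : FreeAlg F (Fin 6) := linearize (newLL6 F u u.swap)

theorem hasPotential_newId_swap (u : Op) : HasPotential u.swap (newId F u) 0 := by
  intro π
  suffices coefB u.swap (newId F u) π = 0 by simp [this]
  rw [newId, linearize_newLL6, coefB, map_sum]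
  refine Finset.sum_eq_zero fun s _ => ?_
  have hroot : ∀ p ∈ polarMonos u u.swap, p.2.rooted u.swap = true := by
    cases u <;> decide +kernel
  have hker : toPoly (polarMonos u u.swap) ∈ LinearMap.ker (coef
      (treeB u.swap (π 0) (π 1) (π 2) (π 3) (π 4) (π 5)) ∘ₗ rename (F := F) (shift s)) := by
    refine toPoly_mem_of_mono_mem fun p hp => ?_
    have hp' := hroot p hp
    generalize p.2 = t at hp'
    cases t with
    | var x => simp at hp'
    | op w a b =>
      rw [rooted_op, decide_eq_true_eq] at hp'
      rw [LinearMap.mem_ker, LinearMap.comp_apply, rename_mono, Mono.rename, hp', ← freeMul_mono]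
      exact coef_freeMul_of_not_rooted (by cases u <;> rfl) _ _
  rw [map_smul, ← LinearMap.comp_apply, LinearMap.mem_ker.mp hker, smul_zero]

theorem countAll_eq_four (u : Op) :
    countAll u u.swap (op u (var 3) (op u.swap (var 5) (var 2)))
      (op u (var 0) (op u (var 4) (var 1))) = 4 := by
  cases u <;> decide +kernel

theorem HasPotential.newId_sub {u : Op} {h : Fin 6 → F} (hh : HasPotential u (newId F u) h) :
    h 1 - h 0 = 4 := by
  have hπ := hh (swap 3 0 * swap 5 1)
  have hcoef : coefB u (newId F u) (swap 3 0 * swap 5 1) = ((4 : ℤ) : F) := by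
    rw [← countAll_eq_four u]
    exact coef_linearize_newLL6 u u.swap (by simp) (by simp)
  rw [hcoef, Perm.sign_mul, Perm.sign_swap (by decide), Perm.sign_swap (by decide)] at hπ
  push_cast at hπ
  rw [one_mul] at hπ
  exact hπ.symm

theorem hasPotential_newId [NeZero (2 : F)] (u : Op) :
    HasPotential u (newId F u) ((2 : F) • rootVector F 1 0) := by
  obtain ⟨h, hh⟩ := exists_hasPotential (F := F) u (linearize_newLL6_mem_allIds u)
  have hodd (i j : Fin 6) (t : Perm (Fin 4)) (ht : shift t = swap i j) (hsign : Perm.sign t = -1)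
      (hij : i ≠ j) : h i = h j := by
    refine hh.apply_eq_of_rename_swap hij ?_
    rw [← ht, rename_shift_linearize_newLL6, hsign]
    simp
  have h2 (i : Fin 6) (hi : 2 ≤ i) : h i = h 2 := by
    obtain rfl | rfl | rfl | rfl : i = 2 ∨ i = 3 ∨ i = 4 ∨ i = 5 := by omega
    · rfl
    · exact hodd 3 2 (swap 1 0) (by decide) (by decide) (by decide)
    · exact hodd 4 2 (swap 2 0) (by decide) (by decide) (by decide)
    · exact hodd 5 2 (swap 3 0) (by decide) (by decide) (by decide)
  have h01 : h 0 - h 2 = -(h 1 - h 2) :=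
    hh.sub_apply_eq_of_rename_swap (by decide) (by decide) (by decide)
      (rename_swap_linearize_newLL6 u u.swap)
  have hval : h 1 - h 0 = 4 := hh.newId_sub
  have hroot (x : Fin 6) : h x = h 2 + 2 * rootVector F 1 0 x := by
    have h0 : h 0 = h 2 - 2 := by
      refine mul_left_cancel₀ (two_ne_zero (α := F)) ?_
      linear_combination h01 - hval
    have h1 : h 1 = h 2 + 2 := by
      refine mul_left_cancel₀ (two_ne_zero (α := F)) ?_
      linear_combination h01 + hval
    by_cases hx : 2 ≤ x
    · have hx0 : x ≠ 0 := by rintro rfl; exact absurd hx (by decide)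
      have hx1 : x ≠ 1 := by rintro rfl; exact absurd hx (by decide)
      simp [rootVector, h2 x hx, hx0, hx1]
    · obtain rfl | rfl : x = 0 ∨ x = 1 := by omega
      · simp [rootVector, h0, sub_eq_add_neg]
      · simp [rootVector, h1]
  intro π
  rw [hh π, hroot (π 5), hroot (π 3), Pi.smul_apply, Pi.smul_apply, smul_eq_mul, smul_eq_mul]
  ring

/-! ### The module of new identities -/

theorem hasPotential_actPoly_newId [NeZero (2 : F)] (u w : Op) (r : F[Perm (Fin 6)]) :
    HasPotential w (actPoly r (newId F u))
      (if w = u then (2 : F) • actVec r (rootVector F 1 0) else 0) := by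
  obtain rfl | rfl : w = u ∨ w = u.swap := by cases u <;> cases w <;> simp [Op.swap]
  · simpa only [if_true, map_smul] using (hasPotential_newId w).actPoly r
  · simpa using (hasPotential_newId_swap u).actPoly r

theorem actVec_rootVector_eq_zero_of_const [CharZero F] {r : F[Perm (Fin 6)]}
    (h : ∀ x y, ((2 : F) • actVec r (rootVector F 1 0)) x =
      ((2 : F) • actVec r (rootVector F 1 0)) y) : actVec r (rootVector F 1 0) = 0 :=
  eq_zero_of_sum_eq_zero_of_const (sum_actVec r (sum_rootVector 1 0)) fun x y =>
    mul_left_cancel₀ two_ne_zero (h x y)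

theorem actPoly_newId_mem_oldIds_iff [CharZero F] (u : Op) (r : F[Perm (Fin 6)]) :
    actPoly r (newId F u) ∈ oldIds F 6 ↔ actVec r (rootVector F 1 0) = 0 := by
  rw [mem_oldIds_iff_of_hasPotential (actPoly_mem_allIds r (linearize_newLL6_mem_allIds u))
    fun w => hasPotential_actPoly_newId u w r]
  constructor
  · intro h
    exact actVec_rootVector_eq_zero_of_const (by simpa using h u)
  · intro h
    simp [h]

theorem smul_newClass_newId_eq_zero_iff [CharZero F] (u : Op) (r : F[Perm (Fin 6)]) :
    r • newClass (newId F u) (linearize_newLL6_mem_allIds u) = 0 ↔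
      actVec r (rootVector F 1 0) = 0 := by
  rw [smul_newClass, newClass_eq_zero_iff, actPoly_newId_mem_oldIds_iff]

theorem exists_hasPotential_actVec_add_const [CharZero F] (u : Op) {f : FreeAlg F (Fin 6)}
    (hf : f ∈ allIds F 6) : ∃ (r : F[Perm (Fin 6)]) (c : F),
      HasPotential u f ((2 : F) • actVec r (rootVector F 1 0) + Function.const _ c) := by
  obtain ⟨h, hh⟩ := exists_hasPotential u hf
  set c : F := (∑ x, h x) / 6 with hc
  have hsum : ∑ x, (2⁻¹ : F) * (h x - c) = 0 := by
    rw [← Finset.mul_sum, Finset.sum_sub_distrib, Finset.sum_const, hc, Finset.card_univ,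
      Fintype.card_fin, nsmul_eq_mul, Nat.cast_ofNat, mul_div_cancel₀ _ (by norm_num), sub_self,
      mul_zero]
  obtain ⟨r, hr⟩ := exists_actVec_rootVector_eq (a := 1) (b := 0) (by decide) hsum
  refine ⟨r, c, ?_⟩
  convert hh using 1
  ext x
  simp [hr]

theorem exists_sub_mem_oldIds [CharZero F] {f : FreeAlg F (Fin 6)} (hf : f ∈ allIds F 6) :
    ∃ r s : F[Perm (Fin 6)],
      f - actPoly r (newId F .circ) - actPoly s (newId F .bullet) ∈ oldIds F 6 := by
  choose r c hr using fun u => exists_hasPotential_actVec_add_const u hf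
  have hmem (u : Op) : actPoly (r u) (newId F u) ∈ allIds F 6 :=
    actPoly_mem_allIds _ (linearize_newLL6_mem_allIds u)
  refine ⟨r .circ, r .bullet, (mem_oldIds_iff_of_hasPotential
    (sub_mem (sub_mem hf (hmem .circ)) (hmem .bullet)) fun w =>
      ((hr w).sub (hasPotential_actPoly_newId .circ w _)).sub
        (hasPotential_actPoly_newId .bullet w _)).mpr ?_⟩
  rintro (_ | _) x y <;> simp

theorem disjoint_newSpan [CharZero F] :
    Disjoint (newSpan (newId F .circ) (linearize_newLL6_mem_allIds .circ))
      (newSpan (newId F .bullet) (linearize_newLL6_mem_allIds .bullet)) := by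
  rw [Submodule.disjoint_def]
  intro x hx hx'
  obtain ⟨r, rfl⟩ := Submodule.mem_span_singleton.mp hx
  obtain ⟨s, hs⟩ := Submodule.mem_span_singleton.mp hx'
  have hr := actPoly_mem_allIds r (linearize_newLL6_mem_allIds (F := F) .circ)
  have hs' := actPoly_mem_allIds s (linearize_newLL6_mem_allIds (F := F) .bullet)
  rw [eq_comm, ← sub_eq_zero, smul_newClass, smul_newClass, ← newClass_sub hr hs',
    newClass_eq_zero_iff, mem_oldIds_iff_of_hasPotential (sub_mem hr hs') fun w =>
      (hasPotential_actPoly_newId .circ w r).sub (hasPotential_actPoly_newId .bullet w s)] at hs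
  rw [smul_newClass_newId_eq_zero_iff]
  exact actVec_rootVector_eq_zero_of_const (by simpa using hs .circ)

theorem codisjoint_newSpan [CharZero F] :
    Codisjoint (newSpan (newId F .circ) (linearize_newLL6_mem_allIds .circ))
      (newSpan (newId F .bullet) (linearize_newLL6_mem_allIds .bullet)) := by
  rw [codisjoint_iff, eq_top_iff]
  rintro x -
  obtain ⟨f, hf, rfl⟩ := newClass_surjective x
  obtain ⟨r, s, h⟩ := exists_sub_mem_oldIds hf
  have hr := actPoly_mem_allIds r (linearize_newLL6_mem_allIds (F := F) .circ)
  have hs := actPoly_mem_allIds s (linearize_newLL6_mem_allIds (F := F) .bullet)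
  rw [← newClass_eq_zero_iff (sub_mem (sub_mem hf hr) hs), newClass_sub (sub_mem hf hr) hs,
    newClass_sub hf hr, ← smul_newClass r (linearize_newLL6_mem_allIds .circ),
    ← smul_newClass s (linearize_newLL6_mem_allIds .bullet), sub_sub, sub_eq_zero] at h
  rw [h]
  exact Submodule.add_mem_sup (Submodule.smul_mem _ _ (Submodule.mem_span_singleton_self _))
    (Submodule.smul_mem _ _ (Submodule.mem_span_singleton_self _))

/-! ### Consequences of the new identities -/

theorem linearize_mem_consequences {S : Set (FreeAlg F ℕ)} {g : FreeAlg F ℕ} (hg : g ∈ S) :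
    linearize g ∈ consequences S (Fin 6) :=
  sub_mem (sub_mem (subst_mem_consequences hg _) (subst_mem_consequences hg _))
    (subst_mem_consequences hg _)

theorem mem_allIds_of_mem_consequences {S : Set (FreeAlg F ℕ)}
    (hS : ∀ g ∈ S, g ∈ lieIds F ∨ ∃ u : Op, g = newLL6 F u u.swap) {n : ℕ}
    {f : FreeAlg F (Fin n)} (hf : f ∈ multilinear F n) (hc : f ∈ consequences S (Fin n)) :
    f ∈ allIds F n := by
  refine (mem_allIds_iff f).mpr ⟨hf, isBracketId_of_eval_eq_zero
    (consequences_le_ker_eval (fun g hg v => ?_) _ hc)⟩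
  rcases hS g hg with hg | ⟨u, rfl⟩
  · exact (isLie_brackets_of_assoc (isAI_mulAI _).assoc).eval_eq_zero hg v
  · exact eval_newLL6 (isAI_mulAI _) v u

theorem mem_consequences_of_mem_allIds [CharZero F] {S : Set (FreeAlg F ℕ)} (hL : lieIds F ⊆ S)
    (hS : ∀ u : Op, newLL6 F u u.swap ∈ S) {f : FreeAlg F (Fin 6)} (hf : f ∈ allIds F 6) :
    f ∈ consequences S (Fin 6) := by
  obtain ⟨r, s, h⟩ := exists_sub_mem_oldIds hf
  have hle : consequences (lieIds F) (Fin 6) ≤ consequences S (Fin 6) :=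
    consequences_le fun g hg => by
      rw [← subst_X g]
      exact subst_mem_consequences (hL hg) X
  have hnew (u : Op) (r : F[Perm (Fin 6)]) : actPoly r (newId F u) ∈ consequences S (Fin 6) :=
    actPoly_mem_consequences S r (linearize_mem_consequences (hS u))
  rw [mem_oldIds_iff, ← mem_consequences_lieIds_iff] at h
  exact (Submodule.sub_mem_iff_left _ (hnew .circ r)).mp
    ((Submodule.sub_mem_iff_left _ (hnew .bullet s)).mp (hle h.2))

end Interchange

end

open Interchange in
theorem mainTheorem2 (F : Type*) [Field F] [CharZero F] :
    allIds F 6 = multilinear F 6 ⊓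
        consequences
          {anticomm F .circ, anticomm F .bullet, jacobi F .circ, jacobi F .bullet,
            newLL6 F .circ .bullet, newLL6 F .bullet .circ} (Fin 6) ∧
      ∃ (h₁ : linearize (newLL6 F .circ .bullet) ∈ allIds F 6)
        (h₂ : linearize (newLL6 F .bullet .circ) ∈ allIds F 6),
        IsSimpleModule F[Equiv.Perm (Fin 6)] (newSpan _ h₁) ∧
        IsSimpleModule F[Equiv.Perm (Fin 6)] (newSpan _ h₂) ∧
        Nonempty (newSpan _ h₁ ≃ₗ[F[Equiv.Perm (Fin 6)]] specht21111 F) ∧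
        Nonempty (newSpan _ h₂ ≃ₗ[F[Equiv.Perm (Fin 6)]] specht21111 F) ∧
        IsCompl (newSpan _ h₁) (newSpan _ h₂) := by
  refine ⟨?_, linearize_newLL6_mem_allIds .circ, linearize_newLL6_mem_allIds .bullet,
    isSimpleModule_span_of_smul_eq_zero_iff (by decide) (smul_newClass_newId_eq_zero_iff .circ),
    isSimpleModule_span_of_smul_eq_zero_iff (by decide) (smul_newClass_newId_eq_zero_iff .bullet),
    nonempty_span_singleton_equiv fun r =>
      (smul_newClass_newId_eq_zero_iff .circ r).trans (smul_youngElement_eq_zero_iff r).symm,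
    nonempty_span_singleton_equiv fun r =>
      (smul_newClass_newId_eq_zero_iff .bullet r).trans (smul_youngElement_eq_zero_iff r).symm,
    ⟨disjoint_newSpan, codisjoint_newSpan⟩⟩
  apply le_antisymm
  · refine fun f hf => ⟨hf.1, mem_consequences_of_mem_allIds ?_ ?_ hf⟩
    · rintro g (rfl | rfl | rfl | rfl) <;> simp
    · rintro (_ | _) <;> simp [Op.swap]
  · refine fun f hf => mem_allIds_of_mem_consequences ?_ hf.1 hf.2
    rintro g (rfl | rfl | rfl | rfl | rfl | rfl)
    exacts [.inl (anticomm_mem_lieIds _), .inl (anticomm_mem_lieIds _), .inl (jacobi_mem_lieIds _),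
      .inl (jacobi_mem_lieIds _), .inr ⟨.circ, rfl⟩, .inr ⟨.bullet, rfl⟩]
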